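/- **Conventions.** Let $G$ be a finite group and $\mathcal Orb_G$ its orbit category (objects $G/H$, morphisms the $G$-maps). "Functor" means pseudofunctor. $\mathcal Sym$ is the 2-category of symmetric monoidal categories, strong symmetric monoidal functors and monoidal natural transformations. A *symmetric monoidal coefficient system* is a pseudofunctor $\mathcal Orb_G^{op}\to\mathcal Sym$, $X\mapsto\mathcal C(X)$, $f\mapsto f^*$ (restriction). An *indexing system* $\mathcal O$ is a full (replete) sub coefficient system of $G/H\mapsto\{\text{finite }G\text{-sets over }G/H\}\simeq\{\text{finite }H\text{-sets}\}$ that is closed under finite disjoint unions, contains $G/G$, is closed under finite limits, and is closed under self-induction: if $H/K\in\mathcal O(G/H)$ and $T\in\mathcal O(G/K)$ then $H\times_KT\in\mathcal O(G/H)$. A map $f:X\to Y$ of orbits is *admissible* if, as a $G$-set over $Y$, it lies in $\mathcal O(Y)$ (for $K\le H$: $G/K\to G/H$ is admissible iff $H/K\in\mathcal O(G/H)$). An *$\mathcal O$-symmetric monoidal Mackey functor* $\mathcal C$ is a symmetric monoidal coefficient system with strong symmetric monoidal norms $N_f:\mathcal C(X)\to\mathcal C(Y)$ for the admissible maps $f:X\to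 Y$ of orbits (written $N_K^H$ for $G/K\to G/H$), pseudofunctorial in $f$, and with the double coset formula: for $f:X\to Y$ admissible, $g:Z\to Y$ any map of orbits, and any decomposition $Z\times_YX=\coprod_iW_i$ into orbits with projections $p_i:W_i\to Z$ and $q_i:W_i\to X$, a monoidal natural isomorphism $$g^*N_f\;\cong\;\textstyle\bigotimes_i N_{p_i}q_i^*,$$ that is, $i_L^*N_K^H\cong\bigotimes_{LxK\in L\backslash H/K}N^L_{L\cap xKx^{-1}}\,c_x\, i^*_{x^{-1}Lx\cap K}$, with $c_x$ conjugation by $x$. An *$\mathcal O$-commutative monoid* in $\mathcal C$ is a commutative monoid $R$ in $\mathcal C(G/G)$, with restriction $R_X\in\mathcal C(X)$ along $X\to G/G$ (so $R_{G/H}=i_H^*R$), together with maps of commutative monoids $\nu_f:N_fR_X\to R_Y$ for all admissible $f:X\to Y$, compatible with identities and composition of admissible maps, and compatible with restriction: under the double coset isomorphism, $g^*\nu_f$ corresponds to the product in $R_Z$ of the maps $\nu_{p_i}:N_{p_i}q_i^*R_X\cong N_{p_i}R_{W_i}\to R_Z$. **Theorem.** Let $\mathcal C$ be an $\mathcal O$-symmetric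 monoidal Mackey functor. Assume that every $\mathcal C(X)$ has reflexive coequalizers and that these are preserved by the tensor product in each variable, by all restrictions and by all norms. Let $R$ be an $\mathcal O$-commutative monoid in $\mathcal C$. Then there is an $\mathcal O$-symmetric monoidal Mackey functor $R\text{-}\mathrm{Mod}$ such that: 1. its value at an orbit $X$ is the category of $R_X$-modules in $\mathcal C(X)$, with the tensor product $M\otimes_{R_X}N$ (the coequalizer of $M\otimes R_X\otimes N\rightrightarrows M\otimes N$), the unit $R_X$, and the associativity, unit and symmetry isomorphisms induced from $\mathcal C(X)$; 2. the restriction of an $R_Y$-module $M$ along $f:X\to Y$ is $f^*M$ with the action of $R_X\cong f^*R_Y$, with pseudofunctor structure that of $\mathcal C$; 3. for admissible $f:X\to Y$, its norm is the relative norm $${}_RN_f(M)=R_Y\otimes_{N_fR_X}N_fM,\qquad\text{i.e. } {}_RN_K^H(M)=i_H^*R\otimes_{N_K^Hi_K^*R}N_K^HM,$$ where $N_fR_X$ acts on $R_Y$ through $\nu_f$; these are strong symmetric monoidal functors, and the maps $N_fM\to{}_RN_f(M)$ are natural, monoidal and compatible with the identity and composition isomorphisms of the two systems of norms; 4. it satisfies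 the double coset formula for the relative norms and the tensor products $\otimes_{R_Z}$, with double coset isomorphisms induced by those of $\mathcal C$. -/

import Mathlib

open CategoryTheory MonoidalCategory Limits Opposite
open scoped MonObj Obj

universe w v u

namespace EqSym

/-! ## The 2-category of symmetric monoidal categories -/

/-- A (bundled) symmetric monoidal category. -/
structure SymMonCat where
  /-- the objects -/
  carrier : Type u
  [cat : Category.{v} carrier]
  [mon : MonoidalCategory carrier]
  [sym : SymmetricCategory carrier]

namespace SymMonCat

instance : CoeSort SymMonCat.{v, u} (Type u) := ⟨SymMonCat.carrier⟩

attribute [instance] SymMonCat.cat SymMonCat.mon SymMonCat.sym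

/-- A strong symmetric monoidal functor. -/
structure Hom (A B : SymMonCat.{v, u}) where
  /-- the underlying functor -/
  functor : A ⥤ B
  [braided : functor.Braided]

attribute [instance] Hom.braided

/-- A monoidal natural transformation. -/
@[ext]
structure Hom₂ {A B : SymMonCat.{v, u}} (F F' : Hom A B) where
  /-- the underlying natural transformation -/
  nat : F.functor ⟶ F'.functor
  [isMonoidal : NatTrans.IsMonoidal nat]

attribute [instance] Hom₂.isMonoidal

instance (A B : SymMonCat.{v, u}) : Category (Hom A B) where
  Hom := Hom₂
  id F := { nat := 𝟙 F.functor }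
  comp a b := { nat := a.nat ≫ b.nat }

instance : CategoryStruct SymMonCat.{v, u} where
  Hom := Hom
  id A := { functor := 𝟭 A }
  comp F F' := { functor := F.functor ⋙ F'.functor }

instance homCategory (A B : SymMonCat.{v, u}) : Category (A ⟶ B) :=
  inferInstanceAs (Category (Hom A B))

@[ext]
lemma hom₂_ext {A B : SymMonCat.{v, u}} {F F' : A ⟶ B} {a b : F ⟶ F'} (h : a.nat = b.nat) :
    a = b := Hom₂.ext h

@[simp] lemma id_nat {A B : SymMonCat.{v, u}} (F : A ⟶ B) :
    Hom₂.nat (𝟙 F) = 𝟙 F.functor := rfl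

@[simp] lemma comp_nat {A B : SymMonCat.{v, u}} {F F' F'' : A ⟶ B} (a : F ⟶ F')
    (b : F' ⟶ F'') : (a ≫ b).nat = a.nat ≫ b.nat := rfl

/-- A natural isomorphism that is monoidal is an invertible 2-morphism. -/
def mkIso {A B : SymMonCat.{v, u}} {F F' : A ⟶ B} (e : F.functor ≅ F'.functor)
    [NatTrans.IsMonoidal e.hom] : F ≅ F' where
  hom := { nat := e.hom }
  inv := { nat := e.inv }

@[simp] lemma id_functor (A : SymMonCat.{v, u}) : Hom.functor (𝟙 A) = 𝟭 A.carrier := rfl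

@[simp] lemma comp_functor {A B D : SymMonCat.{v, u}} (F : A ⟶ B) (F' : B ⟶ D) :
    (F ≫ F').functor = F.functor ⋙ F'.functor := rfl

@[simp] lemma mkIso_hom_nat {A B : SymMonCat.{v, u}} {F F' : A ⟶ B}
    (e : F.functor ≅ F'.functor) [NatTrans.IsMonoidal e.hom] : (mkIso e).hom.nat = e.hom := rfl

@[simp] lemma mkIso_inv_nat {A B : SymMonCat.{v, u}} {F F' : A ⟶ B}
    (e : F.functor ≅ F'.functor) [NatTrans.IsMonoidal e.hom] : (mkIso e).inv.nat = e.inv := rfl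

/-- Symmetric monoidal categories, strong symmetric monoidal functors and monoidal natural
transformations form a bicategory. -/
instance bicategory : Bicategory SymMonCat.{v, u} where
  homCategory := homCategory
  whiskerLeft F _ _ a := { nat := Functor.whiskerLeft F.functor a.nat }
  whiskerRight a F := { nat := Functor.whiskerRight a.nat F.functor }
  associator F F' F'' := mkIso (Functor.associator F.functor F'.functor F''.functor)
  leftUnitor F := mkIso F.functor.leftUnitor
  rightUnitor F := mkIso F.functor.rightUnitor
  whiskerLeft_id _ _ := hom₂_ext (by ext; simp)
  whiskerLeft_comp _ _ _ _ _ _ := hom₂_ext (by ext; simp)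
  id_whiskerLeft _ := hom₂_ext (by ext; simp)
  comp_whiskerLeft _ _ _ _ _ := hom₂_ext (by ext; simp)
  id_whiskerRight _ _ := hom₂_ext (by ext; simp)
  comp_whiskerRight _ _ _ := hom₂_ext (by ext; simp)
  whiskerRight_id _ := hom₂_ext (by ext; simp)
  whiskerRight_comp _ _ _ := hom₂_ext (by ext; simp)
  whisker_assoc _ _ _ _ _ := hom₂_ext (by ext; simp)
  whisker_exchange _ _ := hom₂_ext (by ext; simp)
  pentagon _ _ _ _ := hom₂_ext (by ext; simp)
  triangle _ _ := hom₂_ext (by ext; simp)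

section Tensor

variable {A B : SymMonCat.{v, u}}

lemma tensorμ_braiding {C : Type u} [Category.{v} C] [MonoidalCategory C] [SymmetricCategory C]
    (X₁ X₂ Y₁ Y₂ : C) :
    tensorμ X₁ X₂ Y₁ Y₂ ≫ ((β_ X₁ Y₁).hom ⊗ₘ (β_ X₂ Y₂).hom) =
      (β_ (X₁ ⊗ X₂) (Y₁ ⊗ Y₂)).hom ≫ tensorμ Y₁ Y₂ X₁ X₂ := by
  simp [tensorμ, SymmetricCategory.braiding_swap_eq_inv_braiding X₁ Y₂, MonoidalCategory.tensorHom_def]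

/-- The constant functor at the unit object, as a strong symmetric monoidal functor. -/
instance constUnitMonoidal : ((Functor.const A.carrier).obj (𝟙_ B.carrier)).Monoidal :=
  Functor.CoreMonoidal.toMonoidal
    { εIso := Iso.refl _
      μIso := fun _ _ => λ_ (𝟙_ B.carrier)
      μIso_hom_natural_left := by intros; simp
      μIso_hom_natural_right := by intros; simp
      associativity := by intros; simp; try monoidal
      left_unitality := by intros; simp
      right_unitality := by intros; simp; try monoidal }

instance constUnitBraided : ((Functor.const A.carrier).obj (𝟙_ B.carrier)).Braided where
  braided X Y := by
    change (λ_ (𝟙_ B.carrier)).hom ≫ 𝟙 _ =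
      (β_ (𝟙_ B.carrier) (𝟙_ B.carrier)).hom ≫ (λ_ (𝟙_ B.carrier)).hom
    rw [braiding_leftUnitor, Category.comp_id, unitors_equal]

lemma tensorFunctor_μ (F F' : A ⟶ B) (X Y : A.carrier) :
    Functor.LaxMonoidal.μ (Functor.prod' F.functor F'.functor ⋙ tensor B.carrier) X Y =
      tensorμ _ _ _ _ ≫
        (Functor.LaxMonoidal.μ F.functor X Y ⊗ₘ Functor.LaxMonoidal.μ F'.functor X Y) := by
  rw [Functor.LaxMonoidal.comp_μ, tensor_μ, tensor_map, Functor.prod'_μ_fst,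
    Functor.prod'_μ_snd]
  rfl

instance tensorFunctorBraided (F F' : A ⟶ B) :
    (Functor.prod' F.functor F'.functor ⋙ tensor B.carrier).Braided where
  braided X Y := by
    rw [tensorFunctor_μ, tensorFunctor_μ]
    change (tensorμ _ _ _ _ ≫ (Functor.LaxMonoidal.μ F.functor X Y ⊗ₘ
        Functor.LaxMonoidal.μ F'.functor X Y)) ≫
        (F.functor.map (β_ X Y).hom ⊗ₘ F'.functor.map (β_ X Y).hom) =
      (β_ (F.functor.obj X ⊗ F'.functor.obj X) (F.functor.obj Y ⊗ F'.functor.obj Y)).hom ≫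
        tensorμ _ _ _ _ ≫ (Functor.LaxMonoidal.μ F.functor Y X ⊗ₘ
        Functor.LaxMonoidal.μ F'.functor Y X)
    rw [Category.assoc, MonoidalCategory.tensorHom_comp_tensorHom, Functor.LaxBraided.braided,
      Functor.LaxBraided.braided, ← MonoidalCategory.tensorHom_comp_tensorHom,
      ← Category.assoc, tensorμ_braiding, Category.assoc]

/-- The unit of the pointwise tensor product on strong symmetric monoidal functors `A ⟶ B`. -/
def unitHom (A B : SymMonCat.{v, u}) : A ⟶ B where
  functor := (Functor.const A.carrier).obj (𝟙_ B.carrier)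

/-- The pointwise tensor product `X ↦ F X ⊗ F' X` of strong symmetric monoidal functors. -/
def tensorHom (F F' : A ⟶ B) : A ⟶ B where
  functor := Functor.prod' F.functor F'.functor ⋙ tensor B.carrier

end Tensor

end SymMonCat
/-! ## Orbits, indexing systems -/

/-- An object `G/H` of the orbit category of `G`. -/
structure Orb (G : Type w) [Group G] where
  /-- the subgroup `H` -/
  sub : Subgroup G

namespace Orb

variable {G : Type w} [Group G] [Finite G]

/-- The finite `G`-set `G/H`. -/
def toAction (X : Orb G) : Action FintypeCat.{w} G :=
  Action.FintypeCat.ofMulAction G (FintypeCat.of (G ⧸ X.sub))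

/-- Morphisms of the orbit category are the `G`-maps. -/
instance : Category (Orb G) :=
  inferInstanceAs (Category (InducedCategory (Action FintypeCat.{w} G) Orb.toAction))

/-- The inclusion of the orbit category into finite `G`-sets. -/
def incl : Orb G ⥤ Action FintypeCat.{w} G := inducedFunctor Orb.toAction

/-- The map of sets underlying a map of orbits. -/
def app {X Y : Orb G} (f : X ⟶ Y) (x : G ⧸ X.sub) : G ⧸ Y.sub :=
  (incl.map f).hom x

/-- The terminal orbit `G/G`. -/
def pt (G : Type w) [Group G] : Orb G := ⟨⊤⟩

instance : Subsingleton (G ⧸ (pt G).sub) :=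
  QuotientGroup.subsingleton_quotient_top

/-- The map `G/H ⟶ G/G`. -/
def toPt (X : Orb G) : X ⟶ pt G :=
  InducedCategory.homMk
    { hom := FintypeCat.homMk (fun _ => ((1 : G) : G ⧸ (⊤ : Subgroup G)))
      comm := fun g => by
        ext x
        exact Subsingleton.elim (α := G ⧸ (pt G).sub) _ _ }

lemma hom_pt_ext {X : Orb G} (f g : X ⟶ pt G) : f = g := by
  apply InducedCategory.hom_ext
  apply Action.hom_ext
  ext x
  exact Subsingleton.elim (α := G ⧸ (pt G).sub) _ _

end Orb

/-- An indexing system: a full symmetric monoidal (for disjoint union) sub coefficient system of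
the coefficient system sending `G/H` to the category of finite `G`-sets over `G/H` (that is, of
finite `H`-sets), which contains `G/G`, is closed under finite limits and under
self-induction. -/
structure IndexingSystem (G : Type w) [Group G] [Finite G] where
  /-- the admissible sets: a full subcategory of the finite `G`-sets over each orbit -/
  adm (Y : Orb G) : ObjectProperty (Over (Orb.incl.obj Y))
  iso_closed (Y : Orb G) : (adm Y).IsClosedUnderIsomorphisms
  coprod_closed (Y : Orb G) : (adm Y).IsClosedUnderFiniteCoproducts
  restrict {X Y : Orb G} (f : X ⟶ Y) (T : Over (Orb.incl.obj Y)) :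
    adm Y T → adm X ((Over.pullback (Orb.incl.map f)).obj T)
  terminal : adm (Orb.pt G) (Over.mk (𝟙 _))
  limit_closed (Y : Orb G) (J : Type) [SmallCategory J] [FinCategory J] :
    (adm Y).IsClosedUnderLimitsOfShape J
  induct {X Y : Orb G} (f : X ⟶ Y) (T : Over (Orb.incl.obj X)) :
    adm Y (Over.mk (Orb.incl.map f)) → adm X T → adm Y ((Over.map (Orb.incl.map f)).obj T)

namespace IndexingSystem

variable {G : Type w} [Group G] [Finite G] (O : IndexingSystem G)

/-- The admissible maps of orbits; for `K ≤ H` the projection `G/K ⟶ G/H` is admissible when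
`H/K` is an admissible `H`-set. -/
def admissible : MorphismProperty (Orb G) :=
  fun _ Y f => O.adm Y (Over.mk (Orb.incl.map f))

instance : O.admissible.IsMultiplicative where
  id_mem X := by
    have := O.limit_closed X (Discrete PEmpty)
    have h := (O.adm X).prop_of_isLimit (J := Discrete PEmpty)
      (F := Functor.empty _) (c := asEmptyCone (Over.mk (𝟙 (Orb.incl.obj X))))
      Over.mkIdTerminal (fun j => j.as.elim)
    change O.adm X (Over.mk (Orb.incl.map (𝟙 X)))
    rw [CategoryTheory.Functor.map_id]
    exact h
  comp_mem {X Y Z} f g hf hg := by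
    have h := O.induct g _ hg hf
    change O.adm Z (Over.mk (Orb.incl.map (f ≫ g)))
    rw [CategoryTheory.Functor.map_comp]
    exact h

end IndexingSystem

/-- The orbits with the admissible maps. -/
abbrev AdmOrb {G : Type w} [Group G] [Finite G] (O : IndexingSystem G) :=
  WideSubcategory O.admissible

/-! ## Mackey functors -/

section Pseudo

open scoped Bicategory

/-- A pseudofunctor from a category `I` to a bicategory, with prescribed values on objects.
Composition comparisons are indexed by all factorizations `f ≫ g = fg`, which avoids transport
along equalities of morphisms. -/
structure PseudoOn {I : Type*} [Category* I] {B : Type*} [Bicategory B] (obj : I → B) where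
  /-- the action on morphisms -/
  map {X Y : I} (f : X ⟶ Y) : obj X ⟶ obj Y
  /-- the unit comparison -/
  mapId (X : I) : map (𝟙 X) ≅ 𝟙 (obj X)
  /-- the composition comparison -/
  mapComp {X Y Z : I} (f : X ⟶ Y) (g : Y ⟶ Z) (fg : X ⟶ Z) (h : f ≫ g = fg) :
    map fg ≅ map f ≫ map g
  assoc {W X Y Z : I} (f : W ⟶ X) (g : X ⟶ Y) (k : Y ⟶ Z) (fg : W ⟶ Y) (gk : X ⟶ Z)
    (fgk : W ⟶ Z) (h₁ : f ≫ g = fg) (h₂ : g ≫ k = gk) (h₃ : fg ≫ k = fgk)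
    (h₄ : f ≫ gk = fgk) :
    (mapComp fg k fgk h₃).hom ≫ (mapComp f g fg h₁).hom ▷ map k ≫
        (Bicategory.associator _ _ _).hom =
      (mapComp f gk fgk h₄).hom ≫ map f ◁ (mapComp g k gk h₂).hom
  id_comp {X Y : I} (f : X ⟶ Y) :
    (mapComp (𝟙 X) f f (Category.id_comp f)).hom ≫ (mapId X).hom ▷ map f ≫
      (Bicategory.leftUnitor _).hom = 𝟙 _
  comp_id {X Y : I} (f : X ⟶ Y) :
    (mapComp f (𝟙 Y) f (Category.comp_id f)).hom ≫ map f ◁ (mapId Y).hom ≫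
      (Bicategory.rightUnitor _).hom = 𝟙 _

end Pseudo

variable {G : Type w} [Group G] [Finite G] {O : IndexingSystem G}

/-- A span of orbits `Z ⟵ W ⟶ X` with admissible left leg. -/
structure AdmSpan (Z X : AdmOrb O) where
  /-- the apex `W` -/
  apex : AdmOrb O
  /-- the admissible leg -/
  left : apex ⟶ Z
  /-- the other leg -/
  right : apex.obj ⟶ X.obj

/-- The spans in the list `L` exhibit the pullback `Z ×_Y X` of finite `G`-sets as the disjoint
union of its orbits. For `Z = G/L`, `X = G/K` and `Y = G/H` with `L, K ≤ H`, the orbits are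
the `G/(L ∩ xKx⁻¹)`, with `x` running through representatives of the double cosets `L\H/K`. -/
def IsOrbitDecomposition {X Y Z : AdmOrb O} (f : X ⟶ Y) (g : Z.obj ⟶ Y.obj)
    (L : List (AdmSpan Z X)) : Prop :=
  (∀ s ∈ L, s.left.hom ≫ g = s.right ≫ f.hom) ∧
    ∀ (z : G ⧸ Z.obj.sub) (x : G ⧸ X.obj.sub), Orb.app g z = Orb.app f.hom x →
      ∃! p : (i : Fin L.length) × (G ⧸ (L.get i).apex.obj.sub),
        Orb.app (L.get p.1).left.hom p.2 = z ∧ Orb.app (L.get p.1).right p.2 = x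

variable {obj : Orb G → SymMonCat.{v, u}}

/-- For spans `Z ⟵ Wᵢ ⟶ X` with legs `pᵢ`, `qᵢ`: the functor `M ↦ ⨂ᵢ N_{pᵢ} (qᵢ^* M)`. -/
def transferSum (res : PseudoOn (fun X : (Orb G)ᵒᵖ => obj X.unop))
    (norm : PseudoOn (fun X : AdmOrb O => obj X.obj)) {Z X : AdmOrb O} :
    List (AdmSpan Z X) → (obj X.obj ⟶ obj Z.obj)
  | [] => SymMonCat.unitHom _ _
  | s :: L => SymMonCat.tensorHom (res.map s.right.op ≫ norm.map s.left)
      (transferSum res norm L)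

/-- An `O`-symmetric monoidal Mackey functor with value `obj X` at the orbit `X`: a symmetric
monoidal coefficient system (the pseudofunctor of restrictions), strong symmetric monoidal
norms along admissible maps of orbits, pseudofunctorial, and a double coset isomorphism
`g^* N_f ≅ ⨂ᵢ N_{pᵢ} qᵢ^*` for every decomposition of a pullback into orbits. -/
structure MackeyFunctor (O : IndexingSystem G) (obj : Orb G → SymMonCat.{v, u}) where
  /-- restrictions -/
  res : PseudoOn (fun X : (Orb G)ᵒᵖ => obj X.unop)
  /-- norms -/
  norm : PseudoOn (fun X : AdmOrb O => obj X.obj)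
  /-- the double coset formula -/
  doubleCoset {X Y Z : AdmOrb O} (f : X ⟶ Y) (g : Z.obj ⟶ Y.obj) (L : List (AdmSpan Z X))
    (h : IsOrbitDecomposition f g L) :
    norm.map f ≫ res.map g.op ≅ transferSum res norm L

/-- Levelwise reflexive coequalizers, preserved by the tensor products in each variable, by
restrictions and by norms. -/
structure MackeyFunctor.GoodCoequalizers (C : MackeyFunctor O obj) : Prop where
  has (X : Orb G) : HasReflexiveCoequalizers (obj X).carrier
  tensor (X : Orb G) (M : (obj X).carrier) :
    PreservesColimitsOfShape WalkingReflexivePair (tensorLeft M)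
  res {X Y : Orb G} (f : X ⟶ Y) :
    PreservesColimitsOfShape WalkingReflexivePair (C.res.map f.op).functor
  norm {X Y : AdmOrb O} (f : X ⟶ Y) :
    PreservesColimitsOfShape WalkingReflexivePair (C.norm.map f).functor

/-! ## `O`-commutative monoids -/

/-- A commutative monoid `R` in `C(G/G)` with a map `N_f (R_X) ⟶ R_Y` for each admissible
`f : X ⟶ Y`, where `R_X` is the restriction of `R` to `X`. -/
structure NormData (C : MackeyFunctor O obj) where
  /-- the underlying object -/
  R : (obj (Orb.pt G)).carrier
  [monObj : MonObj R]
  [comm : IsCommMonObj R]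
  /-- the norm maps -/
  nu {X Y : AdmOrb O} (f : X ⟶ Y) :
    (C.norm.map f).functor.obj ((C.res.map (Orb.toPt X.obj).op).functor.obj R) ⟶
      (C.res.map (Orb.toPt Y.obj).op).functor.obj R

namespace NormData

attribute [instance] NormData.monObj NormData.comm

variable {C : MackeyFunctor O obj} (R : NormData C)

/-- The restriction `R_X` of `R` to the orbit `X`. -/
abbrev at' (X : Orb G) : (obj X).carrier := (C.res.map (Orb.toPt X).op).functor.obj R.R

/-- The canonical isomorphism `f^* R_Y ≅ R_X`. -/
def resHom {X Y : Orb G} (f : X ⟶ Y) : (C.res.map f.op).functor.obj (R.at' Y) ⟶ R.at' X :=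
  (C.res.mapComp (Orb.toPt Y).op f.op (Orb.toPt X).op
    (Quiver.Hom.unop_inj (Orb.hom_pt_ext _ _))).inv.nat.app R.R

/-- The product `⨂ᵢ N_{pᵢ} (qᵢ^* R_X) ⟶ R_Z` of the norm maps. -/
def nuProd {Z X : AdmOrb O} : (L : List (AdmSpan Z X)) →
    ((transferSum C.res C.norm L).functor.obj (R.at' X.obj) ⟶ R.at' Z.obj)
  | [] => MonObj.one
  | s :: L => (((C.norm.map s.left).functor.map (R.resHom s.right) ≫ R.nu s.left) ⊗ₘ
      nuProd L) ≫ MonObj.mul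

end NormData

/-- An `O`-commutative monoid. -/
structure OCommMonoid (C : MackeyFunctor O obj) extends NormData C where
  nu_isMonHom {X Y : AdmOrb O} (f : X ⟶ Y) : IsMonHom (toNormData.nu f)
  nu_id (X : AdmOrb O) :
    toNormData.nu (𝟙 X) = (C.norm.mapId X).hom.nat.app (toNormData.at' X.obj)
  nu_comp {X Y Z : AdmOrb O} (f : X ⟶ Y) (g : Y ⟶ Z) :
    toNormData.nu (f ≫ g) = (C.norm.mapComp f g _ rfl).hom.nat.app (toNormData.at' X.obj) ≫
      (C.norm.map g).functor.map (toNormData.nu f) ≫ toNormData.nu g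
  nu_res {X Y Z : AdmOrb O} (f : X ⟶ Y) (g : Z.obj ⟶ Y.obj) (L : List (AdmSpan Z X))
    (h : IsOrbitDecomposition f g L) :
    (C.res.map g.op).functor.map (toNormData.nu f) ≫ toNormData.resHom g =
      (C.doubleCoset f g L h).hom.nat.app (toNormData.at' X.obj) ≫ toNormData.nuProd L

/-! ## Modules -/

section Modules

variable {D : Type u} [Category.{v} D] [MonoidalCategory D] [SymmetricCategory D]

/-- `π : M ⊗ N ⟶ P` exhibits `P` as the balanced tensor product `M ⊗_A N`: it is a coequalizer
of the two maps `M ⊗ A ⊗ N ⇉ M ⊗ N` given by the actions of `A` on `M` and on `N`. -/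
def IsBalancedTensor (A : D) [MonObj A] (M N : D) [ModObj A M] [ModObj A N] {P : D}
    (π : M ⊗ N ⟶ P) : Prop :=
  ∃ w : ((β_ M A).hom ≫ ModObj.smul (M := A) (X := M)) ▷ N ≫ π =
      ((α_ M A N).hom ≫ M ◁ ModObj.smul (M := A) (X := N)) ≫ π,
    Nonempty (IsColimit (Cofork.ofπ π w))

/-- The symmetric monoidal structure on the category of modules over a commutative monoid `A`:
the tensor product of `M` and `N` is `M ⊗_A N` with its induced action, the unit is `A`, and the
associativity, unit and symmetry isomorphisms are induced by those of the ambient category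
(the forgetful functor is lax symmetric monoidal). -/
structure ModTensor (A : D) [MonObj A] [IsCommMonObj A] where
  /-- the monoidal structure -/
  mon : MonoidalCategory (Mod D A)
  /-- the symmetry -/
  sym : SymmetricCategory (Mod D A)
  /-- the structure maps `𝟙 ⟶ A` and `M ⊗ N ⟶ M ⊗_A N` -/
  lax : (Mod.forget (D := D) A).LaxBraided
  unit_iso : IsIso ((ρ_ A).inv ≫ A ◁ Functor.LaxMonoidal.ε (Mod.forget (D := D) A) ≫
    ModObj.smul (M := A) (X := (𝟙_ (Mod D A)).X))
  μ_linear (M N : Mod D A) :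
    A ◁ Functor.LaxMonoidal.μ (Mod.forget A) M N ≫ ModObj.smul (M := A) (X := (M ⊗ N).X) =
      (α_ A M.X N.X).inv ≫ ModObj.smul (M := A) (X := M.X) ▷ N.X ≫
        Functor.LaxMonoidal.μ (Mod.forget A) M N
  μ_balanced (M N : Mod D A) :
    IsBalancedTensor A M.X N.X (Functor.LaxMonoidal.μ (Mod.forget A) M N)

namespace ModTensor

variable {A : D} [MonObj A] [IsCommMonObj A] (T : ModTensor A)

/-- The category of `A`-modules as a symmetric monoidal category. -/
def toSymMonCat : SymMonCat.{v, max u v} where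
  carrier := Mod D A
  mon := T.mon
  sym := T.sym

/-- The forgetful functor to the ambient category. -/
def forget : T.toSymMonCat.carrier ⥤ D := Mod.forget (D := D) A

instance : T.forget.LaxBraided := T.lax

/-- The action of `A` on the object underlying an `A`-module. -/
instance (M : T.toSymMonCat.carrier) : ModObj A (T.forget.obj M) :=
  inferInstanceAs (ModObj A (show CategoryTheory.Mod D A from M).X)

end ModTensor

/-- For a lax monoidal functor `F` and an `A`-module `M`, the `F A`-module `F M`. -/
@[reducible]
def mapModObj {E : Type*} [Category* E] [MonoidalCategory E] (F : D ⥤ E) [F.LaxMonoidal]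
    (A : D) [MonObj A] (M : D) [ModObj A M] : ModObj (F.obj A) (F.obj M) where
  smul := Functor.LaxMonoidal.μ F A M ≫ F.map (ModObj.smul (M := A) (X := M))
  one_smul := by
    change (Functor.LaxMonoidal.ε F ≫ F.map MonObj.one) ▷ F.obj M ≫
      Functor.LaxMonoidal.μ F A M ≫ F.map (ModObj.smul (M := A) (X := M)) = (λ_ _).hom
    rw [comp_whiskerRight, Category.assoc, Functor.LaxMonoidal.μ_natural_left_assoc,
      ← F.map_comp, ModObj.one_smul_self, ← Functor.LaxMonoidal.left_unitality]
  mul_smul := by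
    change (Functor.LaxMonoidal.μ F A A ≫ F.map MonObj.mul) ▷ F.obj M ≫
      Functor.LaxMonoidal.μ F A M ≫ F.map (ModObj.smul (M := A) (X := M)) =
      (α_ _ _ _).hom ≫
        (F.obj A ◁ (Functor.LaxMonoidal.μ F A M ≫ F.map (ModObj.smul (M := A) (X := M)))) ≫
        Functor.LaxMonoidal.μ F A M ≫ F.map (ModObj.smul (M := A) (X := M))
    rw [comp_whiskerRight, Category.assoc, Functor.LaxMonoidal.μ_natural_left_assoc,
      ← F.map_comp, ModObj.mul_smul_self, MonoidalCategory.whiskerLeft_comp, Category.assoc,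
      Functor.LaxMonoidal.μ_natural_right_assoc, ← F.map_comp, F.map_comp,
      Functor.LaxMonoidal.associativity_assoc]

end Modules

/-- Let `F : A ⟶ B` be a strong symmetric monoidal functor and `φ : F R ⟶ S` a map of
commutative monoids. A lift of `F` along `φ` to a strong symmetric monoidal functor `F'` from
`R`-modules to `S`-modules: natural maps `F M ⟶ F' M` which are monoidal and `φ`-semilinear. -/
structure ModLift {A B : SymMonCat.{v, u}} (F : A ⟶ B) {R : A.carrier} [MonObj R]
    [IsCommMonObj R] {S : B.carrier} [MonObj S] [IsCommMonObj S] (φ : F.functor.obj R ⟶ S)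
    (TR : ModTensor R) (TS : ModTensor S) (F' : TR.toSymMonCat ⟶ TS.toSymMonCat) where
  /-- the maps `F M ⟶ F' M` -/
  unit : TR.forget ⋙ F.functor ⟶ F'.functor ⋙ TS.forget
  monoidal : NatTrans.IsMonoidal unit
  linear (M : TR.toSymMonCat.carrier) :
    (mapModObj F.functor R (TR.forget.obj M)).smul ≫ unit.app M =
      (φ ⊗ₘ unit.app M) ≫ ModObj.smul (M := S) (X := TS.forget.obj (F'.functor.obj M))

/-- The lift `F'` is relative extension of scalars: `F' M = S ⊗_{F R} F M` via the map
`S ⊗ F M ⟶ F' M` induced by `F M ⟶ F' M` and the action of `S`. -/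
def ModLift.IsExtension {A B : SymMonCat.{v, u}} {F : A ⟶ B} {R : A.carrier} [MonObj R]
    [IsCommMonObj R] {S : B.carrier} [MonObj S] [IsCommMonObj S] {φ : F.functor.obj R ⟶ S}
    [IsMonHom φ] {TR : ModTensor R} {TS : ModTensor S}
    {F' : TR.toSymMonCat ⟶ TS.toSymMonCat} (l : ModLift F φ TR TS F') : Prop :=
  ∀ M : TR.toSymMonCat.carrier,
    letI : ModObj S S := ModObj.regular S
    letI : ModObj (F.functor.obj R) S := Mod.scalarRestriction φ S
    letI : ModObj (F.functor.obj R) (F.functor.obj (TR.forget.obj M)) :=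
      mapModObj F.functor R (TR.forget.obj M)
    IsBalancedTensor (F.functor.obj R) S (F.functor.obj (TR.forget.obj M))
      (S ◁ l.unit.app M ≫
        ModObj.smul (M := S) (X := TS.forget.obj (F'.functor.obj M)))

/-! ## The Mackey functor of modules -/

instance {C : MackeyFunctor O obj} (R : OCommMonoid C) {X Y : AdmOrb O} (f : X ⟶ Y) :
    IsMonHom (R.nu f) := R.nu_isMonHom f

/-- The data `X ↦ R_X-Mod` of the theory of modules over an `O`-commutative monoid `R`: an
`O`-symmetric monoidal Mackey functor whose value at `X` is the category of `R_X`-modules with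
the tensor product over `R_X`, whose restrictions and norms are lifts of those of `C`. -/
structure ModuleMackey {C : MackeyFunctor O obj} (R : OCommMonoid C) where
  /-- the symmetric monoidal structure `⊗_{R_X}` -/
  tensor (X : Orb G) : ModTensor (R.at' X)
  /-- the Mackey functor of modules -/
  mackey : MackeyFunctor O (fun X => (tensor X).toSymMonCat)
  /-- restrictions of modules lift the restrictions of `C` -/
  resLift {X Y : Orb G} (f : X ⟶ Y) :
    ModLift (C.res.map f.op) (R.resHom f) (tensor Y) (tensor X) (mackey.res.map f.op)
  /-- norms of modules lift the norms of `C` -/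
  normLift {X Y : AdmOrb O} (f : X ⟶ Y) :
    ModLift (C.norm.map f) (R.nu f) (tensor X.obj) (tensor Y.obj) (mackey.norm.map f)

namespace ModuleMackey

variable {C : MackeyFunctor O obj} {R : OCommMonoid C} (D : ModuleMackey R)

/-- The object of `C` underlying a module. -/
abbrev und {X : Orb G} (M : (D.tensor X).toSymMonCat.carrier) : (obj X).carrier :=
  (D.tensor X).forget.obj M

/-- The coefficient system of modules is the standard one: the restriction of `M` along `f` is
`f^* M`, on which `R_X ≅ f^* R_Y` acts, and the pseudofunctor structure is that of `C`. -/
structure IsStandardRestriction : Prop where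
  isIso {X Y : Orb G} (f : X ⟶ Y) (M : (D.tensor Y).toSymMonCat.carrier) :
    IsIso ((D.resLift f).unit.app M)
  id (X : Orb G) (M : (D.tensor X).toSymMonCat.carrier) :
    (D.resLift (𝟙 X)).unit.app M ≫
        (D.tensor X).forget.map ((D.mackey.res.mapId (op X)).hom.nat.app M) =
      (C.res.mapId (op X)).hom.nat.app (D.und M)
  comp {X Y Z : Orb G} (f : X ⟶ Y) (g : Y ⟶ Z) (M : (D.tensor Z).toSymMonCat.carrier) :
    (D.resLift (f ≫ g)).unit.app M ≫
        (D.tensor X).forget.map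
          ((D.mackey.res.mapComp g.op f.op (f ≫ g).op rfl).hom.nat.app M) =
      (C.res.mapComp g.op f.op (f ≫ g).op rfl).hom.nat.app (D.und M) ≫
        (C.res.map f.op).functor.map ((D.resLift g).unit.app M) ≫
          (D.resLift f).unit.app ((D.mackey.res.map g.op).functor.obj M)

/-- The norms of modules are the relative norms `M ↦ R_Y ⊗_{N_f R_X} N_f M`, and their
pseudofunctor structure is induced by that of the norms of `C`. -/
structure IsRelativeNorm : Prop where
  isExtension {X Y : AdmOrb O} (f : X ⟶ Y) : (D.normLift f).IsExtension
  id (X : AdmOrb O) (M : (D.tensor X.obj).toSymMonCat.carrier) :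
    (D.normLift (𝟙 X)).unit.app M ≫
        (D.tensor X.obj).forget.map ((D.mackey.norm.mapId X).hom.nat.app M) =
      (C.norm.mapId X).hom.nat.app (D.und M)
  comp {X Y Z : AdmOrb O} (f : X ⟶ Y) (g : Y ⟶ Z)
      (M : (D.tensor X.obj).toSymMonCat.carrier) :
    (D.normLift (f ≫ g)).unit.app M ≫
        (D.tensor Z.obj).forget.map ((D.mackey.norm.mapComp f g _ rfl).hom.nat.app M) =
      (C.norm.mapComp f g _ rfl).hom.nat.app (D.und M) ≫
        (C.norm.map g).functor.map ((D.normLift f).unit.app M) ≫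
          (D.normLift g).unit.app ((D.mackey.norm.map f).functor.obj M)

/-- The map from `⨂ᵢ N_{pᵢ} qᵢ^* M`, formed in `C`, to the same expression formed with relative
norms and tensor products over `R_Z`. -/
def prodUnit {Z X : AdmOrb O} (M : (D.tensor X.obj).toSymMonCat.carrier) :
    (L : List (AdmSpan Z X)) →
    ((transferSum C.res C.norm L).functor.obj (D.und M) ⟶
      D.und ((transferSum (obj := fun X => (D.tensor X).toSymMonCat)
        D.mackey.res D.mackey.norm L).functor.obj M))
  | [] => Functor.LaxMonoidal.ε (D.tensor Z.obj).forget
  | s :: L =>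
    (((C.norm.map s.left).functor.map ((D.resLift s.right).unit.app M) ≫
      (D.normLift s.left).unit.app ((D.mackey.res.map s.right.op).functor.obj M)) ⊗ₘ
        prodUnit M L) ≫ Functor.LaxMonoidal.μ (D.tensor Z.obj).forget _ _

/-- The double coset isomorphisms for modules are induced by those of `C`. -/
def IsInducedDoubleCoset : Prop :=
  ∀ {X Y Z : AdmOrb O} (f : X ⟶ Y) (g : Z.obj ⟶ Y.obj) (L : List (AdmSpan Z X))
    (h : IsOrbitDecomposition f g L) (M : (D.tensor X.obj).toSymMonCat.carrier),
    (C.res.map g.op).functor.map ((D.normLift f).unit.app M) ≫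
      (D.resLift g).unit.app ((D.mackey.norm.map f).functor.obj M) ≫
        (D.tensor Z.obj).forget.map ((D.mackey.doubleCoset f g L h).hom.nat.app M) =
    (C.doubleCoset f g L h).hom.nat.app (D.und M) ≫ D.prodUnit M L

end ModuleMackey

end EqSym

/-!
Every functor in the statement is an extension of scalars. For a strong symmetric monoidal functor
`F` and a map of commutative monoids `φ : F R ⟶ S`, the module `S ⊗_{F R} F M` receives a
`φ`-semilinear map from `F M` which is universal among semilinear maps to `S`-modules. The relative
norm is the case of `ν_f : N_f R_X ⟶ R_Y`; restriction is the case of the isomorphism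
`f^* R_Y ≅ R_X`, where extension of scalars changes nothing; and the tensor product over `A` is the
extension of scalars of the `A ⊗ A`-module `M ⊗ N` along the multiplication `A ⊗ A ⟶ A`
(`isExt_of_balanced`), with unit the extension of scalars of `𝟙` along `η : 𝟙 ⟶ A`
(`ModTensor.isExt_ε`).

`IsExt φ a b f` says that `f : M ⟶ N` is such a universal map, in terms of the coequalizer of
`S ⊗ R ⊗ M ⇉ S ⊗ M`. This pair has a common section, so the hypotheses on reflexive coequalizers
give existence (`IsExt.exists_ext`), invariance under strong monoidal functors preserving
reflexive coequalizers (`IsExt.map`), under tensor products (`IsExt.tensor`) and under composition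
(`IsExt.comp`). Consequently every composite that occurs in a coherence axiom is again a universal
map out of the corresponding expression in the underlying category, and the structure isomorphisms
for modules are the unique maps induced by those of that category; an equation between them holds
because it holds after composition with a universal map. This is how modules become a symmetric
monoidal category (`ModCat.modTensor`), how extension of scalars becomes a strong symmetric monoidal
functor (`exists_lift_isUniv`, through `coreMonoidalOfUniversal`), and how monoidal transformations
pass to modules (`ModLift.cell`, `ModLift.cell_ext`).

A lift of `F` to modules is `IsUniv` if it is given by extension of scalars. Such lifts are closed
under composition and pointwise tensor product, so a pseudofunctor with a compatible family of maps
of monoids induces a pseudofunctor on modules (`PseudoOn.modPseudo`, used for restrictions and for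
norms), and both sides of the double coset formula are universal lifts. The compatibility of `ν`
with restriction says that the double coset isomorphism is compatible with the two maps of monoids
along which these lifts extend scalars, so it induces the isomorphism for modules
(`ModLift.cellIso`).
-/

namespace EqSym

/-! ### Reflexive coequalizers -/

section Coequalizers

universe v₁ u₁ v₂ u₂

variable {D : Type u₁} [Category.{v₁} D] {E : Type u₂} [Category.{v₂} E]

/-- `π` is a coequalizer of `u` and `v`; written as an existential, so that `IsBalancedTensor`
is an instance of it by definition. -/
def IsCoeq {X Y P : D} (u v : X ⟶ Y) (π : Y ⟶ P) : Prop :=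
  ∃ w : u ≫ π = v ≫ π, Nonempty (IsColimit (Cofork.ofπ π w))

namespace IsCoeq

variable {X Y P : D} {u v : X ⟶ Y} {π : Y ⟶ P}

lemma w (h : IsCoeq u v π) : u ≫ π = v ≫ π := h.choose

lemma desc (h : IsCoeq u v π) {Q : D} (k : Y ⟶ Q) (hk : u ≫ k = v ≫ k) :
    ∃ l : P ⟶ Q, π ≫ l = k := by
  obtain ⟨w, ⟨hc⟩⟩ := h
  exact ⟨_, (Cofork.IsColimit.desc' hc k hk).2⟩

lemma epi (h : IsCoeq u v π) : Epi π := by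
  obtain ⟨w, ⟨hc⟩⟩ := h
  exact ⟨fun _ _ e => Cofork.IsColimit.hom_ext hc e⟩

lemma mk (w : u ≫ π = v ≫ π) (d : ∀ {Q : D} (k : Y ⟶ Q), u ≫ k = v ≫ k → ∃ l : P ⟶ Q, π ≫ l = k)
    (e : Epi π) : IsCoeq u v π :=
  ⟨w, ⟨Cofork.IsColimit.mk _ (fun s => (d s.π s.condition).choose)
    (fun s => (d s.π s.condition).choose_spec)
    (fun s m hm => by
      have := (d s.π s.condition).choose_spec
      rw [← cancel_epi π, this]; exact hm)⟩⟩

lemma of_iso (h : IsCoeq u v π) {X' Y' P' : D} {u' v' : X' ⟶ Y'} {π' : Y' ⟶ P'}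
    (eX : X' ≅ X) (eY : Y' ≅ Y) (eP : P' ≅ P)
    (hu : u' ≫ eY.hom = eX.hom ≫ u) (hv : v' ≫ eY.hom = eX.hom ≫ v)
    (hπ : π' ≫ eP.hom = eY.hom ≫ π) : IsCoeq u' v' π' := by
  have hπ' : π' = eY.hom ≫ π ≫ eP.inv := by rw [← Category.assoc, ← hπ]; simp
  have := h.epi
  refine mk ?_ (fun k hk => ?_) ?_
  · rw [hπ', reassoc_of% hu, reassoc_of% hv, reassoc_of% h.w]
  · obtain ⟨l, hl⟩ := h.desc (eY.inv ≫ k) (by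
      rw [← cancel_epi eX.hom, ← reassoc_of% hu, ← reassoc_of% hv]
      simpa using hk)
    exact ⟨eP.hom ≫ l, by rw [reassoc_of% hπ, hl]; simp⟩
  · rw [hπ']; infer_instance

/-- A functor preserving colimits over the walking reflexive pair preserves coequalizers of pairs
with a common section. -/
lemma map (h : IsCoeq u v π) (s : Y ⟶ X) (su : s ≫ u = 𝟙 Y) (sv : s ≫ v = 𝟙 Y) (F : D ⥤ E)
    [PreservesColimitsOfShape WalkingReflexivePair F] :
    IsCoeq (F.map u) (F.map v) (F.map π) := by
  obtain ⟨w, ⟨hc⟩⟩ := h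
  let K := reflexivePair u v s su sv
  let c : ReflexiveCofork K := ReflexiveCofork.mk π w
  have hcol : IsColimit c := ReflexiveCofork.isColimitEquiv K c hc
  have hF := isColimitOfPreserves F hcol
  let c' : ReflexiveCofork (K ⋙ F) := F.mapCocone c
  have h2 : IsColimit c'.toCofork := (ReflexiveCofork.isColimitEquiv (K ⋙ F) c').symm hF
  exact ⟨by rw [← F.map_comp, w, F.map_comp], ⟨h2⟩⟩

/-- A coequalizer diagram that splits. -/
lemma of_split {s : P ⟶ Y} {t : Y ⟶ X} (w : u ≫ π = v ≫ π) (hs : s ≫ π = 𝟙 P)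
    (ht : t ≫ u = 𝟙 Y) (hts : t ≫ v = π ≫ s) : IsCoeq u v π := by
  refine mk w (fun k hk => ⟨s ≫ k, ?_⟩) ?_
  · rw [← reassoc_of% hts, ← hk, reassoc_of% ht]
  · exact ⟨fun a b e => by simpa [reassoc_of% hs] using congrArg (s ≫ ·) e⟩

end IsCoeq

end Coequalizers

/-- Reflexive coequalizers exist and are preserved by the tensor product in each variable. -/
class ReflexiveTensor (D : Type u) [Category.{v} D] [MonoidalCategory D] : Prop where
  has : HasReflexiveCoequalizers D
  left (M : D) : PreservesColimitsOfShape WalkingReflexivePair (tensorLeft M)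

attribute [instance] ReflexiveTensor.has ReflexiveTensor.left

section

variable {D : Type u} [Category.{v} D] [MonoidalCategory D] [ReflexiveTensor D]

lemma IsCoeq.whiskerLeft {X Y P : D} {u v : X ⟶ Y} {π : Y ⟶ P} (h : IsCoeq u v π) (s : Y ⟶ X)
    (su : s ≫ u = 𝟙 Y) (sv : s ≫ v = 𝟙 Y) (M : D) : IsCoeq (M ◁ u) (M ◁ v) (M ◁ π) :=
  h.map s su sv (tensorLeft M)

variable [SymmetricCategory D]

lemma IsCoeq.whiskerRight {X Y P : D} {u v : X ⟶ Y} {π : Y ⟶ P} (h : IsCoeq u v π) (s : Y ⟶ X)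
    (su : s ≫ u = 𝟙 Y) (sv : s ≫ v = 𝟙 Y) (M : D) : IsCoeq (u ▷ M) (v ▷ M) (π ▷ M) :=
  (h.whiskerLeft s su sv M).of_iso (β_ X M) (β_ Y M) (β_ P M) (by simp) (by simp) (by simp)

/-- Reflexive coequalizers are sifted colimits: the tensor product of two reflexive coequalizers
is the coequalizer of the tensor products of the two pairs. -/
lemma IsCoeq.tensor {X Y P : D} {u v : X ⟶ Y} {π : Y ⟶ P} (h : IsCoeq u v π) (s : Y ⟶ X)
    (su : s ≫ u = 𝟙 Y) (sv : s ≫ v = 𝟙 Y) {X' Y' P' : D} {u' v' : X' ⟶ Y'} {π' : Y' ⟶ P'}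
    (h' : IsCoeq u' v' π') (s' : Y' ⟶ X') (su' : s' ≫ u' = 𝟙 Y') (sv' : s' ≫ v' = 𝟙 Y') :
    IsCoeq (u ⊗ₘ u') (v ⊗ₘ v') (π ⊗ₘ π') := by
  have e1 : Epi (π ▷ Y') := (h.whiskerRight s su sv Y').epi
  have e2 : Epi (π ▷ X') := (h.whiskerRight s su sv X').epi
  have e3 : Epi (P ◁ π') := (h'.whiskerLeft s' su' sv' P).epi
  refine mk ?_ (fun {Q} k hk => ?_) ?_
  · simp only [tensorHom_comp_tensorHom, h.w, h'.w]
  · have k1 : u ▷ Y' ≫ k = v ▷ Y' ≫ k := by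
      have := congrArg (X ◁ s' ≫ ·) hk
      simpa only [← id_tensorHom, tensorHom_comp_tensorHom_assoc, su', sv', Category.id_comp,
        tensorHom_id] using this
    have k2 : Y ◁ u' ≫ k = Y ◁ v' ≫ k := by
      have := congrArg (s ▷ X' ≫ ·) hk
      simpa only [← tensorHom_id, tensorHom_comp_tensorHom_assoc, su, sv, Category.id_comp,
        id_tensorHom] using this
    obtain ⟨l, hl⟩ := (h.whiskerRight s su sv Y').desc k k1
    obtain ⟨m, hm⟩ := (h'.whiskerLeft s' su' sv' P).desc l (by
      rw [← cancel_epi (π ▷ X'), ← whisker_exchange_assoc, ← whisker_exchange_assoc, hl, k2])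
    exact ⟨m, by rw [MonoidalCategory.tensorHom_def, Category.assoc, hm, hl]⟩
  · rw [MonoidalCategory.tensorHom_def]; infer_instance

end

/-! ### Actions and extension of scalars -/

section Ext

variable {D : Type u} [Category.{v} D] [MonoidalCategory D]

/-- The axioms of a module over the monoid `S`, for a map `p : S ⊗ P ⟶ P`. -/
structure IsAct {S P : D} [MonObj S] (p : S ⊗ P ⟶ P) : Prop where
  one : η[S] ▷ P ≫ p = (λ_ P).hom
  mul : μ[S] ▷ P ≫ p = (α_ S S P).hom ≫ S ◁ p ≫ p

lemma isAct_smul (S P : D) [MonObj S] [ModObj S P] :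
    IsAct (S := S) (P := P) (ModObj.smul (M := S) (X := P)) :=
  ⟨ModObj.one_smul_self S P, ModObj.mul_smul_self S P⟩

lemma isAct_mul (S : D) [MonObj S] : IsAct μ[S] := ⟨MonObj.one_mul S, MonObj.mul_assoc S⟩

/-- Restriction of scalars. -/
lemma IsAct.restrict {S T P : D} [MonObj S] [MonObj T] {p : T ⊗ P ⟶ P} (hp : IsAct p)
    (ψ : S ⟶ T) [IsMonHom ψ] : IsAct (ψ ▷ P ≫ p) where
  one := by rw [← comp_whiskerRight_assoc, IsMonHom.one_hom, hp.one]
  mul := by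
    rw [← comp_whiskerRight_assoc, IsMonHom.mul_hom, comp_whiskerRight, Category.assoc, hp.mul,
      MonoidalCategory.tensorHom_def', comp_whiskerRight, Category.assoc,
        associator_naturality_left_assoc,
      whisker_assoc_assoc, MonoidalCategory.whiskerLeft_comp, Category.assoc, Iso.inv_hom_id_assoc,
      ← whisker_exchange_assoc]

/-- `f : M ⟶ N` exhibits the `S`-module `N` as the extension of scalars `S ⊗_R M` along
`φ : R ⟶ S`. The actions are given by bare maps `a` and `b`. On the source only a unit of `R`
compatible with `φ` and `a` is required: associativity plays no role in the construction of the
coequalizer or in its universal property. -/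
structure IsExt {R S M N : D} [MonObj S] (φ : R ⟶ S) (a : R ⊗ M ⟶ M) (b : S ⊗ N ⟶ N)
    (f : M ⟶ N) : Prop where
  unital : ∃ r : 𝟙_ D ⟶ R, r ≫ φ = η[S] ∧ r ▷ M ≫ a = (λ_ M).hom
  act : IsAct b
  lin : a ≫ f = (φ ⊗ₘ f) ≫ b
  coeq : IsCoeq ((S ◁ φ ≫ μ[S]) ▷ M) ((α_ S R M).hom ≫ S ◁ a) (S ◁ f ≫ b)

/-- The common section of the two maps `S ⊗ R ⊗ M ⇉ S ⊗ M`. -/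
lemma extSection {R S M : D} [MonObj S] {φ : R ⟶ S} {a : R ⊗ M ⟶ M}
    (h : ∃ r : 𝟙_ D ⟶ R, r ≫ φ = η[S] ∧ r ▷ M ≫ a = (λ_ M).hom) :
    ∃ s : S ⊗ M ⟶ (S ⊗ R) ⊗ M, s ≫ (S ◁ φ ≫ μ[S]) ▷ M = 𝟙 _ ∧
      s ≫ (α_ S R M).hom ≫ S ◁ a = 𝟙 _ := by
  obtain ⟨r, h1, h2⟩ := h
  refine ⟨((ρ_ S).inv ≫ S ◁ r) ▷ M, ?_, ?_⟩
  · rw [← comp_whiskerRight, Category.assoc, ← MonoidalCategory.whiskerLeft_comp_assoc, h1]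
    simp
  · rw [comp_whiskerRight, Category.assoc, associator_naturality_middle_assoc,
      ← MonoidalCategory.whiskerLeft_comp, h2]
    simp

namespace IsExt

variable {R S M N : D} [MonObj S] {φ : R ⟶ S} {a : R ⊗ M ⟶ M} {b : S ⊗ N ⟶ N} {f : M ⟶ N}

/-- A map `f` is recovered from the linear map `S ⊗ M ⟶ N` attached to it. -/
lemma unit_act (hf : IsAct b) : (λ_ M).inv ≫ η[S] ▷ M ≫ S ◁ f ≫ b = f := by
  rw [← whisker_exchange_assoc, hf.one]; simp

lemma epi (h : IsExt φ a b f) : Epi (S ◁ f ≫ b) := h.coeq.epi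

/-- The free `S`-module map attached to a semilinear map coequalizes the pair. -/
lemma coequalizes {P : D} {p : S ⊗ P ⟶ P} (hp : IsAct p) {g : M ⟶ P}
    (hg : a ≫ g = (φ ⊗ₘ g) ≫ p) :
    (S ◁ φ ≫ μ[S]) ▷ M ≫ S ◁ g ≫ p = ((α_ S R M).hom ≫ S ◁ a) ≫ S ◁ g ≫ p := by
  rw [Category.assoc, ← MonoidalCategory.whiskerLeft_comp_assoc, hg, ← whisker_exchange_assoc,
    comp_whiskerRight, Category.assoc, hp.mul, MonoidalCategory.tensorHom_def']
  simp only [whisker_assoc, Category.assoc, Iso.inv_hom_id_assoc,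
    MonoidalCategory.whiskerLeft_comp, associator_naturality_right_assoc]

lemma hom_ext (h : IsExt φ a b f) {P : D} {p : S ⊗ P ⟶ P} {l l' : N ⟶ P}
    (hl : b ≫ l = S ◁ l ≫ p) (hl' : b ≫ l' = S ◁ l' ≫ p) (e : f ≫ l = f ≫ l') : l = l' := by
  have := h.epi
  rw [← cancel_epi (S ◁ f ≫ b), Category.assoc, Category.assoc, hl, hl',
    ← MonoidalCategory.whiskerLeft_comp_assoc, ← MonoidalCategory.whiskerLeft_comp_assoc, e]

variable [ReflexiveTensor D]

lemma desc (h : IsExt φ a b f) {P : D} {p : S ⊗ P ⟶ P} (hp : IsAct p) (g : M ⟶ P)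
    (hg : a ≫ g = (φ ⊗ₘ g) ≫ p) : ∃ l : N ⟶ P, f ≫ l = g ∧ b ≫ l = S ◁ l ≫ p := by
  obtain ⟨l, hl⟩ := h.coeq.desc (S ◁ g ≫ p) (coequalizes hp hg)
  refine ⟨l, ?_, ?_⟩
  · rw [← unit_act (f := f) h.act, Category.assoc, Category.assoc, hl, unit_act hp]
  · obtain ⟨s, s1, s2⟩ := extSection h.unital
    have := (h.coeq.whiskerLeft s s1 s2 S).epi
    rw [← cancel_epi (S ◁ (S ◁ f ≫ b)), ← MonoidalCategory.whiskerLeft_comp_assoc, hl,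
      MonoidalCategory.whiskerLeft_comp, Category.assoc, ← cancel_epi (α_ S S M).hom]
    have e1 := h.act.mul
    have e2 := hp.mul
    rw [MonoidalCategory.whiskerLeft_comp, Category.assoc, ← associator_naturality_right_assoc,
      ← reassoc_of% e1, ← associator_naturality_right_assoc, ← e2, whisker_exchange_assoc,
      whisker_exchange_assoc, ← hl, Category.assoc]

/-- Extension of scalars exists: the `S`-action on `S ⊗ M` descends to the coequalizer, since
`S ⊗ -` preserves it. -/
lemma exists_ext (φ : R ⟶ S) (a : R ⊗ M ⟶ M)
    (hu : ∃ r : 𝟙_ D ⟶ R, r ≫ φ = η[S] ∧ r ▷ M ≫ a = (λ_ M).hom) :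
    ∃ (N : D) (b : S ⊗ N ⟶ N) (f : M ⟶ N), IsExt φ a b f := by
  obtain ⟨s, s1, s2⟩ := extSection hu
  set p₁ := (S ◁ φ ≫ μ[S]) ▷ M with hp₁
  set p₂ := (α_ S R M).hom ≫ S ◁ a with hp₂
  have : IsReflexivePair p₁ p₂ := ⟨s, s1, s2⟩
  obtain ⟨N, π, hπ⟩ : ∃ (N : D) (π : S ⊗ M ⟶ N), IsCoeq p₁ p₂ π :=
    ⟨_, coequalizer.π p₁ p₂, coequalizer.condition _ _, ⟨coequalizerIsCoequalizer _ _⟩⟩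
  have hS := hπ.whiskerLeft s s1 s2 S
  have := hS.epi
  have := hπ.epi
  have hSS := (hπ.whiskerLeft s s1 s2 (S ⊗ S)).epi
  have hI := (hπ.whiskerLeft s s1 s2 (𝟙_ D)).epi
  -- multiplication by scalars on the free module descends to the coequalizer
  obtain ⟨b, hb⟩ := hS.desc ((α_ S S M).inv ≫ μ[S] ▷ M ≫ π) (by
    have e1 : S ◁ p₁ ≫ (α_ S S M).inv ≫ μ[S] ▷ M =
        (α_ S (S ⊗ R) M).inv ≫ ((α_ S S R).inv ≫ μ[S] ▷ R) ▷ M ≫ p₁ := by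
      rw [hp₁, ← comp_whiskerRight, associator_inv_naturality_middle_assoc, ← comp_whiskerRight]
      congr 2
      rw [MonoidalCategory.whiskerLeft_comp, Category.assoc, Category.assoc,
        ← whisker_exchange_assoc, ← associator_inv_naturality_right_assoc, MonObj.mul_assoc]
      simp
    have e2 : S ◁ p₂ ≫ (α_ S S M).inv ≫ μ[S] ▷ M =
        (α_ S (S ⊗ R) M).inv ≫ ((α_ S S R).inv ≫ μ[S] ▷ R) ▷ M ≫ p₂ := by
      rw [hp₂, MonoidalCategory.whiskerLeft_comp, Category.assoc,
        associator_inv_naturality_right_assoc, whisker_exchange, comp_whiskerRight, Category.assoc,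
        associator_naturality_left_assoc]
      simp
    rw [reassoc_of% e1, reassoc_of% e2, hπ.w])
  have hf : S ◁ ((λ_ M).inv ≫ η[S] ▷ M ≫ π) ≫ b = π := by
    rw [MonoidalCategory.whiskerLeft_comp, MonoidalCategory.whiskerLeft_comp, Category.assoc,
      Category.assoc, hb, associator_inv_naturality_middle_assoc, ← comp_whiskerRight_assoc,
      MonObj.mul_one]
    simp
  refine ⟨_, b, (λ_ M).inv ≫ η[S] ▷ M ≫ π, hu, ⟨?_, ?_⟩, ?_, ?_⟩
  · rw [← cancel_epi ((𝟙_ D) ◁ π), whisker_exchange_assoc, hb,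
      associator_inv_naturality_left_assoc, ← comp_whiskerRight_assoc, MonObj.one_mul]
    simp
  · rw [← cancel_epi ((S ⊗ S) ◁ π), whisker_exchange_assoc, hb,
      associator_naturality_right_assoc, ← MonoidalCategory.whiskerLeft_comp_assoc, hb]
    simp only [MonoidalCategory.whiskerLeft_comp, Category.assoc, hb]
    rw [associator_inv_naturality_left_assoc, ← comp_whiskerRight_assoc, MonObj.mul_assoc,
      associator_inv_naturality_middle_assoc]
    simp
  · rw [MonoidalCategory.tensorHom_def, Category.assoc, hf, leftUnitor_inv_naturality_assoc,
      whisker_exchange_assoc]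
    have e : S ◁ a ≫ π = (α_ S R M).inv ≫ p₁ ≫ π := by
      rw [Iso.eq_inv_comp, hπ.w, hp₂, Category.assoc]
    rw [e, associator_inv_naturality_left_assoc, hp₁, ← comp_whiskerRight_assoc,
      ← whisker_exchange_assoc, MonObj.one_mul]
    simp
  · rw [hf]; exact hπ

/-- The universal property characterizes extensions of scalars. -/
lemma of_univ (hu : ∃ r : 𝟙_ D ⟶ R, r ≫ φ = η[S] ∧ r ▷ M ≫ a = (λ_ M).hom) (hb : IsAct b)
    (hf : a ≫ f = (φ ⊗ₘ f) ≫ b)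
    (d : ∀ {P : D} (p : S ⊗ P ⟶ P), IsAct p → ∀ g : M ⟶ P, a ≫ g = (φ ⊗ₘ g) ≫ p →
      ∃ l : N ⟶ P, f ≫ l = g ∧ b ≫ l = S ◁ l ≫ p)
    (e : ∀ {P : D} (p : S ⊗ P ⟶ P), IsAct p → ∀ l l' : N ⟶ P, b ≫ l = S ◁ l ≫ p →
      b ≫ l' = S ◁ l' ≫ p → f ≫ l = f ≫ l' → l = l') : IsExt φ a b f := by
  obtain ⟨N₀, b₀, f₀, h⟩ := exists_ext φ a hu
  obtain ⟨i, hi, hi'⟩ := h.desc hb f hf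
  obtain ⟨j, hj, hj'⟩ := d b₀ h.act f₀ h.lin
  let E : N ≅ N₀ :=
    { hom := j
      inv := i
      hom_inv_id := e b hb _ _ (by rw [reassoc_of% hj', hi']; simp) (by simp)
        (by rw [reassoc_of% hj, hi]; simp)
      inv_hom_id := h.hom_ext (p := b₀) (by rw [reassoc_of% hi', hj']; simp) (by simp)
        (by rw [reassoc_of% hi, hj]; simp) }
  refine ⟨hu, hb, hf, h.coeq.of_iso (Iso.refl _) (Iso.refl _) E (by simp) (by simp) ?_⟩
  change (S ◁ f ≫ b) ≫ j = _
  rw [Category.assoc, hj', ← MonoidalCategory.whiskerLeft_comp_assoc, hj]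
  simp

/-- Two extensions of scalars of the same module are isomorphic. -/
lemma exists_iso (h : IsExt φ a b f) {N' : D} {b' : S ⊗ N' ⟶ N'} {f' : M ⟶ N'}
    (h' : IsExt φ a b' f') :
    ∃ e : N ≅ N', f ≫ e.hom = f' ∧ b ≫ e.hom = S ◁ e.hom ≫ b' := by
  obtain ⟨i, hi, hi'⟩ := h.desc h'.act f' h'.lin
  obtain ⟨j, hj, hj'⟩ := h'.desc h.act f h.lin
  exact ⟨⟨i, j, h.hom_ext (p := b) (by rw [reassoc_of% hi', hj']; simp) (by simp)
    (by rw [reassoc_of% hi, hj]; simp), h'.hom_ext (p := b') (by rw [reassoc_of% hj', hi']; simp)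
      (by simp)
    (by rw [reassoc_of% hj, hi]; simp)⟩, hi, hi'⟩

/-- Extensions of scalars compose. -/
lemma comp (h : IsExt φ a b f) {T Q : D} [MonObj T] {ψ : S ⟶ T} [IsMonHom ψ] {c : T ⊗ Q ⟶ Q}
    {g : N ⟶ Q} (h' : IsExt ψ b c g) : IsExt (φ ≫ ψ) a c (f ≫ g) := by
  refine of_univ ?_ h'.act ?_ (fun p hp k hk => ?_) (fun p hp l l' hl hl' e => ?_)
  · obtain ⟨r, h1, h2⟩ := h.unital
    exact ⟨r, by rw [reassoc_of% h1, IsMonHom.one_hom], h2⟩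
  · rw [← tensorHom_comp_tensorHom, Category.assoc, ← h'.lin, ← Category.assoc, h.lin,
      Category.assoc]
  · obtain ⟨l, hl, hl'⟩ := h.desc (hp.restrict ψ) k (by
      rw [hk, ← tensorHom_id, tensorHom_comp_tensorHom_assoc, Category.comp_id])
    obtain ⟨m, hm, hm'⟩ := h'.desc hp l (by rw [hl', MonoidalCategory.tensorHom_def',
      Category.assoc])
    exact ⟨m, by rw [Category.assoc, hm, hl], hm'⟩
  · refine h'.hom_ext hl hl' (h.hom_ext (p := ψ ▷ _ ≫ p) ?_ ?_ (by simpa using e))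
    · rw [reassoc_of% h'.lin, hl, MonoidalCategory.tensorHom_def, MonoidalCategory.whiskerLeft_comp,
        Category.assoc, Category.assoc, ← whisker_exchange_assoc, ← whisker_exchange_assoc]
    · rw [reassoc_of% h'.lin, hl', MonoidalCategory.tensorHom_def,
        MonoidalCategory.whiskerLeft_comp,
        Category.assoc, Category.assoc, ← whisker_exchange_assoc, ← whisker_exchange_assoc]

/-- Extension of scalars along the identity. -/
lemma id {N : D} {b : S ⊗ N ⟶ N} (hb : IsAct b) : IsExt (𝟙 S) b b (𝟙 N) := by
  refine of_univ ⟨η[S], by simp, hb.one⟩ hb (by simp) (fun p _ g hg => ⟨g, by simp, ?_⟩)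
    (fun p _ l l' _ _ e => by simpa using e)
  rw [hg, id_tensorHom]

/-- Extensions of scalars are invariant under isomorphisms of the source module and of its ring of
scalars. -/
lemma precomp_iso (h : IsExt φ a b f) {R' M' : D} {a' : R' ⊗ M' ⟶ M'} (e : R' ≅ R)
    (d : M' ≅ M) (hed : a' ≫ d.hom = (e.hom ⊗ₘ d.hom) ≫ a) :
    IsExt (e.hom ≫ φ) a' b (d.hom ≫ f) := by
  have ha : a = (e.inv ⊗ₘ d.inv) ≫ a' ≫ d.hom := by
    rw [hed, tensorHom_comp_tensorHom_assoc]; simp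
  refine of_univ ?_ h.act ?_ (fun p hp g hg => ?_) (fun p hp l l' hl hl' e => ?_)
  · obtain ⟨r, h1, h2⟩ := h.unital
    refine ⟨r ≫ e.inv, by simpa using h1, ?_⟩
    rw [← cancel_mono d.hom, Category.assoc, hed, comp_whiskerRight, Category.assoc,
      MonoidalCategory.tensorHom_def, Category.assoc, inv_hom_whiskerRight_assoc,
        ← whisker_exchange_assoc, h2]
    simp
  · rw [reassoc_of% hed, h.lin, tensorHom_comp_tensorHom_assoc]
  · obtain ⟨l, hl, hl'⟩ := h.desc hp (d.inv ≫ g) (by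
      rw [ha, Category.assoc, Category.assoc, Iso.hom_inv_id_assoc, hg,
        tensorHom_comp_tensorHom_assoc, Iso.inv_hom_id_assoc])
    exact ⟨l, by rw [Category.assoc, hl]; simp, hl'⟩
  · exact h.hom_ext hl hl' (by simpa using e)

/-- Extension of scalars along an isomorphism does not change the underlying object. -/
lemma isIso [MonObj R] [IsMonHom φ] [IsIso φ] (h : IsExt φ a b f) (ha : IsAct a) : IsIso f := by
  have : IsMonHom (inv φ) := inferInstanceAs (IsMonHom (asIso φ).inv)
  have hi : IsExt φ a (inv φ ▷ M ≫ a) (𝟙 M) := by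
    refine of_univ h.unital (ha.restrict (inv φ)) (by simp)
      (fun p hp g hg => ⟨g, by simp, ?_⟩) (fun p _ l l' _ _ e => by simpa using e)
    rw [Category.assoc, hg, MonoidalCategory.tensorHom_def, Category.assoc,
      ← comp_whiskerRight_assoc,
      IsIso.inv_hom_id, id_whiskerRight, Category.id_comp]
  obtain ⟨e, he, -⟩ := hi.exists_iso h
  rw [Category.id_comp] at he
  rw [← he]; infer_instance

end IsExt

end Ext

/-! ### Extension of scalars, monoidal functors and tensor products -/

section Strong

variable {D E : Type u} [Category.{v} D] [MonoidalCategory D] [Category.{v} E]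
  [MonoidalCategory E]

/-- A lax monoidal functor sends modules to modules. -/
lemma IsAct.map {S N : D} [MonObj S] {b : S ⊗ N ⟶ N} (hb : IsAct b) (G : D ⥤ E)
    [G.LaxMonoidal] : IsAct (Functor.LaxMonoidal.μ G S N ≫ G.map b) :=
  letI : ModObj S N := ⟨b, hb.one, hb.mul⟩
  ⟨(mapModObj G S N).one_smul, (mapModObj G S N).mul_smul⟩

/-- A strong monoidal functor preserving reflexive coequalizers preserves extensions of
scalars. -/
lemma IsExt.map {R S M N : D} [MonObj S] {φ : R ⟶ S} {a : R ⊗ M ⟶ M} {b : S ⊗ N ⟶ N}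
    {f : M ⟶ N} (h : IsExt φ a b f) (G : D ⥤ E) [G.Monoidal]
    [PreservesColimitsOfShape WalkingReflexivePair G] :
    IsExt (G.map φ) (Functor.LaxMonoidal.μ G R M ≫ G.map a)
      (Functor.LaxMonoidal.μ G S N ≫ G.map b) (G.map f) := by
  refine ⟨?_, h.act.map G, ?_, ?_⟩
  · obtain ⟨r, h1, h2⟩ := h.unital
    refine ⟨Functor.LaxMonoidal.ε G ≫ G.map r, ?_, ?_⟩
    · rw [Category.assoc, ← G.map_comp, h1, Functor.obj.η_def]
    · rw [comp_whiskerRight, Category.assoc, Functor.LaxMonoidal.μ_natural_left_assoc,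
        ← G.map_comp, h2, ← Functor.LaxMonoidal.left_unitality]
  · rw [Category.assoc, ← G.map_comp, h.lin, G.map_comp, Functor.LaxMonoidal.μ_natural_assoc]
  · obtain ⟨s, s1, s2⟩ := extSection h.unital
    refine (h.coeq.map s s1 s2 G).of_iso
      (whiskerRightIso (Functor.Monoidal.μIso G S R) (G.obj M) ≪≫ Functor.Monoidal.μIso G _ M)
      (Functor.Monoidal.μIso G S M) (Iso.refl _) ?_ ?_ ?_
    · change ((G.obj S ◁ G.map φ ≫ Functor.LaxMonoidal.μ G S S ≫ G.map μ[S]) ▷ G.obj M) ≫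
        Functor.LaxMonoidal.μ G S M = (Functor.LaxMonoidal.μ G S R ▷ G.obj M ≫
          Functor.LaxMonoidal.μ G (S ⊗ R) M) ≫ G.map ((S ◁ φ ≫ μ[S]) ▷ M)
      rw [Category.assoc, ← Functor.LaxMonoidal.μ_natural_left, ← comp_whiskerRight_assoc,
        G.map_comp, Functor.LaxMonoidal.μ_natural_right_assoc]
    · change ((α_ _ _ _).hom ≫ G.obj S ◁ (Functor.LaxMonoidal.μ G R M ≫ G.map a)) ≫
        Functor.LaxMonoidal.μ G S M = (Functor.LaxMonoidal.μ G S R ▷ G.obj M ≫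
          Functor.LaxMonoidal.μ G (S ⊗ R) M) ≫ G.map ((α_ S R M).hom ≫ S ◁ a)
      simp
    · change (G.obj S ◁ G.map f ≫ Functor.LaxMonoidal.μ G S N ≫ G.map b) ≫ 𝟙 _ =
        Functor.LaxMonoidal.μ G S M ≫ G.map (S ◁ f ≫ b)
      simp

end Strong

section Tensor

variable {D : Type u} [Category.{v} D] [MonoidalCategory D] [SymmetricCategory D]

/-- The action of `R ⊗ R'` on `M ⊗ M'`. -/
def tensorAct {R R' M M' : D} (a : R ⊗ M ⟶ M) (a' : R' ⊗ M' ⟶ M') :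
    (R ⊗ R') ⊗ (M ⊗ M') ⟶ M ⊗ M' :=
  tensorμ R R' M M' ≫ (a ⊗ₘ a')

/-- The shuffle `tensorμ`, as an isomorphism. -/
def shuffleIso (X₁ X₂ Y₁ Y₂ : D) : (X₁ ⊗ X₂) ⊗ (Y₁ ⊗ Y₂) ≅ (X₁ ⊗ Y₁) ⊗ (X₂ ⊗ Y₂) where
  hom := tensorμ X₁ X₂ Y₁ Y₂
  inv := tensorδ X₁ X₂ Y₁ Y₂

/-- The unitality condition in `IsExt` passes to tensor products. -/
lemma tensorAct_unital {R R' S S' M M' : D} [MonObj S] [MonObj S'] {φ : R ⟶ S} {φ' : R' ⟶ S'}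
    {a : R ⊗ M ⟶ M} {a' : R' ⊗ M' ⟶ M'}
    (h : ∃ r : 𝟙_ D ⟶ R, r ≫ φ = η[S] ∧ r ▷ M ≫ a = (λ_ M).hom)
    (h' : ∃ r : 𝟙_ D ⟶ R', r ≫ φ' = η[S'] ∧ r ▷ M' ≫ a' = (λ_ M').hom) :
    ∃ r : 𝟙_ D ⟶ R ⊗ R', r ≫ (φ ⊗ₘ φ') = η[S ⊗ S'] ∧
      r ▷ (M ⊗ M') ≫ tensorAct a a' = (λ_ (M ⊗ M')).hom := by
  obtain ⟨r, h1, h2⟩ := h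
  obtain ⟨r', h1', h2'⟩ := h'
  refine ⟨(λ_ _).inv ≫ (r ⊗ₘ r'), ?_, ?_⟩
  · rw [Category.assoc, tensorHom_comp_tensorHom, h1, h1']; rfl
  · rw [tensorAct, comp_whiskerRight, Category.assoc, tensorμ_natural_left_assoc,
      tensorHom_comp_tensorHom, h2, h2', ← tensor_left_unitality]

lemma IsAct.tensor {S S' N N' : D} [MonObj S] [MonObj S'] {b : S ⊗ N ⟶ N} {b' : S' ⊗ N' ⟶ N'}
    (h : IsAct b) (h' : IsAct b') : IsAct (tensorAct b b') where
  one := by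
    obtain ⟨r, h1, h2⟩ := tensorAct_unital (φ := 𝟙 S) (φ' := 𝟙 S') ⟨η, by simp, h.one⟩
      ⟨η, by simp, h'.one⟩
    rw [id_tensorHom_id, Category.comp_id] at h1
    rw [← h1, h2]
  mul := by
    change (tensorμ S S' S S' ≫ (μ[S] ⊗ₘ μ[S'])) ▷ (N ⊗ N') ≫ tensorAct b b' = _
    rw [tensorAct, comp_whiskerRight, Category.assoc, tensorμ_natural_left_assoc,
      tensorHom_comp_tensorHom, h.mul, h'.mul, ← tensorHom_comp_tensorHom,
        tensor_associativity_assoc,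
      ← tensorHom_comp_tensorHom, MonoidalCategory.whiskerLeft_comp, Category.assoc,
      tensorμ_natural_right_assoc]

section

variable [ReflexiveTensor D]

/-- The tensor product of two extensions of scalars is an extension of scalars. -/
lemma IsExt.tensor {R R' S S' M M' N N' : D} [MonObj S] [MonObj S'] {φ : R ⟶ S} {φ' : R' ⟶ S'}
    {a : R ⊗ M ⟶ M} {a' : R' ⊗ M' ⟶ M'} {b : S ⊗ N ⟶ N} {b' : S' ⊗ N' ⟶ N'} {f : M ⟶ N}
    {f' : M' ⟶ N'} (h : IsExt φ a b f) (h' : IsExt φ' a' b' f') :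
    IsExt (φ ⊗ₘ φ') (tensorAct a a') (tensorAct b b') (f ⊗ₘ f') := by
  refine ⟨tensorAct_unital h.unital h'.unital, h.act.tensor h'.act, ?_, ?_⟩
  · rw [tensorAct, tensorAct, Category.assoc, tensorHom_comp_tensorHom, h.lin, h'.lin,
      ← tensorHom_comp_tensorHom,
      tensorμ_natural_assoc]
  · obtain ⟨s, s1, s2⟩ := extSection h.unital
    obtain ⟨s', s1', s2'⟩ := extSection h'.unital
    refine (h.coeq.tensor s s1 s2 h'.coeq s' s1' s2').of_iso
      (whiskerRightIso (shuffleIso S S' R R') (M ⊗ M') ≪≫ shuffleIso _ _ _ _)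
      (shuffleIso S S' M M') (Iso.refl _) ?_ ?_ ?_
    · change ((S ⊗ S') ◁ (φ ⊗ₘ φ') ≫ tensorμ S S' S S' ≫ (μ[S] ⊗ₘ μ[S'])) ▷ (M ⊗ M') ≫
        tensorμ S S' M M' = (tensorμ S S' R R' ▷ (M ⊗ M') ≫ tensorμ (S ⊗ R) (S' ⊗ R') M M') ≫ _
      rw [Category.assoc, ← tensorμ_natural_left, ← comp_whiskerRight_assoc,
        tensorμ_natural_right_assoc, tensorHom_comp_tensorHom]
    · change ((α_ _ _ _).hom ≫ (S ⊗ S') ◁ (tensorμ R R' M M' ≫ (a ⊗ₘ a'))) ≫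
        tensorμ S S' M M' = (tensorμ S S' R R' ▷ (M ⊗ M') ≫ tensorμ (S ⊗ R) (S' ⊗ R') M M') ≫ _
      rw [Category.assoc, ← tensorHom_comp_tensorHom, Category.assoc, tensor_associativity_assoc,
        MonoidalCategory.whiskerLeft_comp, Category.assoc, tensorμ_natural_right]
    · change ((S ⊗ S') ◁ (f ⊗ₘ f') ≫ tensorμ S S' N N' ≫ (b ⊗ₘ b')) ≫ 𝟙 _ =
        tensorμ S S' M M' ≫ _
      rw [Category.comp_id, tensorμ_natural_right_assoc, tensorHom_comp_tensorHom]

end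

/-! ### Tensor products over a commutative monoid -/

section Balanced

variable {A M N P : D} [MonObj A] {a : A ⊗ M ⟶ M} {a' : A ⊗ N ⟶ N} {c : A ⊗ P ⟶ P}

/-- A map out of `M ⊗ N` which is linear in `M` and balanced is semilinear over `μ : A ⊗ A ⟶ A`. -/
lemma semilinear_of_balanced {g : M ⊗ N ⟶ P} (hc : IsAct c)
    (h1 : A ◁ g ≫ c = (α_ A M N).inv ≫ a ▷ N ≫ g)
    (h2 : ((β_ M A).hom ≫ a) ▷ N ≫ g = ((α_ M A N).hom ≫ M ◁ a') ≫ g) :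
    tensorAct a a' ≫ g = (μ[A] ⊗ₘ g) ≫ c := by
  have h1' : a ▷ N ≫ g = (α_ A M N).hom ≫ A ◁ g ≫ c := by rw [h1, Iso.hom_inv_id_assoc]
  have h2' : M ◁ a' ≫ g = (α_ M A N).inv ≫ (β_ M A).hom ▷ N ≫ a ▷ N ≫ g := by
    rw [Category.assoc, ← Iso.inv_comp_eq] at h2
    rw [← h2, comp_whiskerRight, Category.assoc]
  have h3 : tensorμ A A M N ≫ (α_ A M (A ⊗ N)).hom ≫ A ◁ ((α_ M A N).inv ≫ (β_ M A).hom ▷ N) =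
      (α_ A A (M ⊗ N)).hom ≫ A ◁ (α_ A M N).inv := by
    simp only [tensorμ, MonoidalCategory.whiskerLeft_comp, Category.assoc, Iso.inv_hom_id_assoc,
      whiskerLeft_hom_inv_assoc]
    rw [← MonoidalCategory.whiskerLeft_comp A (_ ▷ N), ← comp_whiskerRight,
      SymmetricCategory.symmetry]
    simp
  calc tensorAct a a' ≫ g = tensorμ A A M N ≫ (A ⊗ M) ◁ a' ≫ a ▷ N ≫ g := by
        rw [tensorAct, Category.assoc, MonoidalCategory.tensorHom_def', Category.assoc]
    _ = (tensorμ A A M N ≫ (α_ A M (A ⊗ N)).hom ≫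
          A ◁ ((α_ M A N).inv ≫ (β_ M A).hom ▷ N)) ≫ A ◁ (a ▷ N ≫ g) ≫ c := by
        rw [h1', associator_naturality_right_assoc, ← MonoidalCategory.whiskerLeft_comp_assoc, h2',
          h1']
        simp only [MonoidalCategory.whiskerLeft_comp, Category.assoc]
    _ = (A ⊗ A) ◁ g ≫ μ[A] ▷ P ≫ c := by
        rw [h3, hc.mul, associator_naturality_right_assoc,
          ← MonoidalCategory.whiskerLeft_comp_assoc, h1]
        simp only [MonoidalCategory.whiskerLeft_comp, Category.assoc]
    _ = _ := by rw [MonoidalCategory.tensorHom_def', Category.assoc]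

/-- A map semilinear over `μ : A ⊗ A ⟶ A` is linear in the first variable. -/
lemma linear_of_semilinear {g : M ⊗ N ⟶ P} (ha' : IsAct a')
    (h : tensorAct a a' ≫ g = (μ[A] ⊗ₘ g) ≫ c) :
    A ◁ g ≫ c = (α_ A M N).inv ≫ a ▷ N ≫ g := by
  have h0 : (ρ_ A).inv ▷ (M ⊗ N) ≫ tensorμ A (𝟙_ D) M N ≫ (A ⊗ M) ◁ (λ_ N).hom =
      (α_ A M N).inv := by
    simp only [tensorμ, braiding_tensorUnit_left, Category.assoc]
    monoidal
  have e := congrArg (((ρ_ A).inv ≫ A ◁ η[A]) ▷ (M ⊗ N) ≫ ·) h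
  have h1 : ((ρ_ A).inv ≫ A ◁ η[A]) ▷ (M ⊗ N) ≫ (μ[A] ⊗ₘ g) = A ◁ g := by
    rw [MonoidalCategory.tensorHom_def, ← comp_whiskerRight_assoc, Category.assoc, MonObj.mul_one]
    simp
  have h2 : ((ρ_ A).inv ≫ A ◁ η[A]) ▷ (M ⊗ N) ≫ tensorAct a a' = (α_ A M N).inv ≫ a ▷ N := by
    rw [tensorAct, comp_whiskerRight, Category.assoc, ← id_tensorHom, tensorμ_natural_left_assoc,
      tensorHom_comp_tensorHom, ha'.one, ← h0, MonoidalCategory.tensorHom_def']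
    simp
  simp only [reassoc_of% h1] at e
  rw [← e, reassoc_of% h2]

/-- A map semilinear over `μ : A ⊗ A ⟶ A` is linear in the second variable. -/
lemma linear_of_semilinear' {g : M ⊗ N ⟶ P} (ha : IsAct a)
    (h : tensorAct a a' ≫ g = (μ[A] ⊗ₘ g) ≫ c) :
    A ◁ g ≫ c = (α_ A M N).inv ≫ (β_ A M).hom ▷ N ≫ (α_ M A N).hom ≫ M ◁ a' ≫ g := by
  have h0 : (λ_ A).inv ▷ (M ⊗ N) ≫ tensorμ (𝟙_ D) A M N ≫ (λ_ M).hom ▷ (A ⊗ N) =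
      (α_ A M N).inv ≫ (β_ A M).hom ▷ N ≫ (α_ M A N).hom := by
    simp [tensorμ]
  have e := congrArg (((λ_ A).inv ≫ η[A] ▷ A) ▷ (M ⊗ N) ≫ ·) h
  have h1 : ((λ_ A).inv ≫ η[A] ▷ A) ▷ (M ⊗ N) ≫ (μ[A] ⊗ₘ g) = A ◁ g := by
    rw [MonoidalCategory.tensorHom_def, ← comp_whiskerRight_assoc, Category.assoc, MonObj.one_mul]
    simp
  have h2 : ((λ_ A).inv ≫ η[A] ▷ A) ▷ (M ⊗ N) ≫ tensorAct a a' =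
      (α_ A M N).inv ≫ (β_ A M).hom ▷ N ≫ (α_ M A N).hom ≫ M ◁ a' := by
    rw [tensorAct, comp_whiskerRight, Category.assoc, ← tensorHom_id η[A] A,
      tensorμ_natural_left_assoc,
      tensorHom_comp_tensorHom, ha.one, ← reassoc_of% h0, MonoidalCategory.tensorHom_def]
    simp
  simp only [reassoc_of% h1] at e
  rw [← e, reassoc_of% h2]

/-- A map semilinear over `μ : A ⊗ A ⟶ A` is balanced. -/
lemma balanced_of_semilinear {g : M ⊗ N ⟶ P} (ha : IsAct a)
    (ha' : IsAct a') (h : tensorAct a a' ≫ g = (μ[A] ⊗ₘ g) ≫ c) :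
    ((β_ M A).hom ≫ a) ▷ N ≫ g = ((α_ M A N).hom ≫ M ◁ a') ≫ g := by
  have e := (linear_of_semilinear ha' h).symm.trans (linear_of_semilinear' ha h)
  rw [Iso.inv_comp_eq, Iso.hom_inv_id_assoc] at e
  rw [comp_whiskerRight, Category.assoc, e, ← comp_whiskerRight_assoc, SymmetricCategory.symmetry]
  simp

/-- The two actions of `A` on a module, from the left and from the right, commute. -/
lemma act_comm [IsCommMonObj A] (ha : IsAct a) :
    A ◁ ((β_ M A).hom ≫ a) ≫ a = (α_ A M A).inv ≫ a ▷ A ≫ (β_ M A).hom ≫ a := by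
  have e : A ◁ a ≫ a = (α_ A A M).inv ≫ μ[A] ▷ M ≫ a := by rw [ha.mul, Iso.inv_hom_id_assoc]
  rw [BraidedCategory.braiding_naturality_left_assoc, MonoidalCategory.whiskerLeft_comp,
    Category.assoc, e, BraidedCategory.braiding_tensor_left_hom]
  simp only [Category.assoc, Iso.hom_inv_id_assoc, Iso.inv_hom_id_assoc]
  rw [← comp_whiskerRight_assoc (β_ A A).hom, IsCommMonObj.mul_comm]

/-- The common section of the two maps `M ⊗ A ⊗ N ⇉ M ⊗ N`. -/
lemma balancedSection (ha : IsAct a) (ha' : IsAct a') :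
    ∃ s : M ⊗ N ⟶ (M ⊗ A) ⊗ N, s ≫ ((β_ M A).hom ≫ a) ▷ N = 𝟙 _ ∧
      s ≫ (α_ M A N).hom ≫ M ◁ a' = 𝟙 _ := by
  refine ⟨((ρ_ M).inv ≫ M ◁ η[A]) ▷ N, ?_, ?_⟩
  · rw [← comp_whiskerRight, Category.assoc, BraidedCategory.braiding_naturality_right_assoc,
      ha.one]
    simp
  · rw [comp_whiskerRight, Category.assoc, associator_naturality_middle_assoc,
      ← MonoidalCategory.whiskerLeft_comp, ha'.one]
    simp

variable [ReflexiveTensor D]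

/-- The balanced tensor product is the extension of scalars of the `A ⊗ A`-module `M ⊗ N` along
the multiplication of `A`. -/
lemma isExt_of_balanced {π : M ⊗ N ⟶ P} (ha : IsAct a) (ha' : IsAct a') (hc : IsAct c)
    (h1 : A ◁ π ≫ c = (α_ A M N).inv ≫ a ▷ N ≫ π)
    (h2 : IsCoeq (((β_ M A).hom ≫ a) ▷ N) ((α_ M A N).hom ≫ M ◁ a') π) :
    IsExt μ[A] (tensorAct a a') c π := by
  have := h2.epi
  obtain ⟨s, s1, s2⟩ := balancedSection ha ha'
  have := (h2.whiskerLeft s s1 s2 A).epi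
  refine IsExt.of_univ ?_ hc (semilinear_of_balanced hc h1 h2.w) (fun p hp g hg => ?_)
    (fun p hp l l' _ _ e => (cancel_epi π).1 e)
  · obtain ⟨r, h1, h2⟩ := tensorAct_unital (φ := 𝟙 A) (φ' := 𝟙 A) ⟨η, by simp, ha.one⟩
      ⟨η, by simp, ha'.one⟩
    refine ⟨r, ?_, h2⟩
    rw [id_tensorHom_id, Category.comp_id] at h1
    rw [h1, MonObj.tensorObj.one_def, Category.assoc, MonoidalCategory.tensorHom_def',
      Category.assoc, MonObj.one_mul]
    simp
  · obtain ⟨l, hl⟩ := h2.desc g (balanced_of_semilinear ha ha' hg)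
    refine ⟨l, hl, ?_⟩
    rw [← cancel_epi (A ◁ π), reassoc_of% h1, hl, ← MonoidalCategory.whiskerLeft_comp_assoc, hl,
      linear_of_semilinear ha' hg]

/-- The action `A ⊗ P ⟶ P` exhibits `P` as `A ⊗_A P`: the coequalizer diagram is split. -/
lemma isExt_of_isAct [IsCommMonObj A] (h : IsAct c) : IsExt μ[A] (tensorAct μ[A] c) c c := by
  refine isExt_of_balanced (isAct_mul A) h h ?_ ?_
  · rw [h.mul, Iso.inv_hom_id_assoc]
  · rw [IsCommMonObj.mul_comm]
    refine IsCoeq.of_split (s := (λ_ P).inv ≫ η[A] ▷ P)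
      (t := (λ_ _).inv ≫ η[A] ▷ (A ⊗ P) ≫ (α_ A A P).inv) ?_ ?_ ?_ ?_
    · rw [h.mul, Category.assoc]
    · rw [Category.assoc, h.one, Iso.inv_hom_id]
    · rw [Category.assoc, Category.assoc, associator_inv_naturality_left_assoc,
        ← comp_whiskerRight, MonObj.one_mul]
      simp
    · rw [Category.assoc, Category.assoc, Iso.inv_hom_id_assoc, ← whisker_exchange]
      simp

/-- The balanced tensor product of two modules exists. -/
lemma exists_balanced [IsCommMonObj A] (ha : IsAct a) (ha' : IsAct a') :
    ∃ (P : D) (c : A ⊗ P ⟶ P) (π : M ⊗ N ⟶ P), IsAct c ∧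
      A ◁ π ≫ c = (α_ A M N).inv ≫ a ▷ N ≫ π ∧
      IsCoeq (((β_ M A).hom ≫ a) ▷ N) ((α_ M A N).hom ≫ M ◁ a') π := by
  obtain ⟨s, s1, s2⟩ := balancedSection ha ha'
  set p₁ := ((β_ M A).hom ≫ a) ▷ N with hp₁
  set p₂ := (α_ M A N).hom ≫ M ◁ a' with hp₂
  have : IsReflexivePair p₁ p₂ := ⟨s, s1, s2⟩
  obtain ⟨P, π, hπ⟩ : ∃ (P : D) (π : M ⊗ N ⟶ P), IsCoeq p₁ p₂ π :=
    ⟨_, coequalizer.π p₁ p₂, coequalizer.condition _ _, ⟨coequalizerIsCoequalizer _ _⟩⟩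
  have hA := hπ.whiskerLeft s s1 s2 A
  have := hA.epi
  have := hπ.epi
  have hAA := (hπ.whiskerLeft s s1 s2 (A ⊗ A)).epi
  have hI := (hπ.whiskerLeft s s1 s2 (𝟙_ D)).epi
  obtain ⟨c, hc⟩ := hA.desc ((α_ A M N).inv ≫ a ▷ N ≫ π) (by
    have e1 : A ◁ p₂ ≫ (α_ A M N).inv ≫ a ▷ N =
        (α_ A (M ⊗ A) N).inv ≫ ((α_ A M A).inv ≫ a ▷ A) ▷ N ≫ p₂ := by
      rw [hp₂, MonoidalCategory.whiskerLeft_comp, Category.assoc,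
        associator_inv_naturality_right_assoc, whisker_exchange, comp_whiskerRight, Category.assoc,
        associator_naturality_left_assoc]
      simp
    rw [reassoc_of% e1, ← hπ.w, hp₁, associator_inv_naturality_middle_assoc,
      ← comp_whiskerRight_assoc, ← comp_whiskerRight_assoc, act_comm ha, Category.assoc])
  refine ⟨P, c, π, ⟨?_, ?_⟩, hc, hπ⟩
  · rw [← cancel_epi ((𝟙_ D) ◁ π), whisker_exchange_assoc, hc,
      associator_inv_naturality_left_assoc, ← comp_whiskerRight_assoc, ha.one]
    simp
  · rw [← cancel_epi ((A ⊗ A) ◁ π), whisker_exchange_assoc, hc,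
      associator_naturality_right_assoc, ← MonoidalCategory.whiskerLeft_comp_assoc, hc]
    simp only [MonoidalCategory.whiskerLeft_comp, Category.assoc, hc]
    rw [associator_inv_naturality_left_assoc, ← comp_whiskerRight_assoc, ha.mul,
      associator_inv_naturality_middle_assoc]
    simp

end Balanced

end Tensor

/-! ### The symmetric monoidal category of modules -/

namespace ModCat

variable {D : Type u} [Category.{v} D] [MonoidalCategory D]

section Basic

variable {A : D} [MonObj A]

/-- The action of `A` on the object underlying an `A`-module. -/
def act (M : CategoryTheory.Mod D A) : A ⊗ M.X ⟶ M.X := ModObj.smul (M := A) (X := M.X)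

lemma isAct_act (M : CategoryTheory.Mod D A) : IsAct (act M) := isAct_smul A M.X

lemma hom_lin {M N : CategoryTheory.Mod D A} (f : M ⟶ N) :
    act M ≫ f.hom = A ◁ f.hom ≫ act N :=
  IsModHom.smul_hom (A := A) (f := f.hom)

/-- A linear map, as a morphism of modules. -/
def homMk {M N : CategoryTheory.Mod D A} (f : M.X ⟶ N.X) (h : act M ≫ f = A ◁ f ≫ act N) :
    M ⟶ N :=
  CategoryTheory.Mod.Hom.mk' f h

/-- The module given by an action map. -/
def ofAct {P : D} (c : A ⊗ P ⟶ P) (hc : IsAct c) : CategoryTheory.Mod D A where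
  X := P
  mod := ⟨c, hc.one, hc.mul⟩

variable {R M : D} {φ : R ⟶ A} {a : R ⊗ M ⟶ M}

lemma hom_ext_of_isExt {N P : CategoryTheory.Mod D A} {f : M ⟶ N.X} (h : IsExt φ a (act N) f)
    {k k' : N ⟶ P} (e : f ≫ k.hom = f ≫ k'.hom) : k = k' :=
  CategoryTheory.Mod.hom_ext _ _ (h.hom_ext (hom_lin k) (hom_lin k') e)

variable [ReflexiveTensor D]

/-- The linear map out of an extension of scalars induced by a semilinear map. -/
noncomputable def lift {N P : CategoryTheory.Mod D A} {f : M ⟶ N.X} (h : IsExt φ a (act N) f)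
    (g : M ⟶ P.X) (hg : a ≫ g = (φ ⊗ₘ g) ≫ act P) : N ⟶ P :=
  homMk (h.desc (isAct_act P) g hg).choose (h.desc (isAct_act P) g hg).choose_spec.2

lemma fac {N P : CategoryTheory.Mod D A} {f : M ⟶ N.X} (h : IsExt φ a (act N) f)
    (g : M ⟶ P.X) (hg : a ≫ g = (φ ⊗ₘ g) ≫ act P) : f ≫ (lift h g hg).hom = g :=
  (h.desc (isAct_act P) g hg).choose_spec.1

/-- The isomorphism between two extensions of scalars of the same module. -/
noncomputable def extIso {N P : CategoryTheory.Mod D A} {f : M ⟶ N.X} {g : M ⟶ P.X}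
    (h : IsExt φ a (act N) f) (h' : IsExt φ a (act P) g) : N ≅ P where
  hom := lift h g h'.lin
  inv := lift h' f h.lin
  hom_inv_id := hom_ext_of_isExt h (by
    rw [CategoryTheory.Mod.comp_hom', ← Category.assoc, fac, fac]; simp)
  inv_hom_id := hom_ext_of_isExt h' (by
    rw [CategoryTheory.Mod.comp_hom', ← Category.assoc, fac, fac]; simp)

lemma fac_extIso {N P : CategoryTheory.Mod D A} {f : M ⟶ N.X} {g : M ⟶ P.X}
    (h : IsExt φ a (act N) f) (h' : IsExt φ a (act P) g) : f ≫ (extIso h h').hom.hom = g :=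
  fac h g h'.lin

end Basic

variable [SymmetricCategory D] [ReflexiveTensor D] {A : D} [MonObj A] [IsCommMonObj A]

/-- The multiplication of a commutative monoid is a map of monoids, along which `⊗_A` extends
scalars. -/
local instance isMonHom_mul : IsMonHom μ[A] where
  one_hom := by
    rw [MonObj.tensorObj.one_def, Category.assoc, MonoidalCategory.tensorHom_def',
      Category.assoc, MonObj.one_mul]
    simp
  mul_hom := by rw [MonObj.tensorObj.mul_def, Category.assoc, MonObj.mul_mul_mul_comm]

section Tensor

variable (M N P : CategoryTheory.Mod D A)

lemma exists_tensor : ∃ (P : CategoryTheory.Mod D A) (π : M.X ⊗ N.X ⟶ P.X),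
    A ◁ π ≫ act P = (α_ A M.X N.X).inv ≫ act M ▷ N.X ≫ π ∧
      IsCoeq (((β_ M.X A).hom ≫ act M) ▷ N.X) ((α_ M.X A N.X).hom ≫ M.X ◁ act N) π := by
  obtain ⟨P, c, π, hc, h1, h2⟩ := exists_balanced (isAct_act M) (isAct_act N)
  exact ⟨ofAct c hc, π, h1, h2⟩

/-- The tensor product `M ⊗_A N`. -/
noncomputable def tensorObj : CategoryTheory.Mod D A := (exists_tensor M N).choose

/-- The projection `M ⊗ N ⟶ M ⊗_A N`. -/
noncomputable def π : M.X ⊗ N.X ⟶ (tensorObj M N).X := (exists_tensor M N).choose_spec.choose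

lemma π_linear : A ◁ π M N ≫ act (tensorObj M N) = (α_ A M.X N.X).inv ≫ act M ▷ N.X ≫ π M N :=
  (exists_tensor M N).choose_spec.choose_spec.1

lemma π_coeq :
    IsCoeq (((β_ M.X A).hom ≫ act M) ▷ N.X) ((α_ M.X A N.X).hom ≫ M.X ◁ act N) (π M N) :=
  (exists_tensor M N).choose_spec.choose_spec.2

lemma isExt_π : IsExt μ[A] (tensorAct (act M) (act N)) (act (tensorObj M N)) (π M N) :=
  isExt_of_balanced (isAct_act M) (isAct_act N) (isAct_act _) (π_linear M N) (π_coeq M N)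

lemma isExt_π_left : IsExt ((μ[A] ⊗ₘ 𝟙 A) ≫ μ[A])
    (tensorAct (tensorAct (act M) (act N)) (act P)) (act (tensorObj (tensorObj M N) P))
    ((π M N ⊗ₘ 𝟙 P.X) ≫ π (tensorObj M N) P) :=
  ((isExt_π M N).tensor (IsExt.id (isAct_act P))).comp (isExt_π _ P)

lemma isExt_π_right : IsExt ((𝟙 A ⊗ₘ μ[A]) ≫ μ[A])
    (tensorAct (act M) (tensorAct (act N) (act P))) (act (tensorObj M (tensorObj N P)))
    ((𝟙 M.X ⊗ₘ π N P) ≫ π M (tensorObj N P)) :=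
  ((IsExt.id (isAct_act M)).tensor (isExt_π N P)).comp (isExt_π M _)

omit [ReflexiveTensor D] in
lemma tensorAct_assoc {R₁ R₂ R₃ M₁ M₂ M₃ : D} (a₁ : R₁ ⊗ M₁ ⟶ M₁) (a₂ : R₂ ⊗ M₂ ⟶ M₂)
    (a₃ : R₃ ⊗ M₃ ⟶ M₃) : tensorAct (tensorAct a₁ a₂) a₃ ≫ (α_ M₁ M₂ M₃).hom =
      ((α_ R₁ R₂ R₃).hom ⊗ₘ (α_ M₁ M₂ M₃).hom) ≫ tensorAct a₁ (tensorAct a₂ a₃) := by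
  have h := associator_monoidal R₁ R₂ R₃ M₁ M₂ M₃
  have e1 : tensorAct (tensorAct a₁ a₂) a₃ = tensorμ _ _ _ _ ≫ (tensorμ R₁ R₂ M₁ M₂ ▷ (R₃ ⊗ M₃)) ≫
      ((a₁ ⊗ₘ a₂) ⊗ₘ a₃) := by
    rw [tensorAct, tensorAct, ← tensorHom_id, tensorHom_comp_tensorHom, Category.id_comp]
  have e2 : tensorAct a₁ (tensorAct a₂ a₃) = tensorμ _ _ _ _ ≫ ((R₁ ⊗ M₁) ◁ tensorμ R₂ R₃ M₂ M₃) ≫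
      (a₁ ⊗ₘ (a₂ ⊗ₘ a₃)) := by
    rw [tensorAct, tensorAct, ← id_tensorHom, tensorHom_comp_tensorHom, Category.id_comp]
  rw [e1, e2, Category.assoc, Category.assoc, associator_naturality, reassoc_of% h]

/-- The reassociated projection `(M ⊗ N) ⊗ P ⟶ M ⊗_A (N ⊗_A P)` is universal for the same action as
`(M ⊗ N) ⊗ P ⟶ (M ⊗_A N) ⊗_A P`. -/
lemma isExt_assoc : IsExt ((μ[A] ⊗ₘ 𝟙 A) ≫ μ[A])
    (tensorAct (tensorAct (act M) (act N)) (act P)) (act (tensorObj M (tensorObj N P)))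
    ((α_ M.X N.X P.X).hom ≫ (𝟙 M.X ⊗ₘ π N P) ≫ π M (tensorObj N P)) := by
  have h := (isExt_π_right M N P).precomp_iso (α_ A A A) (α_ M.X N.X P.X)
    (tensorAct_assoc (act M) (act N) (act P))
  have e : (α_ A A A).hom ≫ (𝟙 A ⊗ₘ μ[A]) ≫ μ[A] = (μ[A] ⊗ₘ 𝟙 A) ≫ μ[A] := by simp
  rwa [e] at h

/-- The associativity isomorphism of `⊗_A`. -/
noncomputable def associator : tensorObj (tensorObj M N) P ≅ tensorObj M (tensorObj N P) :=
  extIso (isExt_π_left M N P) (isExt_assoc M N P)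

lemma π_associator : (π M N ⊗ₘ 𝟙 P.X) ≫ π (tensorObj M N) P ≫ (associator M N P).hom.hom =
    (α_ M.X N.X P.X).hom ≫ (𝟙 M.X ⊗ₘ π N P) ≫ π M (tensorObj N P) := by
  rw [← Category.assoc]
  exact fac_extIso (isExt_π_left M N P) (isExt_assoc M N P)

/-- The unit of `⊗_A`: the module `A`. -/
def unit (A : D) [MonObj A] : CategoryTheory.Mod D A := ofAct μ[A] (isAct_mul A)

lemma isExt_act : IsExt μ[A] (tensorAct (act (unit A)) (act M)) (act M) (act M) :=
  isExt_of_isAct (isAct_act M)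

omit [ReflexiveTensor D] in
lemma tensorAct_braiding {R R' M M' : D} (a : R ⊗ M ⟶ M) (a' : R' ⊗ M' ⟶ M') :
    tensorAct a a' ≫ (β_ M M').hom = ((β_ R R').hom ⊗ₘ (β_ M M').hom) ≫ tensorAct a' a := by
  have h1 : tensorμ R R' M M' ≫ (β_ (R ⊗ M) (R' ⊗ M')).hom =
      ((β_ R R').hom ⊗ₘ (β_ M M').hom) ≫ tensorμ R' R M' M := by
    simp [tensorμ, SymmetricCategory.braiding_swap_eq_inv_braiding R' M,
      MonoidalCategory.tensorHom_def]
  rw [tensorAct, Category.assoc, BraidedCategory.braiding_naturality, reassoc_of% h1, tensorAct]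

lemma isExt_braiding {M N : CategoryTheory.Mod D A} {P : D} {c : A ⊗ P ⟶ P} {f : M.X ⊗ N.X ⟶ P}
    (h : IsExt μ[A] (tensorAct (act M) (act N)) c f) :
    IsExt μ[A] (tensorAct (act N) (act M)) c ((β_ N.X M.X).hom ≫ f) := by
  have h := h.precomp_iso (β_ A A) (β_ N.X M.X) (tensorAct_braiding (act N) (act M))
  rwa [IsCommMonObj.mul_comm] at h

/-- The left unit isomorphism of `⊗_A`. -/
noncomputable def leftUnitor : tensorObj (unit A) M ≅ M := extIso (isExt_π _ M) (isExt_act M)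

lemma π_leftUnitor : π (unit A) M ≫ (leftUnitor M).hom.hom = act M :=
  fac_extIso (isExt_π _ M) (isExt_act M)

/-- The right unit isomorphism of `⊗_A`. -/
noncomputable def rightUnitor : tensorObj M (unit A) ≅ M :=
  extIso (isExt_π M _) (isExt_braiding (isExt_act M))

lemma π_rightUnitor : π M (unit A) ≫ (rightUnitor M).hom.hom = (β_ M.X A).hom ≫ act M :=
  fac_extIso (isExt_π M _) (isExt_braiding (isExt_act M))

/-- The symmetry of `⊗_A`. -/
noncomputable def braiding : tensorObj M N ≅ tensorObj N M :=
  extIso (isExt_π M N) (isExt_braiding (isExt_π N M))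

lemma π_braiding : π M N ≫ (braiding M N).hom.hom = (β_ M.X N.X).hom ≫ π N M :=
  fac_extIso (isExt_π M N) (isExt_braiding (isExt_π N M))

variable {M N P}

omit [ReflexiveTensor D] in
lemma tensorAct_lin {R R' M M' N N' : D} {a : R ⊗ M ⟶ M} {a' : R' ⊗ M' ⟶ M'} {b : R ⊗ N ⟶ N}
    {b' : R' ⊗ N' ⟶ N'} {f : M ⟶ N} {g : M' ⟶ N'} (hf : a ≫ f = R ◁ f ≫ b)
    (hg : a' ≫ g = R' ◁ g ≫ b') :
    tensorAct a a' ≫ (f ⊗ₘ g) = (R ⊗ R') ◁ (f ⊗ₘ g) ≫ tensorAct b b' := by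
  rw [tensorAct, tensorAct, Category.assoc, tensorHom_comp_tensorHom, hf, hg,
    ← tensorHom_comp_tensorHom, tensorμ_natural_right_assoc]

/-- The tensor product of two linear maps. -/
noncomputable def tensorHom {M N M' N' : CategoryTheory.Mod D A} (f : M ⟶ M') (g : N ⟶ N') :
    tensorObj M N ⟶ tensorObj M' N' :=
  lift (isExt_π M N) ((f.hom ⊗ₘ g.hom) ≫ π M' N') (by
    rw [← Category.assoc, tensorAct_lin (hom_lin f) (hom_lin g), Category.assoc, (isExt_π _ _).lin,
      ← id_tensorHom, tensorHom_comp_tensorHom_assoc, Category.id_comp])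

lemma π_tensorHom {M N M' N' : CategoryTheory.Mod D A} (f : M ⟶ M') (g : N ⟶ N') :
    π M N ≫ (tensorHom f g).hom = (f.hom ⊗ₘ g.hom) ≫ π M' N' :=
  fac (isExt_π M N) _ _

end Tensor

/-- The data of the monoidal structure on `A`-modules. -/
@[reducible]
noncomputable def monStruct (A : D) [MonObj A] [IsCommMonObj A] :
    MonoidalCategoryStruct (CategoryTheory.Mod D A) where
  tensorObj := tensorObj
  tensorHom := tensorHom
  whiskerLeft M _ _ f := tensorHom (𝟙 M) f
  whiskerRight f M := tensorHom f (𝟙 M)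
  tensorUnit := unit A
  associator := associator
  leftUnitor := leftUnitor
  rightUnitor := rightUnitor

/-- Two linear maps out of `M ⊗_A N` agree if they agree on `M ⊗ N`. -/
lemma tensor_ext {M N P : CategoryTheory.Mod D A} {k k' : tensorObj M N ⟶ P}
    (h : π M N ≫ k.hom = π M N ≫ k'.hom) : k = k' :=
  hom_ext_of_isExt (isExt_π M N) h

/-- Maps out of `(M ⊗_A N) ⊗_A P` are detected on `(M ⊗ N) ⊗ P`. -/
lemma tensor₃_ext {M N P Q : CategoryTheory.Mod D A} {k k' : tensorObj (tensorObj M N) P ⟶ Q}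
    (h : (π M N ⊗ₘ 𝟙 P.X) ≫ π (tensorObj M N) P ≫ k.hom =
      (π M N ⊗ₘ 𝟙 P.X) ≫ π (tensorObj M N) P ≫ k'.hom) : k = k' :=
  hom_ext_of_isExt (isExt_π_left M N P) (by simpa only [Category.assoc] using h)

/-- Maps out of `((M ⊗_A N) ⊗_A P) ⊗_A Q` are detected on `((M ⊗ N) ⊗ P) ⊗ Q`. -/
lemma tensor₄_ext {M N P Q K : CategoryTheory.Mod D A}
    {k k' : tensorObj (tensorObj (tensorObj M N) P) Q ⟶ K}
    (h : ((π M N ⊗ₘ 𝟙 P.X) ⊗ₘ 𝟙 Q.X) ≫ (π (tensorObj M N) P ⊗ₘ 𝟙 Q.X) ≫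
        π (tensorObj (tensorObj M N) P) Q ≫ k.hom =
      ((π M N ⊗ₘ 𝟙 P.X) ⊗ₘ 𝟙 Q.X) ≫ (π (tensorObj M N) P ⊗ₘ 𝟙 Q.X) ≫
        π (tensorObj (tensorObj M N) P) Q ≫ k'.hom) : k = k' :=
  hom_ext_of_isExt (((isExt_π_left M N P).tensor (IsExt.id (isAct_act Q))).comp
    (isExt_π (tensorObj (tensorObj M N) P) Q)) (by
      have e : ((π M N ⊗ₘ 𝟙 P.X) ≫ π (tensorObj M N) P) ⊗ₘ 𝟙 Q.X =
        ((π M N ⊗ₘ 𝟙 P.X) ⊗ₘ 𝟙 Q.X) ≫ (π (tensorObj M N) P ⊗ₘ 𝟙 Q.X) := by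
        rw [tensorHom_comp_tensorHom, Category.id_comp]
      simpa only [e, Category.assoc] using h)

lemma π_whiskerLeft (M : CategoryTheory.Mod D A) {N N' : CategoryTheory.Mod D A} (g : N ⟶ N') :
    π M N ≫ (tensorHom (𝟙 M) g).hom = M.X ◁ g.hom ≫ π M N' := by
  rw [π_tensorHom, ← id_tensorHom]; rfl

lemma π_whiskerRight {M M' : CategoryTheory.Mod D A} (f : M ⟶ M') (N : CategoryTheory.Mod D A) :
    π M N ≫ (tensorHom f (𝟙 N)).hom = f.hom ▷ N.X ≫ π M' N := by
  rw [π_tensorHom, ← tensorHom_id]; rfl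

lemma tensorHom_id (M N : CategoryTheory.Mod D A) : tensorHom (𝟙 M) (𝟙 N) = 𝟙 (tensorObj M N) :=
  tensor_ext (by rw [π_tensorHom]; simp)

lemma tensorHom_comp {M N M' N' M'' N'' : CategoryTheory.Mod D A} (f : M ⟶ M') (g : N ⟶ N')
    (f' : M' ⟶ M'') (g' : N' ⟶ N'') :
    tensorHom f g ≫ tensorHom f' g' = tensorHom (f ≫ f') (g ≫ g') :=
  tensor_ext (by
    have h := π_tensorHom f g
    rw [CategoryTheory.Mod.comp_hom', reassoc_of% h, π_tensorHom, π_tensorHom]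
    simp)

lemma associator_naturality {X₁ X₂ X₃ Y₁ Y₂ Y₃ : CategoryTheory.Mod D A} (f₁ : X₁ ⟶ Y₁)
    (f₂ : X₂ ⟶ Y₂) (f₃ : X₃ ⟶ Y₃) :
    tensorHom (tensorHom f₁ f₂) f₃ ≫ (associator Y₁ Y₂ Y₃).hom =
      (associator X₁ X₂ X₃).hom ≫ tensorHom f₁ (tensorHom f₂ f₃) := by
  refine tensor₃_ext ?_
  have h1 := π_tensorHom (tensorHom f₁ f₂) f₃
  have h2 := π_associator X₁ X₂ X₃
  have h3 := π_associator Y₁ Y₂ Y₃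
  rw [CategoryTheory.Mod.comp_hom', CategoryTheory.Mod.comp_hom', reassoc_of% h1,
    reassoc_of% h2, π_tensorHom, tensorHom_comp_tensorHom_assoc, π_tensorHom,
    tensorHom_comp_tensorHom_assoc, π_tensorHom, Category.id_comp, Category.id_comp,
    ← Category.comp_id f₃.hom, ← tensorHom_comp_tensorHom_assoc, h3,
    MonoidalCategory.associator_naturality_assoc, tensorHom_comp_tensorHom_assoc, Category.comp_id,
    Category.comp_id]

lemma leftUnitor_naturality {X Y : CategoryTheory.Mod D A} (f : X ⟶ Y) :
    tensorHom (𝟙 (unit A)) f ≫ (leftUnitor Y).hom = (leftUnitor X).hom ≫ f := by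
  refine tensor_ext ?_
  have h := π_whiskerLeft (unit A) f
  have h' := π_leftUnitor X
  rw [CategoryTheory.Mod.comp_hom', CategoryTheory.Mod.comp_hom', reassoc_of% h,
    reassoc_of% h', π_leftUnitor]
  exact (hom_lin f).symm

lemma rightUnitor_naturality {X Y : CategoryTheory.Mod D A} (f : X ⟶ Y) :
    tensorHom f (𝟙 (unit A)) ≫ (rightUnitor Y).hom = (rightUnitor X).hom ≫ f := by
  refine tensor_ext ?_
  have h := π_whiskerRight f (unit A)
  have h' := π_rightUnitor X
  rw [CategoryTheory.Mod.comp_hom', CategoryTheory.Mod.comp_hom', reassoc_of% h,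
    reassoc_of% h', π_rightUnitor]
  have e : f.hom ▷ A ≫ (β_ Y.X A).hom ≫ act Y = ((β_ X.X A).hom ≫ act X) ≫ f.hom := by
    rw [Category.assoc, hom_lin, BraidedCategory.braiding_naturality_left_assoc]
  exact e

lemma π_associator' (M N P : CategoryTheory.Mod D A) :
    π M N ▷ P.X ≫ π (tensorObj M N) P ≫ (associator M N P).hom.hom =
      (α_ M.X N.X P.X).hom ≫ M.X ◁ π N P ≫ π M (tensorObj N P) := by
  simpa using π_associator M N P

lemma pentagon (W X Y Z : CategoryTheory.Mod D A) :
    tensorHom (associator W X Y).hom (𝟙 Z) ≫ (associator W (tensorObj X Y) Z).hom ≫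
        tensorHom (𝟙 W) (associator X Y Z).hom =
      (associator (tensorObj W X) Y Z).hom ≫ (associator W X (tensorObj Y Z)).hom := by
  refine tensor₄_ext ?_
  have h1 := π_whiskerRight (associator W X Y).hom Z
  have h2 := π_associator' W X Y
  have h3 := π_associator' W (tensorObj X Y) Z
  have h4 := π_whiskerLeft W (associator X Y Z).hom
  have h5 := π_associator' X Y Z
  have h6 := π_associator' (tensorObj W X) Y Z
  have h7 := π_associator' W X (tensorObj Y Z)
  simp only [CategoryTheory.Mod.comp_hom', MonoidalCategory.tensorHom_id]
  rw [reassoc_of% h1, ← comp_whiskerRight_assoc, ← comp_whiskerRight_assoc, Category.assoc, h2,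
    comp_whiskerRight, comp_whiskerRight, Category.assoc, Category.assoc, reassoc_of% h3, h4,
    ← MonoidalCategory.whiskerLeft_comp_assoc, associator_naturality_middle_assoc,
    ← MonoidalCategory.whiskerLeft_comp_assoc, h5, reassoc_of% h6,
    associator_naturality_left_assoc, ← whisker_exchange_assoc, h7]
  simp

lemma triangle (X Y : CategoryTheory.Mod D A) :
    (associator X (unit A) Y).hom ≫ tensorHom (𝟙 X) (leftUnitor Y).hom =
      tensorHom (rightUnitor X).hom (𝟙 Y) := by
  refine tensor₃_ext ?_
  have h := π_associator X (unit A) Y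
  rw [CategoryTheory.Mod.comp_hom', reassoc_of% h, π_whiskerLeft, π_whiskerRight,
    MonoidalCategory.id_tensorHom, MonoidalCategory.tensorHom_id, ← comp_whiskerRight_assoc,
    ← MonoidalCategory.whiskerLeft_comp_assoc, π_leftUnitor, π_rightUnitor]
  exact (Category.assoc _ _ _).symm.trans (π_coeq X Y).w.symm

/-- The monoidal category of modules over a commutative monoid. -/
@[reducible]
noncomputable def mon (A : D) [MonObj A] [IsCommMonObj A] :
    MonoidalCategory (CategoryTheory.Mod D A) :=
  letI := monStruct A
  MonoidalCategory.ofTensorHom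
    (id_tensorHom_id := tensorHom_id)
    (id_tensorHom := fun _ _ _ _ => rfl)
    (tensorHom_id := fun _ _ => rfl)
    (tensorHom_comp_tensorHom := tensorHom_comp)
    (associator_naturality := associator_naturality)
    (leftUnitor_naturality := leftUnitor_naturality)
    (rightUnitor_naturality := rightUnitor_naturality)
    (pentagon := pentagon)
    (triangle := triangle)

lemma braiding_naturality {M M' N N' : CategoryTheory.Mod D A} (f : M ⟶ M') (g : N ⟶ N') :
    tensorHom f g ≫ (braiding M' N').hom = (braiding M N).hom ≫ tensorHom g f := by
  refine tensor_ext ?_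
  have h := π_tensorHom f g
  have h' := π_braiding M N
  rw [CategoryTheory.Mod.comp_hom', CategoryTheory.Mod.comp_hom', reassoc_of% h,
    reassoc_of% h', π_tensorHom, π_braiding, BraidedCategory.braiding_naturality_assoc]

lemma braiding_symmetry (M N : CategoryTheory.Mod D A) :
    (braiding M N).hom ≫ (braiding N M).hom = 𝟙 _ := by
  refine tensor_ext ?_
  have h := π_braiding M N
  rw [CategoryTheory.Mod.comp_hom', reassoc_of% h, π_braiding]
  simp

lemma hexagon_forward (X Y Z : CategoryTheory.Mod D A) :
    (associator X Y Z).hom ≫ (braiding X (tensorObj Y Z)).hom ≫ (associator Y Z X).hom =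
      tensorHom (braiding X Y).hom (𝟙 Z) ≫ (associator Y X Z).hom ≫
        tensorHom (𝟙 Y) (braiding X Z).hom := by
  refine tensor₃_ext ?_
  have h1 := π_associator' X Y Z
  have h2 := π_braiding X (tensorObj Y Z)
  have h3 := π_associator' Y Z X
  have h4 := π_whiskerRight (braiding X Y).hom Z
  have h5 := π_associator' Y X Z
  have h6 := π_whiskerLeft Y (braiding X Z).hom
  simp only [CategoryTheory.Mod.comp_hom', MonoidalCategory.tensorHom_id]
  rw [reassoc_of% h1, reassoc_of% h2, BraidedCategory.braiding_naturality_right_assoc, h3,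
    reassoc_of% h4, ← comp_whiskerRight_assoc, π_braiding, comp_whiskerRight, Category.assoc,
    reassoc_of% h5, h6, ← MonoidalCategory.whiskerLeft_comp_assoc, π_braiding,
    MonoidalCategory.whiskerLeft_comp, Category.assoc, BraidedCategory.hexagon_forward_assoc]

/-- Modules over a commutative monoid form a symmetric monoidal category. -/
@[reducible]
noncomputable def sym (A : D) [MonObj A] [IsCommMonObj A] :
    letI := mon A
    SymmetricCategory (CategoryTheory.Mod D A) :=
  letI := mon A
  { braiding := braiding
    braiding_naturality_right := fun _ _ _ f => braiding_naturality _ f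
    braiding_naturality_left := fun f _ => braiding_naturality f _
    hexagon_forward := hexagon_forward
    hexagon_reverse := fun X Y Z => by
      -- the inverse of the forward hexagon, since the braiding is symmetric
      have h := hexagon_forward Z X Y
      change (α_ Z X Y).hom ≫ (braiding Z (X ⊗ Y)).hom ≫ (α_ X Y Z).hom =
        (braiding Z X).hom ▷ Y ≫ (α_ X Z Y).hom ≫ X ◁ (braiding Z Y).hom at h
      have h1 := braiding_symmetry (X ⊗ Y) Z
      have h2 : (braiding X Z).hom ▷ Y ≫ (braiding Z X).hom ▷ Y = 𝟙 _ := by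
        rw [← comp_whiskerRight, braiding_symmetry]
        exact id_whiskerRight _ _
      have h3 : X ◁ (braiding Y Z).hom ≫ X ◁ (braiding Z Y).hom = 𝟙 _ := by
        rw [← MonoidalCategory.whiskerLeft_comp, braiding_symmetry]
        exact MonoidalCategory.whiskerLeft_id _ _
      rw [← cancel_mono ((α_ Z X Y).hom ≫ (braiding Z (X ⊗ Y)).hom ≫ (α_ X Y Z).hom)]
      trans 𝟙 _
      · simp only [Category.assoc, Iso.inv_hom_id_assoc]
        rw [reassoc_of% h1, Iso.inv_hom_id]
      · rw [h, Category.assoc, Category.assoc, reassoc_of% h2, Iso.inv_hom_id_assoc, h3]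
        rfl
    symmetry := braiding_symmetry }

/-- The forgetful functor from modules is lax symmetric monoidal. -/
@[reducible]
noncomputable def lax (A : D) [MonObj A] [IsCommMonObj A] :
    letI := mon A
    letI := sym A
    (CategoryTheory.Mod.forget (D := D) A).LaxBraided :=
  letI := mon A
  letI := sym A
  { toLaxMonoidal := Functor.LaxMonoidal.mk (F := CategoryTheory.Mod.forget (D := D) A) η[A] π
      (fun f N => (π_whiskerRight f N).symm) (fun M f => (π_whiskerLeft M f).symm)
      π_associator'
      (fun M => ((congrArg (η[A] ▷ M.X ≫ ·) (π_leftUnitor M)).trans (isAct_act M).one).symm)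
      (fun M => by
        have e : M.X ◁ η[A] ≫ (β_ M.X A).hom ≫ act M = (ρ_ M.X).hom := by
          rw [BraidedCategory.braiding_naturality_right_assoc, (isAct_act M).one]
          simp
        exact ((congrArg (M.X ◁ η[A] ≫ ·) (π_rightUnitor M)).trans e).symm)
    braided := π_braiding }

/-- The symmetric monoidal structure `⊗_A` on modules over a commutative monoid `A`. -/
noncomputable def modTensor (A : D) [MonObj A] [IsCommMonObj A] : ModTensor A where
  mon := mon A
  sym := sym A
  lax := lax A
  unit_iso := by
    change IsIso ((ρ_ A).inv ≫ A ◁ η[A] ≫ μ[A])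
    rw [MonObj.mul_one, Iso.inv_hom_id]
    infer_instance
  μ_linear := π_linear
  μ_balanced := π_coeq

end ModCat

/-! ### Extension of scalars and a given tensor product of modules -/

namespace ModTensor

variable {D : Type u} [Category.{v} D] [MonoidalCategory D] [SymmetricCategory D] {A : D}
  [MonObj A] [IsCommMonObj A] (T : ModTensor A)

/-- The action of `A` on the object underlying an `A`-module. -/
def act (M : T.toSymMonCat.carrier) : A ⊗ T.forget.obj M ⟶ T.forget.obj M :=
  ModObj.smul (M := A) (X := T.forget.obj M)

lemma isAct_act (M : T.toSymMonCat.carrier) : IsAct (T.act M) := isAct_smul A (T.forget.obj M)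

lemma lin {M N : T.toSymMonCat.carrier} (f : M ⟶ N) :
    T.act M ≫ T.forget.map f = A ◁ T.forget.map f ≫ T.act N :=
  ModCat.hom_lin (A := A) f

lemma hom_ext {M N : T.toSymMonCat.carrier} {f g : M ⟶ N} (h : T.forget.map f = T.forget.map g) :
    f = g :=
  CategoryTheory.Mod.hom_ext (A := A) f g h

/-- The module given by an action map. -/
def ofAct {P : D} (c : A ⊗ P ⟶ P) (hc : IsAct c) : T.toSymMonCat.carrier := ModCat.ofAct c hc

/-- The projection `M ⊗ N ⟶ M ⊗_A N`. -/
abbrev π (M N : T.toSymMonCat.carrier) : T.forget.obj M ⊗ T.forget.obj N ⟶ T.forget.obj (M ⊗ N) :=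
  Functor.LaxMonoidal.μ T.forget M N

/-- The unit `A` of the tensor product of `A`-modules is the extension of scalars of the unit. -/
lemma isExt_ε : IsExt η[A] (λ_ (𝟙_ D)).hom (T.act (𝟙_ _)) (Functor.LaxMonoidal.ε T.forget) := by
  have hi : IsIso (A ◁ Functor.LaxMonoidal.ε T.forget ≫ T.act (𝟙_ _)) := by
    have := T.unit_iso
    have e : A ◁ Functor.LaxMonoidal.ε T.forget ≫ T.act (𝟙_ _) = (ρ_ A).hom ≫ (ρ_ A).inv ≫
      A ◁ Functor.LaxMonoidal.ε T.forget ≫ T.act (𝟙_ _) := by rw [Iso.hom_inv_id_assoc]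
    rw [e]
    exact IsIso.comp_isIso' inferInstance this
  have e : (A ◁ η[A] ≫ μ[A]) ▷ 𝟙_ D = (α_ A (𝟙_ D) (𝟙_ D)).hom ≫ A ◁ (λ_ (𝟙_ D)).hom := by
    rw [MonObj.mul_one, MonoidalCategory.triangle]
  refine ⟨⟨𝟙 _, by simp, by simp⟩, T.isAct_act _, ?_, ?_⟩
  · rw [MonoidalCategory.tensorHom_def', Category.assoc, (T.isAct_act _).one]
    simp
  · rw [e]
    exact IsCoeq.mk rfl (fun k _ =>
      ⟨inv (A ◁ Functor.LaxMonoidal.ε T.forget ≫ T.act (𝟙_ _)) ≫ k,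
        by rw [IsIso.hom_inv_id_assoc]⟩) inferInstance

section

variable [ReflexiveTensor D]

/-- The projection `M ⊗ N ⟶ M ⊗_A N` is an extension of scalars along the multiplication. -/
lemma isExt_π (M N : T.toSymMonCat.carrier) :
    IsExt μ[A] (tensorAct (T.act M) (T.act N)) (T.act (M ⊗ N)) (T.π M N) :=
  isExt_of_balanced (T.isAct_act M) (T.isAct_act N) (T.isAct_act _) (T.μ_linear M N)
    (T.μ_balanced M N)

end

variable {R M : D} {φ : R ⟶ A} {a : R ⊗ M ⟶ M}

variable {T} in
lemma hom_ext_of_isExt {N P : T.toSymMonCat.carrier} {f : M ⟶ T.forget.obj N}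
    (h : IsExt φ a (T.act N) f) {k k' : N ⟶ P}
    (e : f ≫ T.forget.map k = f ≫ T.forget.map k') : k = k' :=
  T.hom_ext (h.hom_ext (T.lin k) (T.lin k') e)

variable [ReflexiveTensor D]

/-- The linear map out of an extension of scalars induced by a semilinear map. -/
noncomputable def lift {N P : T.toSymMonCat.carrier} {f : M ⟶ T.forget.obj N}
    (h : IsExt φ a (T.act N) f) (g : M ⟶ T.forget.obj P) (hg : a ≫ g = (φ ⊗ₘ g) ≫ T.act P) :
    N ⟶ P :=
  ModCat.lift (A := A) (N := N) (P := P) h g hg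

lemma fac {N P : T.toSymMonCat.carrier} {f : M ⟶ T.forget.obj N}
    (h : IsExt φ a (T.act N) f) (g : M ⟶ T.forget.obj P) (hg : a ≫ g = (φ ⊗ₘ g) ≫ T.act P) :
    f ≫ T.forget.map (T.lift h g hg) = g :=
  ModCat.fac (A := A) (N := N) (P := P) h g hg

/-- The isomorphism between two extensions of scalars of the same module. -/
noncomputable def extIso {N P : T.toSymMonCat.carrier} {f : M ⟶ T.forget.obj N}
    {g : M ⟶ T.forget.obj P} (h : IsExt φ a (T.act N) f) (h' : IsExt φ a (T.act P) g) : N ≅ P where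
  hom := T.lift h g h'.lin
  inv := T.lift h' f h.lin
  hom_inv_id := hom_ext_of_isExt h (by
    rw [CategoryTheory.Functor.map_comp, ← Category.assoc, fac, fac,
      CategoryTheory.Functor.map_id, Category.comp_id])
  inv_hom_id := hom_ext_of_isExt h' (by
    rw [CategoryTheory.Functor.map_comp, ← Category.assoc, fac, fac,
      CategoryTheory.Functor.map_id, Category.comp_id])

lemma fac_extIso {N P : T.toSymMonCat.carrier} {f : M ⟶ T.forget.obj N}
    {g : M ⟶ T.forget.obj P} (h : IsExt φ a (T.act N) f) (h' : IsExt φ a (T.act P) g) :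
    f ≫ T.forget.map (T.extIso h h').hom = g :=
  T.fac h g h'.lin

end ModTensor

/-! ### Strong monoidality from universal maps -/

section Universal

universe v₁ u₁ v₂ u₂ v₃ u₃

variable {𝓐 : Type u₁} [Category.{v₁} 𝓐] [MonoidalCategory 𝓐]
  {𝓑 : Type u₂} [Category.{v₂} 𝓑] [MonoidalCategory 𝓑]
  {D : Type u₃} [Category.{v₃} D] [MonoidalCategory D]

/-- Let `G` and `P` be lax monoidal functors and `u X : G X ⟶ P (F X)` natural maps such
that morphisms in `𝓑` out of tensor products of values of `F` are detected after composition with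
`u` and with the structure maps of `P`. Isomorphisms `F X ⊗ F Y ≅ F (X ⊗ Y)` and `𝟙 ≅ F 𝟙` for
which `u` is monoidal then make `F` a strong monoidal functor. -/
@[reducible]
def coreMonoidalOfUniversal (G : 𝓐 ⥤ D) [G.LaxMonoidal] (P : 𝓑 ⥤ D) [P.LaxMonoidal] (F : 𝓐 ⥤ 𝓑)
    (u : ∀ X, G.obj X ⟶ P.obj (F.obj X))
    (hu : ∀ {X Y : 𝓐} (f : X ⟶ Y), G.map f ≫ u Y = u X ≫ P.map (F.map f))
      (e : 𝟙_ 𝓑 ≅ F.obj (𝟙_ 𝓐)) (m : ∀ X Y, F.obj X ⊗ F.obj Y ≅ F.obj (X ⊗ Y))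
    (he : Functor.LaxMonoidal.ε P ≫ P.map e.hom = Functor.LaxMonoidal.ε G ≫ u _)
    (hm : ∀ X Y, (u X ⊗ₘ u Y) ≫ Functor.LaxMonoidal.μ P _ _ ≫ P.map (m X Y).hom =
      Functor.LaxMonoidal.μ G X Y ≫ u _)
    (ext₂ : ∀ (X Y : 𝓐) {Q : 𝓑} (k k' : F.obj X ⊗ F.obj Y ⟶ Q),
      (u X ⊗ₘ u Y) ≫ Functor.LaxMonoidal.μ P _ _ ≫ P.map k =
        (u X ⊗ₘ u Y) ≫ Functor.LaxMonoidal.μ P _ _ ≫ P.map k' → k = k')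
    (ext₃ : ∀ (X Y Z : 𝓐) {Q : 𝓑} (k k' : (F.obj X ⊗ F.obj Y) ⊗ F.obj Z ⟶ Q),
      (((u X ⊗ₘ u Y) ≫ Functor.LaxMonoidal.μ P _ _) ⊗ₘ u Z) ≫
          Functor.LaxMonoidal.μ P _ _ ≫ P.map k =
        (((u X ⊗ₘ u Y) ≫ Functor.LaxMonoidal.μ P _ _) ⊗ₘ u Z) ≫
          Functor.LaxMonoidal.μ P _ _ ≫ P.map k' → k = k')
    (extl : ∀ (X : 𝓐) {Q : 𝓑} (k k' : 𝟙_ 𝓑 ⊗ F.obj X ⟶ Q),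
      (Functor.LaxMonoidal.ε P ⊗ₘ u X) ≫ Functor.LaxMonoidal.μ P _ _ ≫ P.map k =
        (Functor.LaxMonoidal.ε P ⊗ₘ u X) ≫ Functor.LaxMonoidal.μ P _ _ ≫ P.map k' → k = k')
    (extr : ∀ (X : 𝓐) {Q : 𝓑} (k k' : F.obj X ⊗ 𝟙_ 𝓑 ⟶ Q),
      (u X ⊗ₘ Functor.LaxMonoidal.ε P) ≫ Functor.LaxMonoidal.μ P _ _ ≫ P.map k =
        (u X ⊗ₘ Functor.LaxMonoidal.ε P) ≫ Functor.LaxMonoidal.μ P _ _ ≫ P.map k' → k = k') :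
    F.CoreMonoidal where
  εIso := e
  μIso := m
  μIso_hom_natural_left {X Y} f X' := ext₂ _ _ _ _ (by
    have h1 := hm X X'
    have h2 : u X ≫ P.map (F.map f) = G.map f ≫ u Y := (hu f).symm
    have h3 : u (X ⊗ X') ≫ P.map (F.map (f ▷ X')) = G.map (f ▷ X') ≫ u (Y ⊗ X') :=
      (hu _).symm
    rw [P.map_comp, P.map_comp, reassoc_of% h1, h3, ← Functor.LaxMonoidal.μ_natural_left_assoc,
      ← Functor.LaxMonoidal.μ_natural_left_assoc, ← MonoidalCategory.tensorHom_id,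
      ← MonoidalCategory.tensorHom_id, tensorHom_comp_tensorHom_assoc, h2, Category.comp_id, ← hm,
      tensorHom_comp_tensorHom_assoc, Category.id_comp])
  μIso_hom_natural_right {X Y} X' f := ext₂ _ _ _ _ (by
    have h1 := hm X' X
    have h2 : u X ≫ P.map (F.map f) = G.map f ≫ u Y := (hu f).symm
    have h3 : u (X' ⊗ X) ≫ P.map (F.map (X' ◁ f)) = G.map (X' ◁ f) ≫ u (X' ⊗ Y) :=
      (hu _).symm
    rw [P.map_comp, P.map_comp, reassoc_of% h1, h3, ← Functor.LaxMonoidal.μ_natural_right_assoc,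
      ← Functor.LaxMonoidal.μ_natural_right_assoc, ← MonoidalCategory.id_tensorHom,
      ← MonoidalCategory.id_tensorHom, tensorHom_comp_tensorHom_assoc, h2, Category.comp_id, ← hm,
      tensorHom_comp_tensorHom_assoc, Category.id_comp])
  associativity X Y Z := ext₃ _ _ _ _ _ (by
    have h1 := hm (X ⊗ Y) Z
    have h2 := hm X (Y ⊗ Z)
    have h3 : u ((X ⊗ Y) ⊗ Z) ≫ P.map (F.map (α_ X Y Z).hom) =
      G.map (α_ X Y Z).hom ≫ u (X ⊗ (Y ⊗ Z)) := (hu _).symm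
    have h4 := Functor.LaxMonoidal.associativity P (F.obj X) (F.obj Y) (F.obj Z)
    have h5 := Functor.LaxMonoidal.associativity G X Y Z
    trans (Functor.LaxMonoidal.μ G X Y ▷ G.obj Z) ≫ Functor.LaxMonoidal.μ G (X ⊗ Y) Z ≫
      G.map (α_ X Y Z).hom ≫ u _
    · rw [P.map_comp, P.map_comp, ← Functor.LaxMonoidal.μ_natural_left_assoc,
        ← MonoidalCategory.tensorHom_id, tensorHom_comp_tensorHom_assoc, Category.assoc, hm,
        Category.comp_id, ← Category.id_comp (u Z), ← tensorHom_comp_tensorHom_assoc,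
        reassoc_of% h1, h3, MonoidalCategory.tensorHom_id]
    · have h6 : (((u X ⊗ₘ u Y) ≫ Functor.LaxMonoidal.μ P _ _) ⊗ₘ u Z) =
        ((u X ⊗ₘ u Y) ⊗ₘ u Z) ≫ Functor.LaxMonoidal.μ P _ _ ▷ _ := by
        rw [← MonoidalCategory.tensorHom_id, tensorHom_comp_tensorHom, Category.comp_id]
      rw [reassoc_of% h5, ← h2, P.map_comp, P.map_comp, h6, Category.assoc, reassoc_of% h4,
        MonoidalCategory.associator_naturality_assoc, ← MonoidalCategory.id_tensorHom,
        ← MonoidalCategory.id_tensorHom, tensorHom_comp_tensorHom_assoc,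
        tensorHom_comp_tensorHom_assoc, ← Functor.LaxMonoidal.μ_natural_right_assoc,
        ← MonoidalCategory.id_tensorHom, tensorHom_comp_tensorHom_assoc, Category.assoc,
        Category.assoc, hm]
      simp)
  left_unitality X := extl _ _ _ (by
    have h1 := hm (𝟙_ 𝓐) X
    have h3 : u (𝟙_ 𝓐 ⊗ X) ≫ P.map (F.map (λ_ X).hom) = G.map (λ_ X).hom ≫ u X :=
      (hu _).symm
    have h4 := Functor.LaxMonoidal.left_unitality P (F.obj X)
    have h5 := Functor.LaxMonoidal.left_unitality G X
    trans (λ_ _).hom ≫ u X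
    · rw [MonoidalCategory.tensorHom_def', Category.assoc, ← h4, leftUnitor_naturality]
    · rw [P.map_comp, P.map_comp, ← Functor.LaxMonoidal.μ_natural_left_assoc,
        ← MonoidalCategory.tensorHom_id, tensorHom_comp_tensorHom_assoc, he, Category.comp_id,
        ← Category.id_comp (u X), ← tensorHom_comp_tensorHom_assoc, reassoc_of% h1, h3, h5]
      simp)
  right_unitality X := extr _ _ _ (by
    have h1 := hm X (𝟙_ 𝓐)
    have h3 : u (X ⊗ 𝟙_ 𝓐) ≫ P.map (F.map (ρ_ X).hom) = G.map (ρ_ X).hom ≫ u X :=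
      (hu _).symm
    have h4 := Functor.LaxMonoidal.right_unitality P (F.obj X)
    have h5 := Functor.LaxMonoidal.right_unitality G X
    trans (ρ_ _).hom ≫ u X
    · rw [MonoidalCategory.tensorHom_def, Category.assoc, ← h4, rightUnitor_naturality]
    · rw [P.map_comp, P.map_comp, ← Functor.LaxMonoidal.μ_natural_right_assoc,
        ← MonoidalCategory.id_tensorHom, tensorHom_comp_tensorHom_assoc, he, Category.comp_id,
        ← Category.id_comp (u X), ← tensorHom_comp_tensorHom_assoc, reassoc_of% h1, h3, h5]
      simp)

/-- A lax monoidal functor is braided as soon as a natural family as in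
`coreMonoidalOfUniversal` is monoidal, with braided source and target. -/
lemma braided_of_universal [BraidedCategory 𝓐] [BraidedCategory 𝓑] [BraidedCategory D] (G : 𝓐 ⥤ D)
    [G.LaxBraided] (P : 𝓑 ⥤ D) [P.LaxBraided] (F : 𝓐 ⥤ 𝓑) [F.LaxMonoidal]
    (u : ∀ X, G.obj X ⟶ P.obj (F.obj X))
    (hu : ∀ {X Y : 𝓐} (f : X ⟶ Y), G.map f ≫ u Y = u X ≫ P.map (F.map f))
    (hm : ∀ X Y, (u X ⊗ₘ u Y) ≫ Functor.LaxMonoidal.μ P _ _ ≫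
      P.map (Functor.LaxMonoidal.μ F X Y) = Functor.LaxMonoidal.μ G X Y ≫ u _)
    (ext₂ : ∀ (X Y : 𝓐) {Q : 𝓑} (k k' : F.obj X ⊗ F.obj Y ⟶ Q),
      (u X ⊗ₘ u Y) ≫ Functor.LaxMonoidal.μ P _ _ ≫ P.map k =
        (u X ⊗ₘ u Y) ≫ Functor.LaxMonoidal.μ P _ _ ≫ P.map k' → k = k') (X Y : 𝓐) :
    Functor.LaxMonoidal.μ F X Y ≫ F.map (β_ X Y).hom =
      (β_ (F.obj X) (F.obj Y)).hom ≫ Functor.LaxMonoidal.μ F Y X := by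
  refine ext₂ X Y _ _ ?_
  have h1 := hm X Y
  rw [P.map_comp, P.map_comp, reassoc_of% h1, ← hu, Functor.LaxBraided.braided_assoc,
    Functor.LaxBraided.braided_assoc, ← hm, BraidedCategory.braiding_naturality_assoc]

end Universal

/-! ### Universal lifts of functors to modules -/

section Lifts

attribute [local instance] ModCat.isMonHom_mul

variable {A B : SymMonCat.{v, u}} {R : A.carrier} [MonObj R] [IsCommMonObj R] {S : B.carrier}
  [MonObj S] [IsCommMonObj S]

/-- The action of `F R` on `F M`, for an `R`-module `M`. -/
def mapAct (F : A ⟶ B) (T : ModTensor R) (M : T.toSymMonCat.carrier) :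
    F.functor.obj R ⊗ F.functor.obj (T.forget.obj M) ⟶ F.functor.obj (T.forget.obj M) :=
  Functor.LaxMonoidal.μ F.functor R (T.forget.obj M) ≫ F.functor.map (T.act M)

lemma mapAct_naturality {F F₂ : A ⟶ B} (α : F ⟶ F₂) (T : ModTensor R)
    (M : T.toSymMonCat.carrier) :
    mapAct F T M ≫ α.nat.app (T.forget.obj M) =
      (α.nat.app R ⊗ₘ α.nat.app (T.forget.obj M)) ≫ mapAct F₂ T M := by
  rw [mapAct, mapAct, Category.assoc, α.nat.naturality, NatTrans.IsMonoidal.tensor_assoc]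

lemma mapAct_lin (F : A ⟶ B) (T : ModTensor R) {M N : T.toSymMonCat.carrier} (f : M ⟶ N) :
    mapAct F T M ≫ F.functor.map (T.forget.map f) =
      (F.functor.obj R ◁ F.functor.map (T.forget.map f)) ≫ mapAct F T N := by
  rw [mapAct, mapAct, Category.assoc, ← F.functor.map_comp, T.lin, F.functor.map_comp,
    Functor.LaxMonoidal.μ_natural_right_assoc]

variable {F : A ⟶ B} {φ : F.functor.obj R ⟶ S} {TR : ModTensor R} {TS : ModTensor S}

namespace ModLift

/-- The component `F M ⟶ F' M` of a lift at a module `M`. -/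
def app {F' : TR.toSymMonCat ⟶ TS.toSymMonCat} (l : ModLift F φ TR TS F')
    (M : TR.toSymMonCat.carrier) :
    F.functor.obj (TR.forget.obj M) ⟶ TS.forget.obj (F'.functor.obj M) :=
  l.unit.app M

lemma lin {F' : TR.toSymMonCat ⟶ TS.toSymMonCat} (l : ModLift F φ TR TS F')
    (M : TR.toSymMonCat.carrier) :
    mapAct F TR M ≫ l.app M = (φ ⊗ₘ l.app M) ≫ TS.act (F'.functor.obj M) :=
  l.linear M

lemma nat {F' : TR.toSymMonCat ⟶ TS.toSymMonCat} (l : ModLift F φ TR TS F')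
    {M N : TR.toSymMonCat.carrier} (f : M ⟶ N) :
    F.functor.map (TR.forget.map f) ≫ l.app N =
      l.app M ≫ TS.forget.map (F'.functor.map f) :=
  l.unit.naturality f

lemma unit_ε {F' : TR.toSymMonCat ⟶ TS.toSymMonCat} (l : ModLift F φ TR TS F') :
    (Functor.LaxMonoidal.ε F.functor ≫ F.functor.map (Functor.LaxMonoidal.ε TR.forget)) ≫
      l.app (𝟙_ _) =
        Functor.LaxMonoidal.ε TS.forget ≫ TS.forget.map (Functor.LaxMonoidal.ε F'.functor) :=
  l.monoidal.unit

lemma unit_μ {F' : TR.toSymMonCat ⟶ TS.toSymMonCat} (l : ModLift F φ TR TS F')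
    (M N : TR.toSymMonCat.carrier) :
    (Functor.LaxMonoidal.μ F.functor (TR.forget.obj M) (TR.forget.obj N) ≫
        F.functor.map (TR.π M N)) ≫ l.app (M ⊗ N) =
      (l.app M ⊗ₘ l.app N) ≫ TS.π _ _ ≫
        TS.forget.map (Functor.LaxMonoidal.μ F'.functor M N) :=
  l.monoidal.tensor M N

/-- The lift is given by extension of scalars along `φ`. -/
def IsUniv {F' : TR.toSymMonCat ⟶ TS.toSymMonCat} (l : ModLift F φ TR TS F') : Prop :=
  ∀ M, IsExt φ (mapAct F TR M) (TS.act (F'.functor.obj M)) (l.app M)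

end ModLift

section Existence

variable (TR TS)
variable {E : TR.toSymMonCat.carrier → TS.toSymMonCat.carrier}
  {u : ∀ M, F.functor.obj (TR.forget.obj M) ⟶ TS.forget.obj (E M)}

lemma exists_isExt_mapAct [ReflexiveTensor B.carrier] [IsMonHom φ] (M : TR.toSymMonCat.carrier) :
    ∃ (N : TS.toSymMonCat.carrier) (f : F.functor.obj (TR.forget.obj M) ⟶ TS.forget.obj N),
      IsExt φ (mapAct F TR M) (TS.act N) f := by
  obtain ⟨N, b, f, h⟩ := IsExt.exists_ext φ (mapAct F TR M)
    ⟨η[F.functor.obj R], IsMonHom.one_hom φ, ((TR.isAct_act M).map F.functor).one⟩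
  exact ⟨TS.ofAct b h.act, f, h⟩

variable {TR TS}

/-- The composite `F M ⟶ F N ⟶ E N` is semilinear, for a linear map `M ⟶ N`. -/
lemma semilinear_map_unit (h : ∀ M, IsExt φ (mapAct F TR M) (TS.act (E M)) (u M))
    {M N : TR.toSymMonCat.carrier} (f : M ⟶ N) :
    mapAct F TR M ≫ F.functor.map (TR.forget.map f) ≫ u N =
      (φ ⊗ₘ F.functor.map (TR.forget.map f) ≫ u N) ≫ TS.act (E N) := by
  have h1 := mapAct_lin F TR f
  rw [reassoc_of% h1, (h N).lin, ← MonoidalCategory.id_tensorHom, tensorHom_comp_tensorHom_assoc,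
    Category.id_comp]

section

variable [ReflexiveTensor B.carrier]

/-- The functor given on objects by a choice of extensions of scalars. -/
noncomputable def liftFunctor (h : ∀ M, IsExt φ (mapAct F TR M) (TS.act (E M)) (u M))
    : TR.toSymMonCat.carrier ⥤ TS.toSymMonCat.carrier where
  obj := E
  map {M N} f := TS.lift (h M) (F.functor.map (TR.forget.map f) ≫ u N) (semilinear_map_unit h f)
  map_id M := ModTensor.hom_ext_of_isExt (h M) (by
    rw [ModTensor.fac, CategoryTheory.Functor.map_id, CategoryTheory.Functor.map_id,
      CategoryTheory.Functor.map_id, Category.id_comp, Category.comp_id])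
  map_comp {M N P} f g := ModTensor.hom_ext_of_isExt (h M) (by
    rw [ModTensor.fac, CategoryTheory.Functor.map_comp, CategoryTheory.Functor.map_comp,
      CategoryTheory.Functor.map_comp, ← Category.assoc (u M), ModTensor.fac, Category.assoc,
      Category.assoc, ModTensor.fac])

lemma liftFunctor_fac (h : ∀ M, IsExt φ (mapAct F TR M) (TS.act (E M)) (u M))
    {M N : TR.toSymMonCat.carrier} (f : M ⟶ N) :
    F.functor.map (TR.forget.map f) ≫ u N = u M ≫ TS.forget.map ((liftFunctor h).map f) :=
  (TS.fac (h M) _ (semilinear_map_unit h f)).symm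

/-- The composite `F M ⊗ F N ⟶ E M ⊗ E N ⟶ E M ⊗_S E N` is universal. -/
lemma isExt_unit_tensor_unit (h : ∀ M, IsExt φ (mapAct F TR M) (TS.act (E M)) (u M))
    (M N : TR.toSymMonCat.carrier) :
    IsExt ((φ ⊗ₘ φ) ≫ μ[S]) (tensorAct (mapAct F TR M) (mapAct F TR N)) (TS.act (E M ⊗ E N))
      ((u M ⊗ₘ u N) ≫ TS.π _ _) :=
  ((h M).tensor (h N)).comp (TS.isExt_π (E M) (E N))

variable [ReflexiveTensor A.carrier] [PreservesColimitsOfShape WalkingReflexivePair F.functor]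
  [IsMonHom φ]

/-- The composite `F M ⊗ F N ⟶ F (M ⊗_R N) ⟶ E (M ⊗_R N)` is universal, for the same action as
`F M ⊗ F N ⟶ E M ⊗_S E N`. -/
lemma isExt_μ_unit (h : ∀ M, IsExt φ (mapAct F TR M) (TS.act (E M)) (u M))
    (M N : TR.toSymMonCat.carrier) :
    IsExt ((φ ⊗ₘ φ) ≫ μ[S]) (tensorAct (mapAct F TR M) (mapAct F TR N)) (TS.act (E (M ⊗ N)))
      (Functor.LaxMonoidal.μ F.functor (TR.forget.obj M) (TR.forget.obj N) ≫
        F.functor.map (TR.π M N) ≫ u (M ⊗ N)) := by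
  have h1 := (((TR.isExt_π M N).map F.functor).comp (h (M ⊗ N))).precomp_iso
    (a' := tensorAct (mapAct F TR M) (mapAct F TR N))
    (Functor.Monoidal.μIso F.functor R R) (Functor.Monoidal.μIso F.functor _ _) ?_
  · have h2 : (φ ⊗ₘ φ) ≫ μ[S] = (Functor.Monoidal.μIso F.functor R R).hom ≫
        F.functor.map μ[R] ≫ φ := by
      rw [← IsMonHom.mul_hom, Functor.obj.μ_def, Category.assoc]; rfl
    rw [h2]
    exact h1
  · change tensorAct _ _ ≫ Functor.LaxMonoidal.μ F.functor _ _ =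
      (Functor.LaxMonoidal.μ F.functor R R ⊗ₘ Functor.LaxMonoidal.μ F.functor _ _) ≫
        Functor.LaxMonoidal.μ F.functor _ _ ≫ F.functor.map (tensorAct (TR.act M) (TR.act N))
    rw [tensorAct, tensorAct, mapAct, mapAct, ← tensorHom_comp_tensorHom, Category.assoc,
      Category.assoc, Functor.LaxMonoidal.μ_natural, F.functor.map_comp,
      tensorμ_comp_μ_tensorHom_μ_comp_μ_assoc]

omit [ReflexiveTensor A.carrier] in
/-- Both sides of the unit constraint are extensions of scalars of `𝟙`. -/
lemma isExt_ε_unit (h : ∀ M, IsExt φ (mapAct F TR M) (TS.act (E M)) (u M))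
    :
    IsExt η[S] (λ_ (𝟙_ B.carrier)).hom (TS.act (E (𝟙_ _)))
      (Functor.LaxMonoidal.ε F.functor ≫ F.functor.map (Functor.LaxMonoidal.ε TR.forget) ≫
        u (𝟙_ _)) := by
  have h1 := (((TR.isExt_ε).map F.functor).comp (h (𝟙_ _))).precomp_iso
    (a' := (λ_ (𝟙_ B.carrier)).hom)
    (Functor.Monoidal.εIso F.functor) (Functor.Monoidal.εIso F.functor) ?_
  · have h2 : η[S] = (Functor.Monoidal.εIso F.functor).hom ≫ F.functor.map η[R] ≫ φ := by
      rw [← IsMonHom.one_hom φ, Functor.obj.η_def, Category.assoc]; rfl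
    rw [h2]
    exact h1
  · change (λ_ (𝟙_ B.carrier)).hom ≫ Functor.LaxMonoidal.ε F.functor =
      (Functor.LaxMonoidal.ε F.functor ⊗ₘ Functor.LaxMonoidal.ε F.functor) ≫
        Functor.LaxMonoidal.μ F.functor _ _ ≫ F.functor.map (λ_ (𝟙_ A.carrier)).hom
    rw [MonoidalCategory.tensorHom_def', Category.assoc, ← Functor.LaxMonoidal.left_unitality,
      leftUnitor_naturality]

/-- The strong monoidal structure on the functor given by a choice of extensions of scalars. -/
@[reducible]
noncomputable def liftMonoidal (h : ∀ M, IsExt φ (mapAct F TR M) (TS.act (E M)) (u M)) :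
    (liftFunctor h).Monoidal :=
  Functor.CoreMonoidal.toMonoidal
    (coreMonoidalOfUniversal (TR.forget ⋙ F.functor) TS.forget (liftFunctor h) u
      (fun f => liftFunctor_fac h f)
      (TS.extIso TS.isExt_ε (isExt_ε_unit h))
      (fun M N => TS.extIso (isExt_unit_tensor_unit h M N) (isExt_μ_unit h M N))
      ((TS.fac_extIso TS.isExt_ε (isExt_ε_unit h)).trans (Category.assoc _ _ _).symm)
      (fun M N => (Category.assoc _ _ _).symm.trans
        ((TS.fac_extIso (isExt_unit_tensor_unit h M N) (isExt_μ_unit h M N)).trans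
          (Category.assoc _ _ _).symm))
      (fun M N Q k k' e => ModTensor.hom_ext_of_isExt (isExt_unit_tensor_unit h M N)
        ((Category.assoc _ _ _).trans (e.trans (Category.assoc _ _ _).symm)))
      (fun M N P Q k k' e => by
        exact ModTensor.hom_ext_of_isExt
          (((isExt_unit_tensor_unit h M N).tensor (h P)).comp (TS.isExt_π (E M ⊗ E N) (E P)))
            ((Category.assoc _ _ _).trans (e.trans (Category.assoc _ _ _).symm)))
      (fun M Q k k' e => by
        exact ModTensor.hom_ext_of_isExt ((TS.isExt_ε.tensor (h M)).comp (TS.isExt_π _ (E M)))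
            ((Category.assoc _ _ _).trans (e.trans (Category.assoc _ _ _).symm)))
      (fun M Q k k' e => by
        exact ModTensor.hom_ext_of_isExt (((h M).tensor TS.isExt_ε).comp (TS.isExt_π (E M) _))
            ((Category.assoc _ _ _).trans (e.trans (Category.assoc _ _ _).symm))))

lemma unit_tensor_unit_μ (h : ∀ M, IsExt φ (mapAct F TR M) (TS.act (E M)) (u M))
    (M N : TR.toSymMonCat.carrier) :
    letI := liftMonoidal h
    (u M ⊗ₘ u N) ≫ TS.π (E M) (E N) ≫
      TS.forget.map (Functor.LaxMonoidal.μ (liftFunctor h) M N) =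
    Functor.LaxMonoidal.μ F.functor (TR.forget.obj M) (TR.forget.obj N) ≫
        F.functor.map (TR.π M N) ≫ u (M ⊗ N) := by
  rw [← Category.assoc]
  exact TS.fac_extIso (isExt_unit_tensor_unit h M N) (isExt_μ_unit h M N)

lemma unit_ε (h : ∀ M, IsExt φ (mapAct F TR M) (TS.act (E M)) (u M)) :
    letI := liftMonoidal h
    Functor.LaxMonoidal.ε TS.forget ≫ TS.forget.map (Functor.LaxMonoidal.ε (liftFunctor h)) =
    Functor.LaxMonoidal.ε F.functor ≫ F.functor.map (Functor.LaxMonoidal.ε TR.forget) ≫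
        u (𝟙_ _) :=
  TS.fac_extIso TS.isExt_ε (isExt_ε_unit h)

/-- The symmetric structure on the functor given by a choice of extensions of scalars. -/
@[reducible]
noncomputable def liftBraided (h : ∀ M, IsExt φ (mapAct F TR M) (TS.act (E M)) (u M)) :
    (liftFunctor h).Braided :=
  { liftMonoidal h with
    braided := fun M N => by
      let := liftMonoidal h
      exact braided_of_universal (TR.forget ⋙ F.functor) TS.forget (liftFunctor h) u
        (fun f => liftFunctor_fac h f)
        (fun M N => (unit_tensor_unit_μ h M N).trans (Category.assoc _ _ _).symm)
        (fun M N Q k k' e => ModTensor.hom_ext_of_isExt (isExt_unit_tensor_unit h M N)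
          ((Category.assoc _ _ _).trans (e.trans (Category.assoc _ _ _).symm))) M N }

/-- The strong symmetric monoidal functor given by a choice of extensions of scalars. -/
noncomputable def liftHom (h : ∀ M, IsExt φ (mapAct F TR M) (TS.act (E M)) (u M)) :
    TR.toSymMonCat ⟶ TS.toSymMonCat :=
  letI := liftBraided h
  SymMonCat.Hom.mk (liftFunctor h)

/-- The lift given by a choice of extensions of scalars. -/
noncomputable def liftHomUnit (h : ∀ M, IsExt φ (mapAct F TR M) (TS.act (E M)) (u M)) :
    ModLift F φ TR TS (liftHom h) where
  unit := { app := u, naturality := fun _ _ f => liftFunctor_fac h f }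
  monoidal :=
    { unit := (Category.assoc _ _ _).trans (unit_ε h).symm
      tensor := fun M N => (Category.assoc _ _ _).trans (unit_tensor_unit_μ h M N).symm }
  linear M := (h M).lin

lemma isUniv_liftHomUnit (h : ∀ M, IsExt φ (mapAct F TR M) (TS.act (E M)) (u M)) :
    (liftHomUnit h).IsUniv := h

end

end Existence

variable (F φ TR TS) in
/-- A strong symmetric monoidal functor preserving reflexive coequalizers extends to modules by
relative extension of scalars. -/
theorem exists_lift_isUniv [ReflexiveTensor A.carrier] [ReflexiveTensor B.carrier]
    [PreservesColimitsOfShape WalkingReflexivePair F.functor] [IsMonHom φ] :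
    ∃ (F' : TR.toSymMonCat ⟶ TS.toSymMonCat) (l : ModLift F φ TR TS F'), l.IsUniv := by
  choose E u h using exists_isExt_mapAct (φ := φ) TR TS
  exact ⟨liftHom h, liftHomUnit h, isUniv_liftHomUnit h⟩


end Lifts

/-! ### Transformations between lifts -/

section Cells

attribute [local instance] ModCat.isMonHom_mul

variable {A B : SymMonCat.{v, u}} {R : A.carrier} [MonObj R] [IsCommMonObj R] {S : B.carrier}
  [MonObj S] [IsCommMonObj S] {F F₂ : A ⟶ B} {φ : F.functor.obj R ⟶ S} {φ₂ : F₂.functor.obj R ⟶ S}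
  {TR : ModTensor R} {TS : ModTensor S} {F' F₂' : TR.toSymMonCat ⟶ TS.toSymMonCat}

namespace ModLift

/-- Transformations out of a universal lift are determined by their composites with the unit. -/
lemma cell_ext {l : ModLift F φ TR TS F'} (hl : l.IsUniv) {a b : F' ⟶ F₂'}
    (h : ∀ M, l.app M ≫ TS.forget.map (a.nat.app M) =
      l.app M ≫ TS.forget.map (b.nat.app M)) : a = b := by
  apply SymMonCat.hom₂_ext
  ext M
  exact ModTensor.hom_ext_of_isExt (hl M) (h M)

lemma cell_lin {l₂ : ModLift F₂ φ₂ TR TS F₂'} {α : F ⟶ F₂} (hα : α.nat.app R ≫ φ₂ = φ)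
    (M : TR.toSymMonCat.carrier) :
    mapAct F TR M ≫ α.nat.app (TR.forget.obj M) ≫ l₂.app M =
      (φ ⊗ₘ α.nat.app (TR.forget.obj M) ≫ l₂.app M) ≫ TS.act (F₂'.functor.obj M) := by
  have h1 := mapAct_naturality α TR M
  rw [reassoc_of% h1, l₂.lin, ← hα, ← tensorHom_comp_tensorHom, Category.assoc]

variable [ReflexiveTensor B.carrier] {l : ModLift F φ TR TS F'} (hl : l.IsUniv)
  (l₂ : ModLift F₂ φ₂ TR TS F₂') (α : F ⟶ F₂) (hα : α.nat.app R ≫ φ₂ = φ)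

/-- The components of the transformation of lifts induced by a transformation. -/
noncomputable def cellApp (M : TR.toSymMonCat.carrier) : F'.functor.obj M ⟶ F₂'.functor.obj M :=
  TS.lift (hl M) (α.nat.app (TR.forget.obj M) ≫ l₂.app M) (cell_lin hα M)

lemma cellApp_fac (M : TR.toSymMonCat.carrier) :
    l.app M ≫ TS.forget.map (cellApp hl l₂ α hα M) =
      α.nat.app (TR.forget.obj M) ≫ l₂.app M :=
  TS.fac (hl M) _ _

lemma cellApp_nat {M N : TR.toSymMonCat.carrier} (f : M ⟶ N) :
    F'.functor.map f ≫ cellApp hl l₂ α hα N = cellApp hl l₂ α hα M ≫ F₂'.functor.map f :=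
  ModTensor.hom_ext_of_isExt (hl M) (by
    have h1 := l.nat f
    have h2 := cellApp_fac hl l₂ α hα M
    have h3 := cellApp_fac hl l₂ α hα N
    rw [TS.forget.map_comp, TS.forget.map_comp, reassoc_of% h2, ← reassoc_of% h1, h3, ← l₂.nat,
      NatTrans.naturality_assoc])

lemma cellApp_unit :
    Functor.LaxMonoidal.ε F'.functor ≫ cellApp hl l₂ α hα (𝟙_ _) =
      Functor.LaxMonoidal.ε F₂'.functor :=
  ModTensor.hom_ext_of_isExt TS.isExt_ε (by
    have h1 := l.unit_ε
    have h2 := cellApp_fac hl l₂ α hα (𝟙_ _)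
    rw [TS.forget.map_comp, ← reassoc_of% h1, h2, ← l₂.unit_ε, Category.assoc,
      NatTrans.naturality_assoc, NatTrans.IsMonoidal.unit_assoc])

lemma cellApp_tensor (M N : TR.toSymMonCat.carrier) :
    Functor.LaxMonoidal.μ F'.functor M N ≫ cellApp hl l₂ α hα (M ⊗ N) =
      (cellApp hl l₂ α hα M ⊗ₘ cellApp hl l₂ α hα N) ≫ Functor.LaxMonoidal.μ F₂'.functor M N :=
  ModTensor.hom_ext_of_isExt (((hl M).tensor (hl N)).comp (TS.isExt_π _ _)) (by
    have h1 := l.unit_μ M N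
    have h2 := cellApp_fac hl l₂ α hα (M ⊗ N)
    have h3 : TS.π _ _ ≫ TS.forget.map (cellApp hl l₂ α hα M ⊗ₘ cellApp hl l₂ α hα N) = _ :=
      (Functor.LaxMonoidal.μ_natural (F := TS.forget) _ _).symm
    rw [TS.forget.map_comp, TS.forget.map_comp, Category.assoc, Category.assoc, ← reassoc_of% h1,
      reassoc_of% h3, tensorHom_comp_tensorHom_assoc, cellApp_fac hl l₂ α hα M,
      cellApp_fac hl l₂ α hα N, ← tensorHom_comp_tensorHom_assoc, ← l₂.unit_μ, h2,
      NatTrans.naturality_assoc, NatTrans.IsMonoidal.tensor_assoc, Category.assoc])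

/-- The monoidal transformation of lifts induced by a monoidal transformation. -/
noncomputable def cell : F' ⟶ F₂' :=
  letI nat : F'.functor ⟶ F₂'.functor :=
    { app := cellApp hl l₂ α hα
      naturality := fun _ _ f => cellApp_nat hl l₂ α hα f }
  haveI : NatTrans.IsMonoidal nat := ⟨cellApp_unit hl l₂ α hα, cellApp_tensor hl l₂ α hα⟩
  SymMonCat.Hom₂.mk nat

lemma cell_fac (M : TR.toSymMonCat.carrier) :
    l.app M ≫ TS.forget.map ((cell hl l₂ α hα).nat.app M) =
      α.nat.app (TR.forget.obj M) ≫ l₂.app M :=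
  cellApp_fac hl l₂ α hα M

variable {l₂} (hl₂ : l₂.IsUniv)

/-- The isomorphism of universal lifts induced by an isomorphism. -/
noncomputable def cellIso (α : F ≅ F₂) (hα : α.hom.nat.app R ≫ φ₂ = φ) : F' ≅ F₂' where
  hom := cell hl l₂ α.hom hα
  inv := cell hl₂ l α.inv (by
    rw [← hα, ← Category.assoc, ← NatTrans.comp_app, ← SymMonCat.comp_nat, Iso.inv_hom_id]
    exact Category.id_comp _)
  hom_inv_id := cell_ext hl fun M => by
    rw [SymMonCat.comp_nat, NatTrans.comp_app, TS.forget.map_comp, ← Category.assoc, cell_fac,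
      Category.assoc, cell_fac, ← Category.assoc, ← NatTrans.comp_app, ← SymMonCat.comp_nat,
      Iso.hom_inv_id]
    exact (Category.id_comp _).trans ((Category.comp_id _).symm.trans
      (congrArg (l.app M ≫ ·) (TS.forget.map_id _).symm))
  inv_hom_id := cell_ext hl₂ fun M => by
    rw [SymMonCat.comp_nat, NatTrans.comp_app, TS.forget.map_comp, ← Category.assoc, cell_fac,
      Category.assoc, cell_fac, ← Category.assoc, ← NatTrans.comp_app, ← SymMonCat.comp_nat,
      Iso.inv_hom_id]
    exact (Category.id_comp _).trans ((Category.comp_id _).symm.trans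
      (congrArg (l₂.app M ≫ ·) (TS.forget.map_id _).symm))

lemma cellIso_fac (α : F ≅ F₂) (hα : α.hom.nat.app R ≫ φ₂ = φ) (M : TR.toSymMonCat.carrier) :
    l.app M ≫ TS.forget.map ((cellIso hl hl₂ α hα).hom.nat.app M) =
      α.hom.nat.app (TR.forget.obj M) ≫ l₂.app M :=
  cellApp_fac hl l₂ α.hom hα M

end ModLift

end Cells

/-! ### Identities, composites and tensor products of lifts -/

namespace ModLift

attribute [local instance] ModCat.isMonHom_mul

section Id

variable {A : SymMonCat.{v, u}} {R : A.carrier} [MonObj R] [IsCommMonObj R] (T : ModTensor R)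

/-- The identity lift. -/
def id : ModLift (𝟙 A) (𝟙 R) T T (𝟙 T.toSymMonCat) where
  unit := { app := fun M => 𝟙 (T.forget.obj M)
            naturality := fun _ _ _ => (Category.comp_id _).trans (Category.id_comp _).symm }
  monoidal :=
    { unit := by
        change (𝟙 _ ≫ Functor.LaxMonoidal.ε T.forget) ≫ 𝟙 _ =
          Functor.LaxMonoidal.ε T.forget ≫ T.forget.map (𝟙 (𝟙_ T.toSymMonCat.carrier))
        rw [T.forget.map_id, Category.id_comp]
      tensor := fun M N => by
        change (𝟙 _ ≫ T.π M N) ≫ 𝟙 _ =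
          (𝟙 (T.forget.obj M) ⊗ₘ 𝟙 (T.forget.obj N)) ≫ T.π M N ≫ T.forget.map (𝟙 (M ⊗ N))
        rw [T.forget.map_id, id_tensorHom_id]
        exact Category.assoc _ _ _ }
  linear M := by
    change (𝟙 _ ≫ T.act M) ≫ 𝟙 _ = (𝟙 R ⊗ₘ 𝟙 (T.forget.obj M)) ≫ T.act M
    rw [id_tensorHom_id, Category.comp_id]

lemma isUniv_id [ReflexiveTensor A.carrier] : (id T).IsUniv := fun M => by
  have h : mapAct (𝟙 A) T M = T.act M := Category.id_comp _
  rw [h]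
  exact IsExt.id (D := A.carrier) (S := R) (T.isAct_act M)

end Id

section Comp

variable {A B D : SymMonCat.{v, u}} {R : A.carrier} [MonObj R] [IsCommMonObj R] {S : B.carrier}
  [MonObj S] [IsCommMonObj S] {U : D.carrier} [MonObj U] [IsCommMonObj U]
  {F : A ⟶ B} {φ : F.functor.obj R ⟶ S} {F₂ : B ⟶ D} {ψ : F₂.functor.obj S ⟶ U}
  {TR : ModTensor R} {TS : ModTensor S} {TU : ModTensor U}
  {F' : TR.toSymMonCat ⟶ TS.toSymMonCat} {F₂' : TS.toSymMonCat ⟶ TU.toSymMonCat}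

lemma mapAct_comp (F : A ⟶ B) (F₂ : B ⟶ D) (TR : ModTensor R) (M : TR.toSymMonCat.carrier) :
    mapAct (F ≫ F₂) TR M =
      Functor.LaxMonoidal.μ F₂.functor _ _ ≫ F₂.functor.map (mapAct F TR M) := by
  rw [mapAct, mapAct, F₂.functor.map_comp]
  exact Category.assoc _ _ _

/-- The composite of two lifts. -/
def comp (l : ModLift F φ TR TS F') (m : ModLift F₂ ψ TS TU F₂') :
    ModLift (F ≫ F₂) (F₂.functor.map φ ≫ ψ) TR TU (F' ≫ F₂') where
  unit :=
    { app := fun M => F₂.functor.map (l.app M) ≫ m.app (F'.functor.obj M)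
      naturality := fun M N f => by
        change F₂.functor.map (F.functor.map (TR.forget.map f)) ≫
          F₂.functor.map (l.app N) ≫ m.app (F'.functor.obj N) =
          (F₂.functor.map (l.app M) ≫ m.app (F'.functor.obj M)) ≫
            TU.forget.map (F₂'.functor.map (F'.functor.map f))
        rw [← F₂.functor.map_comp_assoc, l.nat, F₂.functor.map_comp_assoc, m.nat, Category.assoc] }
  monoidal :=
    { unit := by
        change ((Functor.LaxMonoidal.ε F₂.functor ≫ F₂.functor.map (Functor.LaxMonoidal.ε
          F.functor)) ≫
          F₂.functor.map (F.functor.map (Functor.LaxMonoidal.ε TR.forget))) ≫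
            F₂.functor.map (l.app _) ≫ m.app _ =
          Functor.LaxMonoidal.ε TU.forget ≫ TU.forget.map (Functor.LaxMonoidal.ε F₂'.functor ≫
            F₂'.functor.map (Functor.LaxMonoidal.ε F'.functor))
        have h1 := l.unit_ε
        have h2 := m.unit_ε
        have h3 := m.nat (Functor.LaxMonoidal.ε F'.functor)
        rw [Category.assoc, Category.assoc, ← F₂.functor.map_comp_assoc,
          ← F₂.functor.map_comp_assoc, h1,
          F₂.functor.map_comp_assoc, h3, TU.forget.map_comp, ← reassoc_of% h2]
      tensor := fun M N => by
        change ((Functor.LaxMonoidal.μ F₂.functor _ _ ≫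
          F₂.functor.map (Functor.LaxMonoidal.μ F.functor _ _)) ≫
          F₂.functor.map (F.functor.map (TR.π M N))) ≫
            F₂.functor.map (l.app _) ≫ m.app _ =
          ((F₂.functor.map (l.app M) ≫ m.app (F'.functor.obj M)) ⊗ₘ
            (F₂.functor.map (l.app N) ≫ m.app (F'.functor.obj N))) ≫
          TU.π _ _ ≫ TU.forget.map (Functor.LaxMonoidal.μ F₂'.functor _ _ ≫
            F₂'.functor.map (Functor.LaxMonoidal.μ F'.functor M N))
        have h1 := l.unit_μ M N
        have h2 := m.unit_μ (F'.functor.obj M) (F'.functor.obj N)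
        have h3 := m.nat (Functor.LaxMonoidal.μ F'.functor M N)
        rw [Category.assoc, Category.assoc, ← F₂.functor.map_comp_assoc,
          ← F₂.functor.map_comp_assoc, h1,
          F₂.functor.map_comp, F₂.functor.map_comp, Category.assoc, Category.assoc, h3,
          TU.forget.map_comp, ← tensorHom_comp_tensorHom_assoc, ← reassoc_of% h2,
          Functor.LaxMonoidal.μ_natural_assoc] }
  linear M := by
    refine (congrArg (· ≫ F₂.functor.map (l.app M) ≫ m.app (F'.functor.obj M))
      (mapAct_comp F F₂ TR M)).trans ?_
    have h1 := l.lin M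
    have h2 := m.lin (F'.functor.obj M)
    change (Functor.LaxMonoidal.μ F₂.functor _ _ ≫ F₂.functor.map (mapAct F TR M)) ≫
        F₂.functor.map (l.app M) ≫ m.app (F'.functor.obj M) =
      ((F₂.functor.map φ ≫ ψ) ⊗ₘ
        (F₂.functor.map (l.app M) ≫ m.app (F'.functor.obj M))) ≫ TU.act _
    rw [Category.assoc, ← F₂.functor.map_comp_assoc, h1, F₂.functor.map_comp_assoc,
      ← tensorHom_comp_tensorHom_assoc]
    refine Eq.trans ?_ (congrArg (_ ≫ ·) h2)
    rw [mapAct, Category.assoc, Functor.LaxMonoidal.μ_natural_assoc]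

lemma IsUniv.comp [ReflexiveTensor D.carrier] {l : ModLift F φ TR TS F'} {m : ModLift F₂ ψ TS TU
    F₂'} (hl : l.IsUniv)
    (hm : m.IsUniv) [PreservesColimitsOfShape WalkingReflexivePair F₂.functor]
    [IsMonHom ψ] : (l.comp m).IsUniv := fun M => by
  have := ((hl M).map F₂.functor).comp (hm (F'.functor.obj M))
  rw [mapAct_comp]
  exact this

end Comp

section Tensor

variable {A B : SymMonCat.{v, u}} {R : A.carrier} [MonObj R] [IsCommMonObj R] {S : B.carrier}
  [MonObj S] [IsCommMonObj S] {F F₂ : A ⟶ B} {φ : F.functor.obj R ⟶ S} {φ₂ : F₂.functor.obj R ⟶ S}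
  {TR : ModTensor R} {TS : ModTensor S} {F' F₂' : TR.toSymMonCat ⟶ TS.toSymMonCat}

omit [MonObj R] [IsCommMonObj R] [MonObj S] [IsCommMonObj S] in
lemma tensorHom_ε (F F₂ : A ⟶ B) :
    Functor.LaxMonoidal.ε (SymMonCat.tensorHom F F₂).functor =
      (λ_ (𝟙_ B.carrier)).inv ≫
        (Functor.LaxMonoidal.ε F.functor ⊗ₘ Functor.LaxMonoidal.ε F₂.functor) := by
  change Functor.LaxMonoidal.ε (Functor.prod' F.functor F₂.functor ⋙ tensor B.carrier) = _
  rw [Functor.LaxMonoidal.comp_ε, tensor_ε, tensor_map, Functor.prod'_ε_fst, Functor.prod'_ε_snd]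

lemma mapAct_tensorHom (F F₂ : A ⟶ B) (TR : ModTensor R) (M : TR.toSymMonCat.carrier) :
    mapAct (SymMonCat.tensorHom F F₂) TR M = tensorAct (mapAct F TR M) (mapAct F₂ TR M) := by
  rw [mapAct]
  have h : Functor.LaxMonoidal.μ (SymMonCat.tensorHom F F₂).functor R (TR.forget.obj M) = _ :=
    SymMonCat.tensorFunctor_μ F F₂ R (TR.forget.obj M)
  rw [h, tensorAct, mapAct, mapAct, ← tensorHom_comp_tensorHom]
  exact Category.assoc _ _ _

/-- The tensor product of two lifts. -/
def tensor [ReflexiveTensor B.carrier] (l : ModLift F φ TR TS F') (m : ModLift F₂ φ₂ TR TS F₂') :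
    ModLift (SymMonCat.tensorHom F F₂) ((φ ⊗ₘ φ₂) ≫ μ[S]) TR TS (SymMonCat.tensorHom F' F₂') where
  unit :=
    { app := fun M => (l.app M ⊗ₘ m.app M) ≫ TS.π _ _
      naturality := fun M N f => by
        have h := Functor.LaxMonoidal.μ_natural TS.forget (F'.functor.map f) (F₂'.functor.map f)
        change (F.functor.map (TR.forget.map f) ⊗ₘ F₂.functor.map (TR.forget.map f)) ≫
          (l.app N ⊗ₘ m.app N) ≫ TS.π _ _ = ((l.app M ⊗ₘ m.app M) ≫ TS.π _ _) ≫
            TS.forget.map (F'.functor.map f ⊗ₘ F₂'.functor.map f)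
        rw [tensorHom_comp_tensorHom_assoc, l.nat, m.nat, ← tensorHom_comp_tensorHom_assoc,
          Category.assoc]
        exact congrArg (_ ≫ ·) h }
  monoidal :=
    { unit := by
        have h1 := l.unit_ε
        have h2 := m.unit_ε
        have h3 := Functor.LaxMonoidal.left_unitality_inv TS.forget (𝟙_ TS.toSymMonCat.carrier)
        have h4 := Functor.LaxMonoidal.μ_natural TS.forget
          (Functor.LaxMonoidal.ε F'.functor) (Functor.LaxMonoidal.ε F₂'.functor)
        have key : (((λ_ _).inv ≫
            (Functor.LaxMonoidal.ε F.functor ⊗ₘ Functor.LaxMonoidal.ε F₂.functor)) ≫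
          (F.functor.map (Functor.LaxMonoidal.ε TR.forget) ⊗ₘ
            F₂.functor.map (Functor.LaxMonoidal.ε TR.forget))) ≫
            (l.app _ ⊗ₘ m.app _) ≫ TS.π _ _ =
          Functor.LaxMonoidal.ε TS.forget ≫ TS.forget.map ((λ_ _).inv ≫
            (Functor.LaxMonoidal.ε F'.functor ⊗ₘ Functor.LaxMonoidal.ε F₂'.functor)) := by
          rw [Category.assoc, Category.assoc, tensorHom_comp_tensorHom_assoc,
            tensorHom_comp_tensorHom_assoc, h1, h2,
            ← tensorHom_comp_tensorHom_assoc, h4, TS.forget.map_comp, ← h3,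
            MonoidalCategory.tensorHom_def', Category.assoc, Category.assoc, Category.assoc,
            leftUnitor_inv_naturality_assoc]
        exact (congrArg (fun e => (e ≫ (F.functor.map (Functor.LaxMonoidal.ε TR.forget) ⊗ₘ
            F₂.functor.map (Functor.LaxMonoidal.ε TR.forget))) ≫
            (l.app _ ⊗ₘ m.app _) ≫ TS.π _ _) (tensorHom_ε F F₂)).trans (key.trans
              (congrArg (fun e => Functor.LaxMonoidal.ε TS.forget ≫ TS.forget.map e)
                (tensorHom_ε F' F₂').symm))
      tensor := fun M N => by
        have h1 := l.unit_μ M N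
        have h2 := m.unit_μ M N
        have h3 := tensorμ_comp_μ_tensorHom_μ_comp_μ TS.forget (F'.functor.obj M)
          (F₂'.functor.obj M) (F'.functor.obj N) (F₂'.functor.obj N)
        have h4 := Functor.LaxMonoidal.μ_natural TS.forget
          (Functor.LaxMonoidal.μ F'.functor M N) (Functor.LaxMonoidal.μ F₂'.functor M N)
        have key : ((tensorμ _ _ _ _ ≫ (Functor.LaxMonoidal.μ F.functor _ _ ⊗ₘ
            Functor.LaxMonoidal.μ F₂.functor _ _)) ≫
          (F.functor.map (TR.π M N) ⊗ₘ F₂.functor.map (TR.π M N))) ≫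
            (l.app _ ⊗ₘ m.app _) ≫ TS.π _ _ =
          (((l.app M ⊗ₘ m.app M) ≫ TS.π _ _) ⊗ₘ ((l.app N ⊗ₘ m.app N) ≫ TS.π _ _)) ≫
            TS.π _ _ ≫ TS.forget.map (tensorμ _ _ _ _ ≫
            (Functor.LaxMonoidal.μ F'.functor M N ⊗ₘ Functor.LaxMonoidal.μ F₂'.functor M N)) := by
          rw [Category.assoc, Category.assoc, tensorHom_comp_tensorHom_assoc,
            tensorHom_comp_tensorHom_assoc,
            h1, h2,
            ← tensorHom_comp_tensorHom_assoc, ← tensorHom_comp_tensorHom_assoc, h4,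
            ← tensorμ_natural_assoc, TS.forget.map_comp, ← tensorHom_comp_tensorHom_assoc,
            reassoc_of% h3]
        exact (congrArg (fun e => (e ≫ (F.functor.map (TR.π M N) ⊗ₘ F₂.functor.map (TR.π M N))) ≫
            (l.app _ ⊗ₘ m.app _) ≫ TS.π _ _) (SymMonCat.tensorFunctor_μ F F₂ _ _)).trans
              (key.trans (congrArg (fun e => (((l.app M ⊗ₘ m.app M) ≫ TS.π _ _) ⊗ₘ
                ((l.app N ⊗ₘ m.app N) ≫ TS.π _ _)) ≫ TS.π _ _ ≫ TS.forget.map e)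
                (SymMonCat.tensorFunctor_μ F' F₂' M N).symm)) }
  linear M := by
    have h1 := (TS.isExt_π (F'.functor.obj M) (F₂'.functor.obj M)).lin
    have key : tensorAct (mapAct F TR M) (mapAct F₂ TR M) ≫ (l.app M ⊗ₘ m.app M) ≫ TS.π _ _ =
        (((φ ⊗ₘ φ₂) ≫ μ[S]) ⊗ₘ ((l.app M ⊗ₘ m.app M) ≫ TS.π _ _)) ≫ TS.act _ := by
      rw [tensorAct, Category.assoc, tensorHom_comp_tensorHom_assoc, l.lin, m.lin,
        ← tensorHom_comp_tensorHom_assoc, ← tensorμ_natural_assoc, ← tensorHom_comp_tensorHom_assoc,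
        ← h1, tensorAct, Category.assoc]
    exact (congrArg (· ≫ (l.app M ⊗ₘ m.app M) ≫ TS.π _ _) (mapAct_tensorHom F F₂ TR M)).trans key

lemma IsUniv.tensor [ReflexiveTensor B.carrier] {l : ModLift F φ TR TS F'}
    {m : ModLift F₂ φ₂ TR TS F₂'} (hl : l.IsUniv) (hm : m.IsUniv) : (l.tensor m).IsUniv :=
  fun M => by
    have := ((hl M).tensor (hm M)).comp (TS.isExt_π (F'.functor.obj M) (F₂'.functor.obj M))
    rw [mapAct_tensorHom]
    exact this

variable (TR TS)

lemma mapAct_unitHom (TR : ModTensor R) (M : TR.toSymMonCat.carrier) :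
    mapAct (SymMonCat.unitHom A B) TR M = (λ_ (𝟙_ B.carrier)).hom :=
  Category.comp_id _

/-- The lift of the constant functor at the unit. -/
def unitLift : ModLift (SymMonCat.unitHom A B) η[S] TR TS (SymMonCat.unitHom _ _) where
  unit :=
    { app := fun M => Functor.LaxMonoidal.ε TS.forget
      naturality := fun M N f => by
        exact (Category.id_comp _).trans ((Category.comp_id _).symm.trans
          (congrArg (Functor.LaxMonoidal.ε TS.forget ≫ ·) (TS.forget.map_id _).symm)) }
  monoidal :=
    { unit := by
        change (𝟙 _ ≫ 𝟙 _) ≫ Functor.LaxMonoidal.ε TS.forget =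
          Functor.LaxMonoidal.ε TS.forget ≫ TS.forget.map (𝟙 _)
        rw [TS.forget.map_id, Category.comp_id, Category.comp_id, Category.id_comp]
      tensor := fun M N => by
        change ((λ_ _).hom ≫ 𝟙 _) ≫ Functor.LaxMonoidal.ε TS.forget =
          (Functor.LaxMonoidal.ε TS.forget ⊗ₘ Functor.LaxMonoidal.ε TS.forget) ≫ TS.π _ _ ≫
            TS.forget.map (λ_ (𝟙_ TS.toSymMonCat.carrier)).hom
        rw [Category.comp_id, MonoidalCategory.tensorHom_def', Category.assoc,
          ← Functor.LaxMonoidal.left_unitality, leftUnitor_naturality] }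
  linear M := by
    have h := TS.isExt_ε.lin
    rw [← mapAct_unitHom (A := A) (B := B) TR M] at h
    exact h

lemma isUniv_unitLift : (unitLift TR TS).IsUniv := fun M => by
  rw [mapAct_unitHom]
  exact TS.isExt_ε

end Tensor

end ModLift

/-! ### Pseudofunctors of modules -/

section Pseudofunctor

open scoped Bicategory

variable {I : Type*} [Category* I] {obj : I → SymMonCat.{v, u}}

namespace PseudoOn

variable (P : PseudoOn obj)

/-- The component of the unit comparison at an object. -/
def idApp (X : I) (M : (obj X).carrier) : (P.map (𝟙 X)).functor.obj M ⟶ M :=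
  (P.mapId X).hom.nat.app M

/-- The component of a composition comparison at an object. -/
def compApp {X Y Z : I} (f : X ⟶ Y) (g : Y ⟶ Z) (fg : X ⟶ Z) (h : f ≫ g = fg)
    (M : (obj X).carrier) :
    (P.map fg).functor.obj M ⟶ (P.map g).functor.obj ((P.map f).functor.obj M) :=
  (P.mapComp f g fg h).hom.nat.app M

lemma idApp_naturality (X : I) {M N : (obj X).carrier} (k : M ⟶ N) :
    (P.map (𝟙 X)).functor.map k ≫ P.idApp X N = P.idApp X M ≫ k :=
  (P.mapId X).hom.nat.naturality k

lemma compApp_naturality {X Y Z : I} (f : X ⟶ Y) (g : Y ⟶ Z) (fg : X ⟶ Z) (h : f ≫ g = fg)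
    {M N : (obj X).carrier} (k : M ⟶ N) :
    (P.map fg).functor.map k ≫ P.compApp f g fg h N =
      P.compApp f g fg h M ≫ (P.map g).functor.map ((P.map f).functor.map k) :=
  (P.mapComp f g fg h).hom.nat.naturality k

lemma assoc_app {W X Y Z : I} (f : W ⟶ X) (g : X ⟶ Y) (k : Y ⟶ Z) (fg : W ⟶ Y) (gk : X ⟶ Z)
    (fgk : W ⟶ Z) (h₁ : f ≫ g = fg) (h₂ : g ≫ k = gk) (h₃ : fg ≫ k = fgk) (h₄ : f ≫ gk = fgk)
    (M : (obj W).carrier) :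
    P.compApp fg k fgk h₃ M ≫
        (P.map k).functor.map (P.compApp f g fg h₁ M) =
      P.compApp f gk fgk h₄ M ≫
        P.compApp g k gk h₂ ((P.map f).functor.obj M) := by
  have h := congrArg (fun a => a.nat.app M) (P.assoc f g k fg gk fgk h₁ h₂ h₃ h₄)
  refine Eq.trans ?_ h
  exact congrArg (_ ≫ ·) (Category.comp_id _).symm

lemma id_comp_app {X Y : I} (f : X ⟶ Y) (M : (obj X).carrier) :
    P.compApp (𝟙 X) f f (Category.id_comp f) M ≫
      (P.map f).functor.map (P.idApp X M) = 𝟙 _ := by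
  have h := congrArg (fun a => a.nat.app M) (P.id_comp f)
  refine Eq.trans ?_ h
  exact congrArg (_ ≫ ·) (Category.comp_id _).symm

lemma comp_id_app {X Y : I} (f : X ⟶ Y) (M : (obj X).carrier) :
    P.compApp f (𝟙 Y) f (Category.comp_id f) M ≫
      P.idApp Y ((P.map f).functor.obj M) = 𝟙 _ := by
  have h := congrArg (fun a => a.nat.app M) (P.comp_id f)
  refine Eq.trans ?_ h
  exact congrArg (_ ≫ ·) (Category.comp_id _).symm

variable {P} [∀ X, ReflexiveTensor (obj X).carrier]
  {A : ∀ X, (obj X).carrier} [∀ X, MonObj (A X)] [∀ X, IsCommMonObj (A X)]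
  {T : ∀ X, ModTensor (A X)} {φ : ∀ {X Y : I} (f : X ⟶ Y), (P.map f).functor.obj (A X) ⟶ A Y}
  {F' : ∀ {X Y : I} (_ : X ⟶ Y), (T X).toSymMonCat ⟶ (T Y).toSymMonCat}
  {l : ∀ {X Y : I} (f : X ⟶ Y), ModLift (P.map f) (φ f) (T X) (T Y) (F' f)}
  (hl : ∀ {X Y : I} (f : X ⟶ Y), (l f).IsUniv)
  (hid : ∀ X, P.idApp X (A X) ≫ 𝟙 (A X) = φ (𝟙 X))
  (hcomp : ∀ {X Y Z : I} (f : X ⟶ Y) (g : Y ⟶ Z) (fg : X ⟶ Z) (h : f ≫ g = fg),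
    P.compApp f g fg h (A X) ≫ (P.map g).functor.map (φ f) ≫ φ g = φ fg)

/-- The unit comparison between lifts. -/
noncomputable def modId (X : I) : F' (𝟙 X) ≅ 𝟙 (T X).toSymMonCat :=
  ModLift.cellIso (hl (𝟙 X)) (ModLift.isUniv_id (T X)) (P.mapId X) (hid X)

/-- The component of the unit comparison between lifts at a module. -/
noncomputable def modIdApp (X : I) (M : (T X).toSymMonCat.carrier) : (F' (𝟙 X)).functor.obj M ⟶ M :=
  (modId hl hid X).hom.nat.app M

lemma modId_fac (X : I) (M : (T X).toSymMonCat.carrier) :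
    (l (𝟙 X)).app M ≫ (T X).forget.map (modIdApp hl hid X M) =
      P.idApp X ((T X).forget.obj M) :=
  (ModLift.cellIso_fac (hl (𝟙 X)) (ModLift.isUniv_id (T X)) (P.mapId X) (hid X) M).trans
    (Category.comp_id _)

variable [∀ {X Y : I} (f : X ⟶ Y), IsMonHom (φ f)]
  [∀ {X Y : I} (f : X ⟶ Y), PreservesColimitsOfShape WalkingReflexivePair (P.map f).functor]

/-- The composition comparison between lifts. -/
noncomputable def modComp {X Y Z : I} (f : X ⟶ Y) (g : Y ⟶ Z) (fg : X ⟶ Z) (h : f ≫ g = fg) :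
    F' fg ≅ F' f ≫ F' g :=
  ModLift.cellIso (hl fg) ((hl f).comp (hl g)) (P.mapComp f g fg h) (hcomp f g fg h)

/-- The component of a composition comparison between lifts at a module. -/
noncomputable def modCompApp {X Y Z : I} (f : X ⟶ Y) (g : Y ⟶ Z) (fg : X ⟶ Z) (h : f ≫ g = fg)
    (M : (T X).toSymMonCat.carrier) :
    (F' fg).functor.obj M ⟶ (F' g).functor.obj ((F' f).functor.obj M) :=
  (modComp hl hcomp f g fg h).hom.nat.app M

lemma modComp_fac {X Y Z : I} (f : X ⟶ Y) (g : Y ⟶ Z) (fg : X ⟶ Z) (h : f ≫ g = fg)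
    (M : (T X).toSymMonCat.carrier) :
    (l fg).app M ≫ (T Z).forget.map (modCompApp hl hcomp f g fg h M) =
      P.compApp f g fg h ((T X).forget.obj M) ≫
        (P.map g).functor.map ((l f).app M) ≫ (l g).app ((F' f).functor.obj M) :=
  ModLift.cellIso_fac (hl fg) ((hl f).comp (hl g)) (P.mapComp f g fg h) (hcomp f g fg h) M

/-- The pseudofunctor of modules formed by universal lifts of a pseudofunctor along a compatible
family of maps of monoids. -/
noncomputable def modPseudo : PseudoOn (fun X => (T X).toSymMonCat) where
  map f := F' f
  mapId := modId hl hid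
  mapComp := modComp hl hcomp
  assoc {W X Y Z} f g k fg gk fgk h₁ h₂ h₃ h₄ := ModLift.cell_ext (hl fgk) fun M => by
    have e1 := modComp_fac hl hcomp fg k fgk h₃ M
    have e2 := modComp_fac hl hcomp f g fg h₁ M
    have e3 := modComp_fac hl hcomp f gk fgk h₄ M
    have e4 := modComp_fac hl hcomp g k gk h₂ ((F' f).functor.obj M)
    have e5 := P.assoc_app f g k fg gk fgk h₁ h₂ h₃ h₄ ((T W).forget.obj M)
    have e6 := (l k).nat (modCompApp hl hcomp f g fg h₁ M)
    have e7 := P.compApp_naturality g k gk h₂ ((l f).app M)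
    have key : (l fgk).app M ≫ (T Z).forget.map (modCompApp hl hcomp fg k fgk h₃ M ≫
        (F' k).functor.map (modCompApp hl hcomp f g fg h₁ M)) =
        (l fgk).app M ≫ (T Z).forget.map (modCompApp hl hcomp f gk fgk h₄ M ≫
          modCompApp hl hcomp g k gk h₂ ((F' f).functor.obj M)) := by
      rw [CategoryTheory.Functor.map_comp, CategoryTheory.Functor.map_comp, reassoc_of% e1,
        reassoc_of% e3, e4, ← e6, ← CategoryTheory.Functor.map_comp_assoc, e2,
        CategoryTheory.Functor.map_comp_assoc, reassoc_of% e5, reassoc_of% e7,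
        CategoryTheory.Functor.map_comp_assoc]
    refine Eq.trans ?_ key
    exact congrArg (fun t => (l fgk).app M ≫ (T Z).forget.map t)
      (congrArg (_ ≫ ·) (Category.comp_id _))
  id_comp {X Y} f := ModLift.cell_ext (hl f) fun M => by
    have e1 := modComp_fac hl hcomp (𝟙 X) f f (Category.id_comp f) M
    have e2 := modId_fac hl hid X M
    have e3 := P.id_comp_app f ((T X).forget.obj M)
    have e4 := (l f).nat (modIdApp hl hid X M)
    have key : (l f).app M ≫ (T Y).forget.map (modCompApp hl hcomp (𝟙 X) f f (Category.id_comp f)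
      M ≫
        (F' f).functor.map (modIdApp hl hid X M)) = (l f).app M ≫ (T Y).forget.map (𝟙 _) := by
      rw [CategoryTheory.Functor.map_comp, reassoc_of% e1, ← e4,
        ← CategoryTheory.Functor.map_comp_assoc, e2, reassoc_of% e3,
        CategoryTheory.Functor.map_id, Category.comp_id]
    refine Eq.trans ?_ key
    exact congrArg (fun t => (l f).app M ≫ (T Y).forget.map t)
      (congrArg (_ ≫ ·) (Category.comp_id _))
  comp_id {X Y} f := ModLift.cell_ext (hl f) fun M => by
    have e1 := modComp_fac hl hcomp f (𝟙 Y) f (Category.comp_id f) M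
    have e2 := modId_fac hl hid Y ((F' f).functor.obj M)
    have e3 := P.comp_id_app f ((T X).forget.obj M)
    have e4 := P.idApp_naturality Y ((l f).app M)
    have key : (l f).app M ≫ (T Y).forget.map (modCompApp hl hcomp f (𝟙 Y) f (Category.comp_id f)
      M ≫
        modIdApp hl hid Y ((F' f).functor.obj M)) = (l f).app M ≫ (T Y).forget.map (𝟙 _) := by
      rw [CategoryTheory.Functor.map_comp, reassoc_of% e1, e2, e4, reassoc_of% e3,
        CategoryTheory.Functor.map_id, Category.comp_id]
    refine Eq.trans ?_ key
    exact congrArg (fun t => (l f).app M ≫ (T Y).forget.map t)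
      (congrArg (_ ≫ ·) (Category.comp_id _))

end PseudoOn

end Pseudofunctor

/-! ### The Mackey functor of modules -/

section Aux

variable {A B : SymMonCat.{v, u}} {R : A.carrier} [MonObj R] [IsCommMonObj R] {S : B.carrier}
  [MonObj S] [IsCommMonObj S] {F : A ⟶ B} {φ : F.functor.obj R ⟶ S} [IsMonHom φ]
  {TR : ModTensor R} {TS : ModTensor S} {F' : TR.toSymMonCat ⟶ TS.toSymMonCat}

/-- The coequalizer diagrams in `IsExt` and in `ModLift.IsExtension` differ by the commutativity of
`S`. -/
lemma ModLift.IsUniv.isExtension {l : ModLift F φ TR TS F'} (hl : l.IsUniv) : l.IsExtension := by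
  intro M
  have h := (hl M).coeq
  have e : (S ◁ φ ≫ μ[S]) = (β_ S (F.functor.obj R)).hom ≫ φ ▷ S ≫ μ[S] := by
    rw [← BraidedCategory.braiding_naturality_right_assoc, IsCommMonObj.mul_comm]
  rw [e] at h
  exact h

omit [IsCommMonObj R] in
/-- Monoidal transformations are maps of monoids at monoids. -/
lemma isMonHom_app {F₂ : A ⟶ B} (α : F ⟶ F₂) : IsMonHom (α.nat.app R) where
  one_hom := by
    rw [Functor.obj.η_def, Functor.obj.η_def, Category.assoc, NatTrans.naturality,
      NatTrans.IsMonoidal.unit_assoc]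
  mul_hom := by
    rw [Functor.obj.μ_def, Functor.obj.μ_def, Category.assoc, NatTrans.naturality,
      NatTrans.IsMonoidal.tensor_assoc]

omit [IsCommMonObj R] in
/-- The monoid structures on `K (F R)` obtained from `F ≫ K` and by applying `F` and `K` in turn are
equal, but not by definition. -/
lemma isMonHom_of_comp {D : SymMonCat.{v, u}} (F : A ⟶ B) (K : B ⟶ D) {U : D.carrier} [MonObj U]
    (f : K.functor.obj (F.functor.obj R) ⟶ U)
    (hf : IsMonHom (M := (F ≫ K).functor.obj R) f) : IsMonHom f where
  one_hom := by
    have h := hf.one_hom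
    rw [← h]
    refine congrArg (· ≫ f) ?_
    change Functor.LaxMonoidal.ε K.functor ≫
        K.functor.map (Functor.LaxMonoidal.ε F.functor ≫ F.functor.map η[R]) =
      (Functor.LaxMonoidal.ε K.functor ≫ K.functor.map (Functor.LaxMonoidal.ε F.functor)) ≫
        K.functor.map (F.functor.map η[R])
    rw [K.functor.map_comp, Category.assoc]
  mul_hom := by
    have h := hf.mul_hom
    refine Eq.trans ?_ h
    refine congrArg (· ≫ f) ?_
    change Functor.LaxMonoidal.μ K.functor _ _ ≫
        K.functor.map (Functor.LaxMonoidal.μ F.functor R R ≫ F.functor.map μ[R]) =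
      (Functor.LaxMonoidal.μ K.functor _ _ ≫ K.functor.map (Functor.LaxMonoidal.μ F.functor R R)) ≫
        K.functor.map (F.functor.map μ[R])
    rw [K.functor.map_comp, Category.assoc]

end Aux

variable {G : Type w} [Group G] [Finite G] {O : IndexingSystem G}
  {obj : Orb G → SymMonCat.{v, u}} {C : MackeyFunctor O obj}

lemma MackeyFunctor.GoodCoequalizers.reflexiveTensor (hC : C.GoodCoequalizers) (X : Orb G) :
    ReflexiveTensor (obj X).carrier :=
  ⟨hC.has X, hC.tensor X⟩

namespace NormData

variable (R : NormData C)

lemma compApp_resHom {X Y : Orb G} (f : X ⟶ Y) :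
    C.res.compApp (Orb.toPt Y).op f.op (Orb.toPt X).op
      (Quiver.Hom.unop_inj (Orb.hom_pt_ext _ _)) R.R ≫ R.resHom f = 𝟙 _ := by
  have h := (C.res.mapComp (Orb.toPt Y).op f.op (Orb.toPt X).op
    (Quiver.Hom.unop_inj (Orb.hom_pt_ext _ _))).hom_inv_id
  exact congrArg (fun a => a.nat.app R.R) h

/-- The isomorphisms `f^* R_Y ≅ R_X` are compatible with composition. -/
lemma resHom_compApp {X Y : Orb G} (f : X ⟶ Y) :
    R.resHom f ≫ C.res.compApp (Orb.toPt Y).op f.op (Orb.toPt X).op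
      (Quiver.Hom.unop_inj (Orb.hom_pt_ext _ _)) R.R = 𝟙 _ := by
  have h := (C.res.mapComp (Orb.toPt Y).op f.op (Orb.toPt X).op
    (Quiver.Hom.unop_inj (Orb.hom_pt_ext _ _))).inv_hom_id
  exact congrArg (fun a => a.nat.app R.R) h

instance {X Y : Orb G} (f : X ⟶ Y) : IsIso (R.resHom f) :=
  ⟨_, R.resHom_compApp f, R.compApp_resHom f⟩

instance {X Y : Orb G} (f : X ⟶ Y) : IsMonHom (R.resHom f) :=
  isMonHom_of_comp _ _ _ (isMonHom_app _)

lemma resHom_id (X : Orb G) : R.resHom (𝟙 X) = C.res.idApp (op X) (R.at' X) := by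
  have h1 := R.resHom_compApp (𝟙 X)
  have h2 := C.res.comp_id_app (Orb.toPt X).op R.R
  exact (Category.comp_id _).symm.trans ((congrArg (R.resHom (𝟙 X) ≫ ·) h2.symm).trans
    ((Category.assoc _ _ _).symm.trans ((congrArg (· ≫ C.res.idApp (op X) (R.at' X)) h1).trans
      (Category.id_comp _))))

/-- The isomorphisms `f^* R_Y ≅ R_X` are compatible with composition. -/
lemma resHom_comp {X Y Z : Orb G} (f : X ⟶ Y) (g : Y ⟶ Z) (fg : X ⟶ Z) (h : g.op ≫ f.op = fg.op) :
    C.res.compApp g.op f.op fg.op h (R.at' Z) ≫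
      (C.res.map f.op).functor.map (R.resHom g) ≫ R.resHom f = R.resHom fg := by
  have h1 := R.compApp_resHom f
  have h2 := R.compApp_resHom g
  have h3 := R.resHom_compApp fg
  have h4 := C.res.assoc_app (Orb.toPt Z).op g.op f.op (Orb.toPt Y).op fg.op (Orb.toPt X).op
    (Quiver.Hom.unop_inj (Orb.hom_pt_ext _ _)) h (Quiver.Hom.unop_inj (Orb.hom_pt_ext _ _))
    (Quiver.Hom.unop_inj (Orb.hom_pt_ext _ _)) R.R
  have h5 := congrArg (C.res.map f.op).functor.map h2
  rw [CategoryTheory.Functor.map_comp, CategoryTheory.Functor.map_id] at h5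
  rw [← Category.id_comp (C.res.compApp g.op f.op fg.op h (R.at' Z) ≫ _), ← h3, Category.assoc,
    ← reassoc_of% h4, reassoc_of% h5, h1, Category.comp_id]

end NormData

section Transfer

variable (R : OCommMonoid C) {T : ∀ X : Orb G, ModTensor (R.at' X)}
  {res : PseudoOn (fun X : (Orb G)ᵒᵖ => (T X.unop).toSymMonCat)}
  {norm : PseudoOn (fun X : AdmOrb O => (T X.obj).toSymMonCat)}
  (lr : ∀ {X Y : Orb G} (f : X ⟶ Y), ModLift (C.res.map f.op) (R.resHom f) (T Y) (T X)
    (res.map f.op))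
  (ln : ∀ {X Y : AdmOrb O} (f : X ⟶ Y),
    ModLift (C.norm.map f) (R.nu f) (T X.obj) (T Y.obj) (norm.map f))
  [∀ X, ReflexiveTensor (obj X).carrier]

/-- The lift of `M ↦ ⨂ᵢ N_{pᵢ} (qᵢ^* M)` to modules. -/
def transferLift {Z X : AdmOrb O} : ∀ L : List (AdmSpan Z X),
    ModLift (transferSum C.res C.norm L) (R.nuProd L) (T X.obj) (T Z.obj)
      (transferSum (obj := fun X => (T X).toSymMonCat) res norm L)
  | [] => ModLift.unitLift (T X.obj) (T Z.obj)
  | s :: L => ((lr s.right).comp (ln s.left)).tensor (transferLift L)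

variable [∀ {X Y : AdmOrb O} (f : X ⟶ Y),
  PreservesColimitsOfShape WalkingReflexivePair (C.norm.map f).functor]

/-- The right hand side of the double coset formula for modules is a universal lift. -/
lemma isUniv_transferLift (hlr : ∀ {X Y : Orb G} (f : X ⟶ Y), (lr f).IsUniv)
    (hln : ∀ {X Y : AdmOrb O} (f : X ⟶ Y), (ln f).IsUniv) {Z X : AdmOrb O} :
    ∀ L : List (AdmSpan Z X), (transferLift R lr ln L).IsUniv
  | [] => ModLift.isUniv_unitLift (T X.obj) (T Z.obj)
  | s :: L => ((hlr s.right).comp (hln s.left)).tensor (isUniv_transferLift hlr hln L)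

end Transfer

/-- `prodUnit` is the component of `transferLift`. -/
lemma ModuleMackey.prodUnit_eq {R : OCommMonoid C} (D : ModuleMackey R)
    [∀ X, ReflexiveTensor (obj X).carrier] {Z X : AdmOrb O}
    (M : (D.tensor X.obj).toSymMonCat.carrier) : ∀ L : List (AdmSpan Z X),
    D.prodUnit M L = (transferLift R D.resLift D.normLift L).app M
  | [] => rfl
  | s :: L => by
    have h := prodUnit_eq D M L
    rw [ModuleMackey.prodUnit, h]
    rfl

/-- The Mackey functor of modules, assembled from universal lifts. -/
theorem exists_moduleMackey (hC : C.GoodCoequalizers) (R : OCommMonoid C) :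
    ∃ D : ModuleMackey R, D.IsStandardRestriction ∧ D.IsRelativeNorm ∧ D.IsInducedDoubleCoset := by
  have hrt := hC.reflexiveTensor
  have hr := @hC.res
  have hn := @hC.norm
  let T : ∀ X : Orb G, ModTensor (R.at' X) := fun X => ModCat.modTensor (R.at' X)
  choose rF rl hrl using fun {X Y : Orb G} (f : X ⟶ Y) =>
    exists_lift_isUniv (C.res.map f.op) (R.resHom f) (T Y) (T X)
  choose nF nl hnl using fun {X Y : AdmOrb O} (f : X ⟶ Y) =>
    exists_lift_isUniv (C.norm.map f) (R.nu f) (T X.obj) (T Y.obj)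
  have hrl' : ∀ {X Y : (Orb G)ᵒᵖ} (f : X ⟶ Y), (rl f.unop).IsUniv := fun f => hrl f.unop
  have hnl' : ∀ {X Y : AdmOrb O} (f : X ⟶ Y), (nl f).IsUniv := fun f => hnl f
  have : ∀ {X Y : (Orb G)ᵒᵖ} (f : X ⟶ Y), IsMonHom (R.resHom f.unop) := fun _ => inferInstance
  have : ∀ {X Y : (Orb G)ᵒᵖ} (f : X ⟶ Y),
    PreservesColimitsOfShape WalkingReflexivePair (C.res.map f).functor := fun f => hr f.unop
  have : ∀ X : (Orb G)ᵒᵖ, ReflexiveTensor (obj X.unop).carrier := fun X => hrt X.unop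
  have hrid : ∀ X : (Orb G)ᵒᵖ, C.res.idApp X (R.at' X.unop) ≫ 𝟙 (R.at' X.unop) =
      R.resHom (𝟙 X.unop) := fun X => by rw [R.resHom_id, Category.comp_id]
  have hrcomp : ∀ {X Y Z : (Orb G)ᵒᵖ} (f : X ⟶ Y) (g : Y ⟶ Z) (fg : X ⟶ Z) (h : f ≫ g = fg),
      C.res.compApp f g fg h (R.at' X.unop) ≫
        (C.res.map g).functor.map (R.resHom f.unop) ≫ R.resHom g.unop = R.resHom fg.unop :=
    fun f g fg h => R.resHom_comp g.unop f.unop fg.unop h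
  have hnid : ∀ X : AdmOrb O, C.norm.idApp X (R.at' X.obj) ≫ 𝟙 (R.at' X.obj) = R.nu (𝟙 X) :=
    fun X => by rw [R.nu_id, Category.comp_id]; rfl
  have hncomp : ∀ {X Y Z : AdmOrb O} (f : X ⟶ Y) (g : Y ⟶ Z) (fg : X ⟶ Z) (h : f ≫ g = fg),
      C.norm.compApp f g fg h (R.at' X.obj) ≫
        (C.norm.map g).functor.map (R.nu f) ≫ R.nu g = R.nu fg := by
    intro X Y Z f g fg h
    subst h
    exact (R.nu_comp f g).symm
  let res : PseudoOn (fun X : (Orb G)ᵒᵖ => (T X.unop).toSymMonCat) :=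
    PseudoOn.modPseudo (P := C.res) (A := fun X => R.at' X.unop) (T := fun X => T X.unop)
      (φ := fun f => R.resHom f.unop) (F' := fun f => rF f.unop) (l := fun f => rl f.unop)
      hrl' hrid hrcomp
  let norm : PseudoOn (fun X : AdmOrb O => (T X.obj).toSymMonCat) :=
    PseudoOn.modPseudo (P := C.norm) (A := fun X => R.at' X.obj) (T := fun X => T X.obj)
      (φ := fun f => R.nu f) (F' := fun f => nF f) (l := fun f => nl f) hnl' hnid hncomp
  let D : ModuleMackey R :=
    { tensor := T
      mackey :=
        { res := res
          norm := norm
          doubleCoset := fun f g L h =>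
            ModLift.cellIso ((hnl f).comp (hrl g))
              (isUniv_transferLift R (res := res) (norm := norm) (fun f => rl f) (fun f => nl f)
                (fun f => hrl f) (fun f => hnl f) L)
              (C.doubleCoset f g L h) (R.nu_res f g L h).symm }
      resLift := fun f => rl f
      normLift := fun f => nl f }
  refine ⟨D, ⟨?_, ?_, ?_⟩, ⟨?_, ?_, ?_⟩, ?_⟩
  · intro X Y f M
    exact (hrl f M).isIso (((T Y).isAct_act M).map (C.res.map f.op).functor)
  · intro X M
    exact PseudoOn.modId_fac (P := C.res) (A := fun X => R.at' X.unop) (T := fun X => T X.unop)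
      (φ := fun f => R.resHom f.unop) (F' := fun f => rF f.unop) (l := fun f => rl f.unop)
      hrl' hrid (op X) M
  · intro X Y Z f g M
    exact PseudoOn.modComp_fac (P := C.res) (A := fun X => R.at' X.unop) (T := fun X => T X.unop)
      (φ := fun f => R.resHom f.unop) (F' := fun f => rF f.unop) (l := fun f => rl f.unop)
      hrl' hrcomp g.op f.op (f ≫ g).op rfl M
  · intro X Y f
    exact (hnl f).isExtension
  · intro X M
    exact PseudoOn.modId_fac (P := C.norm) (A := fun X => R.at' X.obj) (T := fun X => T X.obj)
      (φ := fun f => R.nu f) (F' := fun f => nF f) (l := fun f => nl f) hnl' hnid X M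
  · intro X Y Z f g M
    exact PseudoOn.modComp_fac (P := C.norm) (A := fun X => R.at' X.obj) (T := fun X => T X.obj)
      (φ := fun f => R.nu f) (F' := fun f => nF f) (l := fun f => nl f) hnl' hncomp f g _ rfl M
  · intro X Y Z f g L h M
    have key := ModLift.cellIso_fac ((hnl f).comp (hrl g))
      (isUniv_transferLift R (res := res) (norm := norm) (fun f => rl f) (fun f => nl f)
        (fun f => hrl f) (fun f => hnl f) L)
      (C.doubleCoset f g L h) (R.nu_res f g L h).symm M
    rw [D.prodUnit_eq]
    exact (Category.assoc _ _ _).symm.trans key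

end EqSym

theorem mainTheorem3 {G : Type w} [Group G] [Finite G] (O : EqSym.IndexingSystem G)
    (obj : EqSym.Orb G → EqSym.SymMonCat.{v, u}) (C : EqSym.MackeyFunctor O obj)
    (hC : C.GoodCoequalizers) (R : EqSym.OCommMonoid C) :
    ∃ D : EqSym.ModuleMackey R,
      D.IsStandardRestriction ∧ D.IsRelativeNorm ∧ D.IsInducedDoubleCoset :=
  EqSym.exists_moduleMackey hC R
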